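/- Let $\mathbb F$ be a field or skew field with an involution $\alpha\mapsto\bar\alpha$ (a bijection with $\overline{\alpha+\beta}=\bar\alpha+\bar\beta$, $\overline{\alpha\beta}=\bar\beta\bar\alpha$, $\bar{\bar\alpha}=\alpha$; possibly the identity if $\mathbb F$ is a field), let $V$ be a finite-dimensional right vector space over $\mathbb F$, $U$ a subspace of $V$, and let $\mathcal G$ be a sesquilinear form $U\times V\to\mathbb F$ or $(V/U)\times V\to\mathbb F$, i.e. a biadditive map with $\mathcal G(u\alpha,v\beta)=\bar\alpha\,\mathcal G(u,v)\,\beta$. Consider bases $e_1,\dots,e_n$ of $V$ such that $e_1,\dots,e_m$ is a basis of $U$ (if $\mathcal G\colon U\times V\to\mathbb F$), respectively $e_{m+1},\dots,e_n$ is a basis of $U$ (if $\mathcal G\colon (V/U)\times V\to\mathbb F$). The matrix of $\mathcal G$ in such a basis is the $m\times n$ block matrix $[A|B]=[\alpha_{ij}]$ with $\alpha_{ij}=\mathcal G(e_i,e_j)$, respectively $\alpha_{ij}=\mathcal G(e_i+U,e_j)$, where $A$ is $m\times m$. The block-direct sum is $[A_1|B_1]\uplus[A_2|B_2]:=[A_1\oplus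 A_2\,|\,B_1\oplus B_2]$. Let $J_q(\lambda)$ be the upper triangular $q\times q$ Jordan block, $E_q=(0,\dots,0,1)^T$ the column of height $q\ge1$, and $E_0=0_{01}$ the $0\times 1$ matrix. Let $S^*=[\bar s_{ji}]$ for $S=[s_{ij}]$; matrices $K,K'$ are *congruent if $K'=S^*KS$ for some nonsingular $S$ (congruent, if the involution is the identity). (a) There is such a basis of $V$ in which the matrix of $\mathcal G$ is a block-direct sum of a matrix $[K|0_{p0}]$ with $K$ a nonsingular $p\times p$ matrix, and of matrices of the form $[J_q(0)|0_{q0}]$ ($q\ge1$) and $[J_q(0)|E_q]$ ($q\ge0$); any of these summands may be absent. The block $K$ is determined by $\mathcal G$ uniquely up to *congruence, and the summands $[J_q(0)|0_{q0}]$, $[J_q(0)|E_q]$ are determined by $\mathcal G$ uniquely up to permutation. (b) Let $\mathbb F=\mathbb C$, with the identity involution or with complex conjugation. Let $\Gamma_n$ be the $n\times n$ matrix with $(i,j)$ entry $(-1)^{n-i}$ if $i+j\in\{n+1,n+2\}$ and $0$ otherwise, and $\Delta_n$ the $n\times n$ matrix with $(i,j)$ entry $1$ if $i+j=n+1$, $\sqrt{-1}$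 if $i+j=n+2$, and $0$ otherwise. Then in each direct sum as in (a) one can replace the summand $[K|0_{p0}]$ by $[K_1|0_{p_10}]\uplus\dots\uplus[K_s|0_{p_s0}]$, where each $K_i$ is $p_i\times p_i$ and $K_1\oplus\dots\oplus K_s$ is the Horn–Sergeichuk canonical form of $K$, that is, a direct sum that is *congruent to $K$ (congruent, for the identity involution) and whose summands $K_i$ have - in the case of the identity involution, the form $J_n(0)$, $\Gamma_n$, or $\begin{bmatrix}0&I_n\\J_n(\lambda)&0\end{bmatrix}$ with $\lambda\ne0$, $\lambda\ne(-1)^{n+1}$, where $\lambda$ is determined up to replacement by $\lambda^{-1}$; - in the case of complex conjugation, the form $J_n(0)$, $\lambda\Gamma_n$ with $|\lambda|=1$, or $\begin{bmatrix}0&I_n\\J_n(\mu)&0\end{bmatrix}$ with $|\mu|>1$; alternatively, $\Delta_n$ may be used throughout instead of $\Gamma_n$ ($n\ge1$ in all cases; since $K$ is nonsingular, no $J_n(0)$ actually occurs among the $K_i$). The resulting block-direct sum is a matrix of $\mathcal G$ and is determined by $\mathcal G$ uniquely up to permutation of summands (and, in the case of the identity involution, up to the replacements of $\lambda$ by $\lambda^{-1}$);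 thus it is a canonical matrix of $\mathcal G$. -/

import Mathlib

/-- `σ` is an involution on the field or skew field `F`: an additive, multiplication-reversing
map that is its own inverse (in particular a bijection). -/
structure IsInvolution {F : Type*} [DivisionRing F] (σ : F → F) : Prop where
  map_add : ∀ a b, σ (a + b) = σ a + σ b
  map_mul : ∀ a b, σ (a * b) = σ b * σ a
  involutive : ∀ a, σ (σ a) = a

/-- The conjugate transpose `[σ (a j i)]` of a matrix, for the involution `σ`. -/
def conjTr {F : Type*} (σ : F → F) {ι κ : Type*} (A : Matrix ι κ F) : Matrix κ ι F :=
  Matrix.of fun i j => σ (A j i)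

/-- `*`-congruence of square matrices (congruence, if `σ` is the identity of a field):
`S^* K S = K'` for some nonsingular `S`. The matrices may have different index types;
nonsingularity of `S` (a two-sided inverse `R`) forces them to have equal sizes. -/
def StarCongruent {F : Type*} [DivisionRing F] (σ : F → F) {ι κ : Type*}
    [Fintype ι] [Fintype κ] [DecidableEq ι] [DecidableEq κ]
    (K : Matrix ι ι F) (K' : Matrix κ κ F) : Prop :=
  ∃ (S : Matrix ι κ F) (R : Matrix κ ι F),
    S * R = 1 ∧ R * S = 1 ∧ conjTr σ S * K * S = K'

/-- A block matrix `[A|B]` in which `A` is square; rows and columns of `A` are indexed by `ι`,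
the columns of `B` by `κ`. -/
structure BlockMatrix (F : Type*) where
  ι : Type
  κ : Type
  fintypeι : Fintype ι
  fintypeκ : Fintype κ
  decEqι : DecidableEq ι
  decEqκ : DecidableEq κ
  A : Matrix ι ι F
  B : Matrix ι κ F

attribute [instance] BlockMatrix.fintypeι BlockMatrix.fintypeκ
  BlockMatrix.decEqι BlockMatrix.decEqκ

namespace BlockMatrix

/-- The block matrix `[A|B]`. -/
def mk' {F : Type*} {ι κ : Type} [Fintype ι] [Fintype κ] [DecidableEq ι] [DecidableEq κ]
    (A : Matrix ι ι F) (B : Matrix ι κ F) : BlockMatrix F :=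
  ⟨ι, κ, inferInstance, inferInstance, inferInstance, inferInstance, A, B⟩

/-- The block matrix `[K|0]` in which the second block has no columns. -/
def regular {F : Type*} [Zero F] {ι : Type} [Fintype ι] [DecidableEq ι]
    (K : Matrix ι ι F) : BlockMatrix F :=
  mk' K (0 : Matrix ι (Fin 0) F)

/-- The block-direct sum `[A₁ ⊕ A₂ | B₁ ⊕ B₂]` of `[A₁|B₁]` and `[A₂|B₂]`. -/
def sum {F : Type*} [Zero F] (M N : BlockMatrix F) : BlockMatrix F :=
  mk' (Matrix.fromBlocks M.A 0 0 N.A) (Matrix.fromBlocks M.B 0 0 N.B)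

/-- The block-direct sum of a list of block matrices; the empty sum has no rows or columns. -/
def listSum {F : Type*} [Zero F] : List (BlockMatrix F) → BlockMatrix F
  | [] => mk' (0 : Matrix (Fin 0) (Fin 0) F) (0 : Matrix (Fin 0) (Fin 0) F)
  | M :: l => M.sum (listSum l)

end BlockMatrix

/-- The upper triangular Jordan block `J_q(c)`. -/
def jordanBlock {F : Type*} [Zero F] [One F] (q : ℕ) (c : F) : Matrix (Fin q) (Fin q) F :=
  Matrix.of fun i j => if i = j then c else if (i : ℕ) + 1 = j then 1 else 0

/-- The column `E_q = (0, …, 0, 1)ᵀ` of height `q`; `E_0` is the `0`-by-`1` matrix. -/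
def lastColumn (F : Type*) [Zero F] [One F] (q : ℕ) : Matrix (Fin q) (Fin 1) F :=
  Matrix.of fun i _ => if (i : ℕ) + 1 = q then 1 else 0

/-- The types of singular summands: `[J_q(0)|0_{q0}]` with `q ≥ 1`, and `[J_q(0)|E_q]`
with `q ≥ 0`. -/
inductive SingularSummand : Type
  | jordan (q : ℕ) (hq : 1 ≤ q)
  | jordanE (q : ℕ)

/-- The block matrix over `F` of a singular summand. -/
def SingularSummand.toBlock (F : Type*) [Zero F] [One F] : SingularSummand → BlockMatrix F
  | .jordan q _ => BlockMatrix.regular (jordanBlock q (0 : F))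
  | .jordanE q => BlockMatrix.mk' (jordanBlock q (0 : F)) (lastColumn F q)

/-- The block-direct sum of a list of singular summands. -/
def singularSum (F : Type*) [Zero F] [One F] (L : List SingularSummand) : BlockMatrix F :=
  BlockMatrix.listSum (L.map (SingularSummand.toBlock F))

open scoped RightActions in
/-- `g : U × V → F` is a sesquilinear form on right vector spaces over `F`. -/
structure IsSesquilinear {F : Type*} [DivisionRing F] (σ : F → F) {U V : Type*}
    [AddCommGroup U] [Module Fᵐᵒᵖ U] [AddCommGroup V] [Module Fᵐᵒᵖ V]
    (g : U → V → F) : Prop where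
  add_left : ∀ u u' v, g (u + u') v = g u v + g u' v
  smul_left : ∀ u (a : F) v, g (u <• a) v = σ a * g u v
  add_right : ∀ u v v', g u (v + v') = g u v + g u v'
  smul_right : ∀ u v (a : F), g u (v <• a) = g u v * a

/-- A sesquilinear form of one of the two kinds `U × V → F` and `(V/U) × V → F`, where `U` is a
subspace of the right vector space `V`. -/
inductive SubspaceForm {F : Type*} [DivisionRing F] (σ : F → F) {V : Type*}
    [AddCommGroup V] [Module Fᵐᵒᵖ V] (U : Submodule Fᵐᵒᵖ V)
  | onSub (g : U → V → F) (hg : IsSesquilinear σ g)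
  | onQuot (g : V ⧸ U → V → F) (hg : IsSesquilinear σ g)

/-- `G.HasMatrix M`: in some basis of `V` adapted to `U`, the matrix of `G` is `M = [A|B]`.
The basis consists of a first part, indexed by `M.ι`, and a second part, indexed by `M.κ`.
For a form `U × V → F` the first part is a basis of `U`, for a form `(V/U) × V → F` the second
part is a basis of `U`. -/
def SubspaceForm.HasMatrix {F : Type*} [DivisionRing F] {σ : F → F} {V : Type*}
    [AddCommGroup V] [Module Fᵐᵒᵖ V] {U : Submodule Fᵐᵒᵖ V} :
    SubspaceForm σ U → BlockMatrix F → Prop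
  | .onSub g _, M =>
      ∃ (e : Module.Basis (M.ι ⊕ M.κ) Fᵐᵒᵖ V) (hU : ∀ i, e (Sum.inl i) ∈ U),
        Submodule.span Fᵐᵒᵖ (Set.range fun i => e (Sum.inl i)) = U ∧
        (∀ i j, g ⟨e (Sum.inl i), hU i⟩ (e (Sum.inl j)) = M.A i j) ∧
        (∀ i j, g ⟨e (Sum.inl i), hU i⟩ (e (Sum.inr j)) = M.B i j)
  | .onQuot g _, M =>
      ∃ e : Module.Basis (M.ι ⊕ M.κ) Fᵐᵒᵖ V,
        Submodule.span Fᵐᵒᵖ (Set.range fun j => e (Sum.inr j)) = U ∧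
        (∀ i j, g (Submodule.Quotient.mk (e (Sum.inl i))) (e (Sum.inl j)) = M.A i j) ∧
        (∀ i j, g (Submodule.Quotient.mk (e (Sum.inl i))) (e (Sum.inr j)) = M.B i j)

/-- The `n`-by-`n` matrix `Γ_n`: the entries on the antidiagonal and on the diagonal just below
it are `1` in the last row, `-1` in the row above it, and so on with alternating signs;
the other entries are `0`. -/
def gammaMatrix (n : ℕ) : Matrix (Fin n) (Fin n) ℂ :=
  Matrix.of fun i j =>
    if (i : ℕ) + j + 1 = n ∨ (i : ℕ) + j = n then (-1) ^ (n - 1 - (i : ℕ)) else 0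

/-- The symmetric `n`-by-`n` matrix `Δ_n`: entries `1` on the antidiagonal, `i` on the diagonal
just below it, and `0` elsewhere. -/
def deltaMatrix (n : ℕ) : Matrix (Fin n) (Fin n) ℂ :=
  Matrix.of fun i j =>
    if (i : ℕ) + j + 1 = n then 1 else if (i : ℕ) + j = n then Complex.I else 0

/-- The `2n`-by-`2n` matrix with blocks `0, I_n` in the first row and `J_n(c), 0` in the
second row. -/
def hMatrix (n : ℕ) (c : ℂ) : Matrix (Fin n ⊕ Fin n) (Fin n ⊕ Fin n) ℂ :=
  Matrix.fromBlocks 0 1 (jordanBlock n c) 0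

/-- The types of summands of the Horn–Sergeichuk canonical form for congruence: `J_n(0)`, `Γ_n`,
and the matrix with blocks `0, I_n, J_n(c), 0` where `c ≠ 0` and `c ≠ (-1)^(n+1)`. -/
inductive CongruenceSummand : Type
  | jordan (n : ℕ) (hn : 1 ≤ n)
  | gamma (n : ℕ) (hn : 1 ≤ n)
  | h (n : ℕ) (hn : 1 ≤ n) (c : ℂ) (hc : c ≠ 0) (hc' : c ≠ (-1) ^ (n + 1))

namespace CongruenceSummand

/-- The block matrix `[K|0]` for a summand `K`. -/
noncomputable def toBlock : CongruenceSummand → BlockMatrix ℂ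
  | jordan n _ => BlockMatrix.regular (jordanBlock n 0)
  | gamma n _ => BlockMatrix.regular (gammaMatrix n)
  | h n _ c _ _ => BlockMatrix.regular (hMatrix n c)

/-- Equality of summands up to replacement of the parameter `c` by `c⁻¹`. -/
def SameUpToInverse : CongruenceSummand → CongruenceSummand → Prop
  | h n _ c _ _, h n' _ c' _ _ => n = n' ∧ (c' = c ∨ c' = c⁻¹)
  | s, s' => s = s'

/-- `[K₁|0] ⊎ ⋯ ⊎ [K_s|0]` for a list of summands; its `A`-block is `K₁ ⊕ ⋯ ⊕ K_s`. -/
noncomputable def blockSum (C : List CongruenceSummand) : BlockMatrix ℂ :=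
  BlockMatrix.listSum (C.map toBlock)

end CongruenceSummand

/-- The types of summands of the Horn–Sergeichuk canonical form for `*`-congruence: `J_n(0)`,
`c T_n` with `|c| = 1` (where `T_n` is `Γ_n` or, alternatively, `Δ_n`), and the matrix with
blocks `0, I_n, J_n(c), 0` where `|c| > 1`. -/
inductive StarCongruenceSummand : Type
  | jordan (n : ℕ) (hn : 1 ≤ n)
  | unimodular (n : ℕ) (hn : 1 ≤ n) (c : ℂ) (hc : ‖c‖ = 1)
  | h (n : ℕ) (hn : 1 ≤ n) (c : ℂ) (hc : 1 < ‖c‖)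

namespace StarCongruenceSummand

/-- The block matrix `[K|0]` for a summand `K`; `T` is the chosen family `Γ` or `Δ`. -/
noncomputable def toBlock (T : ∀ n, Matrix (Fin n) (Fin n) ℂ) :
    StarCongruenceSummand → BlockMatrix ℂ
  | jordan n _ => BlockMatrix.regular (jordanBlock n 0)
  | unimodular n _ c _ => BlockMatrix.regular (c • T n)
  | h n _ c _ => BlockMatrix.regular (hMatrix n c)

/-- `[K₁|0] ⊎ ⋯ ⊎ [K_s|0]` for a list of summands; its `A`-block is `K₁ ⊕ ⋯ ⊕ K_s`. -/
noncomputable def blockSum (T : ∀ n, Matrix (Fin n) (Fin n) ℂ)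
    (C : List StarCongruenceSummand) : BlockMatrix ℂ :=
  BlockMatrix.listSum (C.map (toBlock T))

end StarCongruenceSummand

/-!
**The regularizing decomposition.** A form on `U × V` and a form on `(V / U) × V` are treated
together, as a form `g` on `X × Y` with an injection `j : X → Y` or with a surjection `q : Y → X`.
Each kind has a derived form of the other kind on smaller spaces: an injection gives the form
`quotForm` on `(X / L) × X`, where `L` is the left kernel of `g`, and a surjection gives the form
`subForm` on `N × X`, where `N` is the left annihilator of `ker q`. The total dimension
never grows, and it drops in every step that starts from an injection, until `j` is bijective and
`g` is nondegenerate, that is, until only a nonsingular matrix is left.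

In terms of matrices, the summands `[J_q(0)|0]` and `[J_q(0)|E_q]` are chains of basis vectors in
which each row is paired with the next column. A decomposition into a nonsingular part and chains
induces one of the derived form, with the same nonsingular part and with shortened chains
(`SubHas.push`, `QuotHas.push`), and it can be rebuilt from one of the derived form
(`SubHas.lift`, `QuotHas.lift`). By induction along the derived forms this gives the existence of
a decomposition (`decomposes_of_finrank`) and its uniqueness (`unique_of_finrank`): the nonsingular
part is the matrix of the nondegenerate form at the end, and the chains are determined by those of
the derived form and by the dimension. With `hasMatrix_iff` the complex case becomes the
classification of nonsingular complex matrices up to congruence and `*`-congruence.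

**Canonical forms, existence.** A nonsingular matrix is the matrix of a nondegenerate form `B`,
sesquilinear for `σ`, with a cosquare `Φ`: `B x y = σ (B (Φ y) x)`. The operators `Φ - c` and
`Φ - (σ c)⁻¹` are adjoint to each other up to `Φ` and a scalar. A chain of maximal length `n` for
an eigenvalue `c` is therefore paired to a chain of the same length for `(σ c)⁻¹` (`exists_pair`).
If `c ≠ (σ c)⁻¹`, the two chains span a subspace that splits off with the matrix
`[0, I; J_n(c), 0]` (`IsCosquare.exists_hMatrix_of_ne`). If `c = (σ c)⁻¹`, the height pairing
`B ((Φ - c) ^ (n - 1) x) z` on the kernel of `(Φ - c) ^ n` is, up to a scalar, Hermitian in the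
sesquilinear case, and symmetric or skew-symmetric in the bilinear case. So one chain, or two chains
in the skew-symmetric case, span a subspace that splits off
(`IsCosquare.exists_isRegularSubspace_of_chains`). It is compared with the canonical summand whose
cosquare has the same Jordan form: the two forms differ by a selfadjoint operator, and a square root
of it that is a polynomial in it makes them isometric (`Realizes.of_similar_id`). In the
sesquilinear case the polynomial must have real coefficients, and the forms are isometric up to sign
(`Realizes.of_cyclic`). Splitting off summands repeatedly ends with a canonical form
(`exists_realizes_listSum`).

**Canonical forms, uniqueness.** A quantity that is additive over orthogonal decompositions takes on
a canonical form the sum of its values on the summands (`invariant_listSum`). The dimensions of the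
kernels of `(Φ - d) ^ k` determine the Jordan cells of the cosquare (`HasJordanBasis.finrank_ker`),
and these determine the summands in the bilinear case up to inversion of the parameters
(`CongruenceSummand.rel_of_bind_cells_eq`). In the sesquilinear case they determine the summands
`[0, I; J_n(μ), 0]`. The summands `a T_n` and `-a T_n`, where `T` is `Γ` or `Δ` and `‖a‖ = 1`, have
the same cosquare, and they are told apart by the positive index of inertia of the Hermitian form
given by the height pairing (`HasIndex`).
-/

section regularization
open MulOpposite

/-! ### Sesquilinear maps over a skew field -/

namespace IsInvolution
variable {F : Type*} [DivisionRing F] {σ : F → F}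

theorem map_zero (hσ : IsInvolution σ) : σ 0 = 0 := by
  have := hσ.map_add 0 0
  simpa using this

theorem map_one (hσ : IsInvolution σ) : σ 1 = 1 := by
  have := hσ.map_mul (σ 1) 1
  rw [mul_one, hσ.involutive, mul_one] at this
  exact this.symm

theorem eq_zero (hσ : IsInvolution σ) {a : F} (h : σ a = 0) : a = 0 := by
  rw [← hσ.involutive a, h, hσ.map_zero]

theorem map_sum (hσ : IsInvolution σ) {ι : Type*} (s : Finset ι) (f : ι → F) :
    σ (∑ i ∈ s, f i) = ∑ i ∈ s, σ (f i) :=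
  _root_.map_sum (AddMonoidHom.mk' σ hσ.map_add) f s

end IsInvolution

namespace IsSesquilinear
variable {F : Type*} [DivisionRing F] {σ : F → F} {X Y : Type*}
  [AddCommGroup X] [Module Fᵐᵒᵖ X] [AddCommGroup Y] [Module Fᵐᵒᵖ Y] {g : X → Y → F}

theorem zero_left (h : IsSesquilinear σ g) (y : Y) : g 0 y = 0 := by
  have := h.add_left 0 0 y
  simpa using this

theorem zero_right (h : IsSesquilinear σ g) (x : X) : g x 0 = 0 := by
  have := h.add_right x 0 0
  simpa using this

theorem neg_right (h : IsSesquilinear σ g) (x : X) (y : Y) : g x (-y) = -g x y := by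
  rw [eq_neg_iff_add_eq_zero, ← h.add_right, neg_add_cancel, h.zero_right]

theorem sub_right (h : IsSesquilinear σ g) (x : X) (y z : Y) : g x (y - z) = g x y - g x z := by
  rw [sub_eq_add_neg, h.add_right, h.neg_right, sub_eq_add_neg]

theorem neg_left (h : IsSesquilinear σ g) (x : X) (y : Y) : g (-x) y = -g x y := by
  rw [eq_neg_iff_add_eq_zero, ← h.add_left, neg_add_cancel, h.zero_left]

theorem sub_left (h : IsSesquilinear σ g) (x z : X) (y : Y) : g (x - z) y = g x y - g z y := by
  rw [sub_eq_add_neg, h.add_left, h.neg_left, sub_eq_add_neg]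

theorem op_smul_left (h : IsSesquilinear σ g) (a : Fᵐᵒᵖ) (x : X) (y : Y) :
    g (a • x) y = σ (unop a) * g x y := h.smul_left x (unop a) y

theorem op_smul_right (h : IsSesquilinear σ g) (a : Fᵐᵒᵖ) (x : X) (y : Y) :
    g x (a • y) = g x y * unop a := h.smul_right x y (unop a)

theorem sum_left (h : IsSesquilinear σ g) {ι : Type*} (s : Finset ι) (x : ι → X) (y : Y) :
    g (∑ i ∈ s, x i) y = ∑ i ∈ s, g (x i) y :=
  map_sum (AddMonoidHom.mk' (fun x => g x y) fun a b => h.add_left a b y) x s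

theorem sum_right (h : IsSesquilinear σ g) {ι : Type*} (s : Finset ι) (x : X) (y : ι → Y) :
    g x (∑ i ∈ s, y i) = ∑ i ∈ s, g x (y i) :=
  map_sum (AddMonoidHom.mk' (fun y => g x y) (h.add_right x)) y s

/-- The right linear functional `g x`. -/
def toFun (h : IsSesquilinear σ g) (x : X) : Y →ₗ[Fᵐᵒᵖ] F where
  toFun := g x
  map_add' := h.add_right x
  map_smul' a y := h.op_smul_right a x y

theorem basis_left (h : IsSesquilinear σ g) {ι : Type*} [Fintype ι]
    (f : Module.Basis ι Fᵐᵒᵖ X) (x : X) (y : Y) :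
    g x y = ∑ i, σ (unop (f.repr x i)) * g (f i) y := by
  conv_lhs => rw [← f.sum_repr x]
  rw [h.sum_left]
  simp [h.op_smul_left]

theorem basis_right (h : IsSesquilinear σ g) {ι : Type*} [Fintype ι]
    (e : Module.Basis ι Fᵐᵒᵖ Y) (x : X) (y : Y) :
    g x y = ∑ i, g x (e i) * unop (e.repr y i) := by
  conv_lhs => rw [← e.sum_repr y]
  rw [h.sum_right]
  simp [h.op_smul_right]

end IsSesquilinear

section linear_algebra
variable {F : Type*} [DivisionRing F] {X Y : Type*}
  [AddCommGroup X] [Module Fᵐᵒᵖ X] [AddCommGroup Y] [Module Fᵐᵒᵖ Y]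

/-- Right linear functionals that are left linearly independent admit a dual family. -/
theorem exists_dual_family {A : Type*} [Fintype A] [DecidableEq A] (φ : A → Y →ₗ[Fᵐᵒᵖ] F)
    (h : ∀ c : A → F, (∀ y, ∑ a, c a * φ a y = 0) → c = 0) :
    ∃ y : A → Y, ∀ a b, φ a (y b) = if a = b then 1 else 0 := by
  have hr : LinearMap.range (LinearMap.pi φ) = ⊤ := by
    by_contra hne
    obtain ⟨v, -, hv⟩ := SetLike.exists_of_lt (lt_top_iff_ne_top.mpr hne)
    obtain ⟨f, hf0, hfv⟩ := LinearMap.exists_extend_of_notMem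
      (0 : LinearMap.range (LinearMap.pi φ) →ₗ[Fᵐᵒᵖ] F) hv 1
    have key : ∀ w : A → F, f w = ∑ a, f (Pi.single a 1) * w a := by
      intro w
      have : w = ∑ a, op (w a) • (Pi.single a 1 : A → F) := by
        ext b
        simp [Finset.sum_apply, Pi.single_apply]
      conv_lhs => rw [this]
      simp
    have h0 := h (fun a => f (Pi.single a 1)) (fun y => by
      have := congr($hf0 ⟨LinearMap.pi φ y, ⟨y, rfl⟩⟩)
      simp only [LinearMap.comp_apply, Submodule.subtype_apply, LinearMap.zero_apply] at this
      rw [key] at this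
      exact this)
    have h1 := key v
    rw [hfv] at h1
    simp only [funext_iff, Pi.zero_apply] at h0
    simp [h0] at h1
  have hs := LinearMap.range_eq_top.mp hr
  choose y hy using fun b => hs (Pi.single b 1)
  refine ⟨y, fun a b => ?_⟩
  have := congr_fun (hy b) a
  simpa [Pi.single_apply] using this

/-- A linearly independent family is extended to a basis by vectors from a given subspace that
spans the space together with the family. -/
theorem exists_basis_extension [Module.Finite Fᵐᵒᵖ Y] {A : Type*} (u : A → Y)
    (hu : LinearIndependent Fᵐᵒᵖ u) (R : Submodule Fᵐᵒᵖ Y)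
    (hR : ∀ y, ∃ z ∈ Submodule.span Fᵐᵒᵖ (Set.range u), y - z ∈ R) :
    ∃ (T : ℕ) (e : Module.Basis (A ⊕ Fin T) Fᵐᵒᵖ Y),
      (∀ a, e (Sum.inl a) = u a) ∧ ∀ t, e (Sum.inr t) ∈ R := by
  set S := Submodule.span Fᵐᵒᵖ (Set.range u) with hS
  obtain ⟨C', hC'⟩ := Submodule.exists_isCompl (S.comap R.subtype)
  set C := C'.map R.subtype with hC
  have hCR : C ≤ R := by
    rw [hC]; exact Submodule.map_subtype_le R C'
  have hcompl : IsCompl S C := by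
    constructor
    · rw [Submodule.disjoint_def]
      rintro x hxS ⟨⟨y, hyR⟩, hyC, rfl⟩
      have := Submodule.disjoint_def.mp hC'.disjoint ⟨y, hyR⟩ hxS hyC
      simp [this]
    · rw [codisjoint_iff, eq_top_iff]
      rintro y -
      obtain ⟨z, hz, hyz⟩ := hR y
      have := hC'.sup_eq_top ▸ Submodule.mem_top (x := (⟨y - z, hyz⟩ : R))
      obtain ⟨a, ha, b, hb, hab⟩ := Submodule.mem_sup.mp this
      have hab' : (a : Y) + b = y - z := congr_arg Subtype.val hab
      refine Submodule.mem_sup.mpr ⟨z + a, S.add_mem hz ha, b, ⟨b, hb, rfl⟩, ?_⟩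
      rw [add_assoc, hab']; abel
  refine ⟨Module.finrank Fᵐᵒᵖ C, ((Module.Basis.span hu).prod
    (Module.finBasis Fᵐᵒᵖ C)).map (Submodule.prodEquivOfIsCompl S C hcompl), ?_, ?_⟩
  · intro a
    simp [Module.Basis.span_apply]
  · intro t
    simp only [Module.Basis.map_apply, Module.Basis.prod_apply, Sum.elim_inr, Function.comp,
      LinearMap.inr_apply, Submodule.coe_prodEquivOfIsCompl']
    simpa using hCR (Module.finBasis Fᵐᵒᵖ C t).2

/-- A subspace cut out by the vanishing of some coordinates has the remaining basis vectors as
a basis. -/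
theorem exists_basis_submodule {I I' : Type*} (f : Module.Basis I Fᵐᵒᵖ X)
    (inc : I' → I) (hinc : Function.Injective inc) (W : Submodule Fᵐᵒᵖ X)
    (hW : ∀ x, x ∈ W ↔ ∀ t, t ∉ Set.range inc → f.repr x t = 0) :
    ∃ f' : Module.Basis I' Fᵐᵒᵖ W, ∀ s, (f' s : X) = f (inc s) := by
  classical
  have hmem : ∀ s, f (inc s) ∈ W := fun s => (hW _).2 fun t ht => by
    rw [f.repr_self, Finsupp.single_apply, if_neg]
    rintro rfl
    exact ht ⟨s, rfl⟩
  have hli : LinearIndependent Fᵐᵒᵖ (fun s => (⟨f (inc s), hmem s⟩ : W)) :=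
    LinearIndependent.of_comp W.subtype (f.linearIndependent.comp inc hinc)
  refine ⟨Module.Basis.mk hli ?_, fun s => congr_arg Subtype.val (Module.Basis.mk_apply hli _ s)⟩
  rintro ⟨x, hx⟩ -
  have hspan : x ∈ Submodule.span Fᵐᵒᵖ (Set.range fun s => f (inc s)) := by
    rw [← f.linearCombination_repr x]
    refine Submodule.sum_mem _ fun t ht => Submodule.smul_mem _ _ (Submodule.subset_span ?_)
    by_contra hcon
    refine Finsupp.mem_support_iff.mp ht ((hW x).1 hx t ?_)
    rintro ⟨s, rfl⟩
    exact hcon ⟨s, rfl⟩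
  have : (⟨x, hx⟩ : W) ∈ (Submodule.span Fᵐᵒᵖ (Set.range fun s => f (inc s))).comap W.subtype :=
    hspan
  have h2 : (Set.range fun s => f (inc s))
      = W.subtype '' (Set.range fun s => (⟨f (inc s), hmem s⟩ : W)) := by
    rw [← Set.range_comp]; rfl
  rw [h2, Submodule.span_image, Submodule.comap_map_eq_of_injective W.injective_subtype] at this
  exact this

/-- The quotient by the subspace on which given coordinates vanish has the classes of the
corresponding basis vectors as a basis. -/
theorem exists_basis_quotient {I I' : Type*} (f : Module.Basis I Fᵐᵒᵖ X)
    (inc : I' → I) (hinc : Function.Injective inc) (L : Submodule Fᵐᵒᵖ X)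
    (hL : ∀ x, x ∈ L ↔ ∀ s, f.repr x (inc s) = 0) :
    (∃ f' : Module.Basis I' Fᵐᵒᵖ (X ⧸ L), ∀ s, f' s = L.mkQ (f (inc s))) ∧
      ∀ t, t ∉ Set.range inc → L.mkQ (f t) = 0 := by
  classical
  have hz : ∀ t, t ∉ Set.range inc → L.mkQ (f t) = 0 := fun t ht => by
    rw [Submodule.mkQ_apply, Submodule.Quotient.mk_eq_zero, hL]
    intro s
    rw [f.repr_self, Finsupp.single_apply, if_neg]
    rintro rfl
    exact ht ⟨s, rfl⟩
  refine ⟨?_, hz⟩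
  have hli : LinearIndependent Fᵐᵒᵖ (fun s => L.mkQ (f (inc s))) := by
    rw [linearIndependent_iff]
    intro l hl
    have h1 : L.mkQ (Finsupp.linearCombination Fᵐᵒᵖ f (l.mapDomain inc)) = 0 := by
      rw [Finsupp.linearCombination_mapDomain, ← hl, Finsupp.apply_linearCombination]
      rfl
    rw [Submodule.mkQ_apply, Submodule.Quotient.mk_eq_zero, hL] at h1
    ext s
    have := h1 s
    rwa [f.repr_linearCombination, Finsupp.mapDomain_apply hinc] at this
  refine ⟨Module.Basis.mk hli ?_, fun s => by simp⟩
  rintro x -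
  obtain ⟨x, rfl⟩ := L.mkQ_surjective x
  rw [← f.linearCombination_repr x, Finsupp.apply_linearCombination]
  refine Submodule.sum_mem _ fun t ht => Submodule.smul_mem _ _ ?_
  by_cases h : t ∈ Set.range inc
  · obtain ⟨s, rfl⟩ := h
    exact Submodule.subset_span ⟨s, rfl⟩
  · simp only [Function.comp_apply, hz t h]
    exact Submodule.zero_mem _

end linear_algebra

/-! ### Forms on a subspace or on a quotient, and their derived forms -/

section derived
variable {F : Type*} [DivisionRing F] {σ : F → F} {X Y : Type*}
  [AddCommGroup X] [Module Fᵐᵒᵖ X] [AddCommGroup Y] [Module Fᵐᵒᵖ Y] {g : X → Y → F}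

/-- The left annihilator of a subspace. -/
def leftAnn (h : IsSesquilinear σ g) (N : Submodule Fᵐᵒᵖ Y) :
    Submodule Fᵐᵒᵖ X where
  carrier := {x | ∀ y ∈ N, g x y = 0}
  add_mem' {a b} ha hb y hy := by rw [h.add_left, ha y hy, hb y hy, add_zero]
  zero_mem' y _ := h.zero_left y
  smul_mem' a x hx y hy := by rw [h.op_smul_left, hx y hy, mul_zero]

/-- The form that a form on `X × Y` with `j : X → Y` induces on `(X / L) × X`, where `L` is the
left kernel. -/
noncomputable def quotForm (h : IsSesquilinear σ g) (j : X →ₗ[Fᵐᵒᵖ] Y) :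
    X ⧸ leftAnn h ⊤ → X → F :=
  fun x z => g (Function.surjInv (leftAnn h ⊤).mkQ_surjective x) (j z)

theorem apply_eq_of_mkQ_eq (h : IsSesquilinear σ g) {x x' : X}
    (hx : (leftAnn h ⊤).mkQ x = (leftAnn h ⊤).mkQ x') (y : Y) : g x y = g x' y := by
  have : x - x' ∈ leftAnn h ⊤ := (Submodule.Quotient.eq _).mp hx
  rw [← sub_eq_zero, ← h.sub_left]
  exact this y trivial

theorem quotForm_mkQ (h : IsSesquilinear σ g) (j : X →ₗ[Fᵐᵒᵖ] Y)
    (x z : X) : quotForm h j ((leftAnn h ⊤).mkQ x) z = g x (j z) :=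
  apply_eq_of_mkQ_eq h (Function.surjInv_eq (leftAnn h ⊤).mkQ_surjective _) _

theorem quotForm_sesquilinear (h : IsSesquilinear σ g)
    (j : X →ₗ[Fᵐᵒᵖ] Y) : IsSesquilinear σ (quotForm h j) where
  add_left u u' v := by
    obtain ⟨u, rfl⟩ := (leftAnn h ⊤).mkQ_surjective u
    obtain ⟨u', rfl⟩ := (leftAnn h ⊤).mkQ_surjective u'
    rw [← map_add, quotForm_mkQ, quotForm_mkQ, quotForm_mkQ, h.add_left]
  smul_left u a v := by
    obtain ⟨u, rfl⟩ := (leftAnn h ⊤).mkQ_surjective u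
    rw [← map_smul, quotForm_mkQ, quotForm_mkQ, h.smul_left]
  add_right u v v' := by
    obtain ⟨u, rfl⟩ := (leftAnn h ⊤).mkQ_surjective u
    rw [quotForm_mkQ, quotForm_mkQ, quotForm_mkQ, map_add, h.add_right]
  smul_right u v a := by
    obtain ⟨u, rfl⟩ := (leftAnn h ⊤).mkQ_surjective u
    rw [quotForm_mkQ, quotForm_mkQ, map_smul, h.smul_right]

/-- The form that a form on `X × Y` with a surjection `q : Y → X` induces on `N × X`, where
`N ≤ X` is the left annihilator of the kernel of `q`. -/
noncomputable def subForm (h : IsSesquilinear σ g) {q : Y →ₗ[Fᵐᵒᵖ] X}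
    (hq : Function.Surjective q) : leftAnn h (LinearMap.ker q) → X → F :=
  fun x z => g x (Function.surjInv hq z)

theorem subForm_apply (h : IsSesquilinear σ g) {q : Y →ₗ[Fᵐᵒᵖ] X}
    (hq : Function.Surjective q) (x : leftAnn h (LinearMap.ker q)) (y : Y) :
    subForm h hq x (q y) = g x y := by
  rw [← sub_eq_zero, subForm, ← h.sub_right]
  refine x.2 _ ?_
  rw [LinearMap.mem_ker, map_sub, Function.surjInv_eq hq, sub_self]

theorem subForm_sesquilinear (h : IsSesquilinear σ g)
    {q : Y →ₗ[Fᵐᵒᵖ] X} (hq : Function.Surjective q) : IsSesquilinear σ (subForm h hq) where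
  add_left u u' v := h.add_left _ _ _
  smul_left u a v := h.smul_left _ _ _
  add_right u v v' := by
    obtain ⟨v, rfl⟩ := hq v
    obtain ⟨v', rfl⟩ := hq v'
    rw [← map_add, subForm_apply, subForm_apply, subForm_apply, h.add_right]
  smul_right u v a := by
    obtain ⟨v, rfl⟩ := hq v
    rw [← map_smul, subForm_apply, subForm_apply, h.smul_right]

/-- For a form `g` on `X × Y` with `j : X → Y`: in some bases of `X` and `Y` that are matched
by `j` along `emb`, the matrix of `g` is `M`. -/
def SubHas (j : X →ₗ[Fᵐᵒᵖ] Y) (g : X → Y → F) {R C : Type} (emb : R → C) (M : R → C → F) : Prop :=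
  ∃ (f : Module.Basis R Fᵐᵒᵖ X) (e : Module.Basis C Fᵐᵒᵖ Y),
    (∀ s, j (f s) = e (emb s)) ∧ ∀ s t, g (f s) (e t) = M s t

/-- For a form `g` on `X × Y` with `q : Y → X`: in some bases of `X` and `Y` that are matched
by `q` along `emb`, with the other basis vectors of `Y` in the kernel of `q`, the matrix of `g`
is `M`. -/
def QuotHas (q : Y →ₗ[Fᵐᵒᵖ] X) (g : X → Y → F) {R C : Type} (emb : R → C) (M : R → C → F) :
    Prop :=
  ∃ (f : Module.Basis R Fᵐᵒᵖ X) (e : Module.Basis C Fᵐᵒᵖ Y),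
    (∀ s, q (e (emb s)) = f s) ∧ (∀ t, t ∉ Set.range emb → q (e t) = 0) ∧
      ∀ s t, g (f s) (e t) = M s t

theorem repr_of_matched {q : Y →ₗ[Fᵐᵒᵖ] X} {R C : Type} {emb : R → C}
    (f : Module.Basis R Fᵐᵒᵖ X) (e : Module.Basis C Fᵐᵒᵖ Y) (hemb : Function.Injective emb)
    (hfe : ∀ s, q (e (emb s)) = f s) (hz : ∀ t, t ∉ Set.range emb → q (e t) = 0) (y : Y) (s : R) :
    f.repr (q y) s = e.repr y (emb s) := by
  classical
  have : f.coord s ∘ₗ q = e.coord (emb s) := e.ext fun t => by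
    by_cases ht : t ∈ Set.range emb
    · obtain ⟨t, rfl⟩ := ht
      simp [hfe, Finsupp.single_apply, hemb.eq_iff]
    · have hne : t ≠ emb s := fun h => ht ⟨s, h.symm⟩
      simp [hz t ht, hne]
  exact congr($this y)

end derived

/-! ### Chains -/

section chains
variable {F : Type*} [DivisionRing F] {P ι : Type}

/-- The index set of a basis consisting of a part `P` and of chains of lengths `r i`. -/
abbrev ChainIdx (P : Type) {ι : Type} (r : ι → ℕ) : Type := P ⊕ (Σ i, Fin (r i))

/-- The inclusion of index sets that embeds each chain as an initial segment. -/
def chainEmb (P : Type) {r c : ι → ℕ} (h : ∀ i, r i ≤ c i) : ChainIdx P r → ChainIdx P c :=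
  Sum.map id (Sigma.map id fun i => Fin.castLE (h i))

/-- The matrix that is `K` on the part `P` and pairs the `k`-th row of each chain to the
`(k + 1)`-st column of the same chain. -/
def chainMat [DecidableEq ι] (K : Matrix P P F) {r c : ι → ℕ} : ChainIdx P r → ChainIdx P c → F
  | .inl a, .inl b => K a b
  | .inr s, .inr t => if s.1 = t.1 ∧ (s.2 : ℕ) + 1 = t.2 then 1 else 0
  | _, _ => 0

variable {r c r' : ι → ℕ}

theorem chainEmb_injective (h : ∀ i, r i ≤ c i) : Function.Injective (chainEmb P h) := by
  rintro (a | ⟨i, k⟩) (b | ⟨i', k'⟩) hab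
  · simpa [chainEmb] using hab
  · simp [chainEmb] at hab
  · simp [chainEmb] at hab
  · simp only [chainEmb, Sum.map_inr, Sigma.map, id, Sum.inr.injEq, Sigma.mk.injEq] at hab
    obtain ⟨rfl, h2⟩ := hab
    simp only [heq_eq_eq, Fin.castLE_inj] at h2
    rw [h2]

theorem inl_mem_range_chainEmb (h : ∀ i, r i ≤ c i) (a : P) :
    Sum.inl a ∈ Set.range (chainEmb P h) := ⟨Sum.inl a, rfl⟩

theorem inr_mem_range_chainEmb (h : ∀ i, r i ≤ c i) (i : ι) (k : Fin (c i)) :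
    Sum.inr ⟨i, k⟩ ∈ Set.range (chainEmb P h) ↔ (k : ℕ) < r i := by
  constructor
  · rintro ⟨(a | ⟨i', k'⟩), hab⟩
    · simp [chainEmb] at hab
    · simp only [chainEmb, Sum.map_inr, Sigma.map, id, Sum.inr.injEq, Sigma.mk.injEq] at hab
      obtain ⟨rfl, h2⟩ := hab
      simp only [heq_eq_eq] at h2
      rw [← h2]
      simp
  · intro hk
    exact ⟨Sum.inr ⟨i, k, hk⟩, rfl⟩

theorem chainMat_emb [DecidableEq ι] (K : Matrix P P F) {c' : ι → ℕ} (h : ∀ i, r i ≤ c i)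
    (h' : ∀ i, r' i ≤ c' i) (s : ChainIdx P r) (t : ChainIdx P r') :
    chainMat K (chainEmb P h s) (chainEmb P h' t) = chainMat K s t := by
  rcases s with a | ⟨i, k⟩ <;> rcases t with b | ⟨i', k'⟩ <;> rfl

theorem chainMat_emb_left [DecidableEq ι] (K : Matrix P P F) (h : ∀ i, r i ≤ c i)
    (s : ChainIdx P r) (t : ChainIdx P r') :
    chainMat K (chainEmb P h s) t = chainMat K s t := by
  rcases s with a | ⟨i, k⟩ <;> rcases t with b | ⟨i', k'⟩ <;> rfl

variable {σ : F → F} {X Y : Type*} [Fintype P] [Fintype ι] [DecidableEq ι]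
  [AddCommGroup X] [Module Fᵐᵒᵖ X] [AddCommGroup Y] [Module Fᵐᵒᵖ Y] {g : X → Y → F}

theorem apply_chain_succ (h : IsSesquilinear σ g) (K : Matrix P P F)
    (f : Module.Basis (ChainIdx P r) Fᵐᵒᵖ X) (e : ChainIdx P c → Y)
    (hg : ∀ s t, g (f s) (e t) = chainMat K s t) (x : X) (i : ι) (k : Fin (r i))
    (k' : Fin (c i)) (hk : (k : ℕ) + 1 = k') :
    g x (e (.inr ⟨i, k'⟩)) = σ (unop (f.repr x (.inr ⟨i, k⟩))) := by
  rw [h.basis_left f, Finset.sum_eq_single (Sum.inr ⟨i, k⟩)]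
  · rw [hg]; simp [chainMat, hk]
  · rintro (a | ⟨i₂, k₂⟩) - hne
    · rw [hg]; simp [chainMat]
    · rw [hg]; simp only [chainMat]
      rw [if_neg, mul_zero]
      rintro ⟨rfl, h2⟩
      apply hne
      have : k₂ = k := Fin.ext (by omega)
      rw [this]
  · simp

theorem coord_inl_eq_zero [DecidableEq P] (hσ : IsInvolution σ) (h : IsSesquilinear σ g)
    {K : Matrix P P F} (hK : IsUnit K)
    (f : Module.Basis (ChainIdx P r) Fᵐᵒᵖ X) (e : ChainIdx P c → Y)
    (hg : ∀ s t, g (f s) (e t) = chainMat K s t) (x : X) (hx : ∀ b, g x (e (.inl b)) = 0)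
    (a : P) : f.repr x (.inl a) = 0 := by
  obtain ⟨K', hK', -⟩ := isUnit_iff_exists.mp hK
  have h1 : ∀ b, ∑ a, σ (unop (f.repr x (.inl a))) * K a b = 0 := fun b => by
    have := hx b
    rw [h.basis_left f, Fintype.sum_sum_type] at this
    simpa [hg, chainMat] using this
  have h2 : Matrix.vecMul (fun a => σ (unop (f.repr x (.inl a)))) K = 0 := funext h1
  have h3 := congr_arg (fun v => Matrix.vecMul v K') h2
  simp only [Matrix.vecMul_vecMul, hK', Matrix.vecMul_one, Matrix.zero_vecMul] at h3
  have h4 := hσ.eq_zero (congr_fun h3 a)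
  exact unop_injective h4

/-- The left kernel is spanned by the last vectors of the chains with `r i = c i`, so that the
remaining basis vectors give a basis for the derived form. A chain of lengths `(r, c)` becomes
one of lengths `(c - 1, r)`. -/
theorem SubHas.push [DecidableEq P] (hσ : IsInvolution σ) (h : IsSesquilinear σ g)
    {K : Matrix P P F} (hK : IsUnit K) (j : X →ₗ[Fᵐᵒᵖ] Y) (hrc : ∀ i, r i ≤ c i)
    (hcr : ∀ i, c i - 1 ≤ r i)
    (H : SubHas j g (chainEmb P hrc) (chainMat K)) :
    QuotHas (leftAnn h ⊤).mkQ (quotForm h j) (chainEmb P hcr) (chainMat K) := by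
  obtain ⟨f, e, hfe, hg⟩ := H
  have hL : ∀ x, x ∈ leftAnn h ⊤ ↔ ∀ s, f.repr x (chainEmb P hcr s) = 0 := by
    intro x
    constructor
    · rintro hx (a | ⟨i, k⟩)
      · exact coord_inl_eq_zero hσ h hK f e hg x (fun b => hx _ trivial) a
      · have := apply_chain_succ h K f e hg x i (Fin.castLE (hcr i) k)
          ⟨k + 1, by have : (k : ℕ) < c i - 1 := k.2; omega⟩ rfl
        rw [hx _ trivial] at this
        exact unop_injective (hσ.eq_zero this.symm)
    · intro hx y _
      rw [h.basis_right e]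
      refine Finset.sum_eq_zero fun t _ => ?_
      rw [h.basis_left f, Finset.sum_eq_zero, zero_mul]
      intro s _
      by_cases hs : s ∈ Set.range (chainEmb P hcr)
      · obtain ⟨s, rfl⟩ := hs
        rw [hx s, unop_zero, hσ.map_zero, zero_mul]
      · rcases s with a | ⟨i, k⟩
        · exact absurd (inl_mem_range_chainEmb hcr a) hs
        · rw [inr_mem_range_chainEmb] at hs
          rcases t with b | ⟨i', k'⟩
          · rw [hg]; simp [chainMat]
          · rw [hg]; simp only [chainMat]
            rw [if_neg, mul_zero]
            rintro ⟨rfl, h2⟩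
            have := k'.2
            have hs' : ¬ (k : ℕ) < c i - 1 := hs
            omega
  obtain ⟨⟨f', hf'⟩, hz⟩ := exists_basis_quotient f (chainEmb P hcr) (chainEmb_injective hcr) _ hL
  refine ⟨f', f, fun s => (hf' s).symm, hz, fun s t => ?_⟩
  rw [hf', quotForm_mkQ, hfe, hg, chainMat_emb]

/-- The left annihilator of `ker q` is spanned by the basis vectors that are not paired with a
vector of `ker q`. A chain of lengths `(r, c)` becomes one of lengths
`(r - (c - r), r)`: it loses its last row, if there is one, in case `c = r + 1`. -/
theorem QuotHas.push (hσ : IsInvolution σ) (h : IsSesquilinear σ g)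
    {K : Matrix P P F} {q : Y →ₗ[Fᵐᵒᵖ] X} (hq : Function.Surjective q) (hrc : ∀ i, r i ≤ c i)
    (hcr : ∀ i, c i ≤ r i + 1) (hr : ∀ i, r i - (c i - r i) ≤ r i)
    (H : QuotHas q g (chainEmb P hrc) (chainMat K)) :
    SubHas (leftAnn h (LinearMap.ker q)).subtype (subForm h hq) (chainEmb P hr)
      (chainMat K) := by
  obtain ⟨f, e, hfe, hz, hg⟩ := H
  have hL : ∀ x, x ∈ leftAnn h (LinearMap.ker q) ↔
      ∀ t, t ∉ Set.range (chainEmb P hr) → f.repr x t = 0 := by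
    intro x
    constructor
    · rintro hx (a | ⟨i, k⟩) ht
      · exact absurd (inl_mem_range_chainEmb hr a) ht
      · rw [inr_mem_range_chainEmb] at ht
        have hk := k.2
        have := apply_chain_succ h K f e hg x i k ⟨k + 1, by have := hcr i; omega⟩ rfl
        rw [hx _ (hz _ _)] at this
        · exact unop_injective (hσ.eq_zero this.symm)
        · rw [inr_mem_range_chainEmb]
          have := hcr i
          have ht' : ¬ (k : ℕ) < r i - (c i - r i) := ht
          simp only
          omega
    · intro hx y hy
      rw [h.basis_right e]
      refine Finset.sum_eq_zero fun t _ => ?_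
      by_cases ht : t ∈ Set.range (chainEmb P hrc)
      · obtain ⟨t, rfl⟩ := ht
        rw [← repr_of_matched f e (chainEmb_injective hrc) hfe hz, LinearMap.mem_ker.mp hy]
        simp
      · rw [h.basis_left f, Finset.sum_eq_zero, zero_mul]
        intro s _
        rw [hg]
        rcases t with b | ⟨i', k'⟩
        · exact absurd (inl_mem_range_chainEmb hrc b) ht
        · rw [inr_mem_range_chainEmb] at ht
          rcases s with a | ⟨i, k⟩
          · simp [chainMat]
          · simp only [chainMat]
            split_ifs with h3
            · obtain ⟨rfl, h3⟩ := h3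
              rw [hx, unop_zero, hσ.map_zero, zero_mul]
              rw [inr_mem_range_chainEmb]
              have := k'.2
              have := hcr i
              change ¬ (k : ℕ) < r i - (c i - r i)
              omega
            · rw [mul_zero]
  obtain ⟨f', hf'⟩ := exists_basis_submodule f (chainEmb P hr) (chainEmb_injective hr) _ hL
  refine ⟨f', f, fun s => hf' s, fun s t => ?_⟩
  rw [← hfe, subForm_apply, hf', hg, chainMat_emb]

end chains

/-! ### Lifting a decomposition from the derived form -/

theorem reindex_ofBijective_apply {D V A B : Type*} [Semiring D] [AddCommMonoid V] [Module D V]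
    (b : Module.Basis A D V) {φ : A → B} (hφ : Function.Bijective φ) (a : A) :
    b.reindex (Equiv.ofBijective φ hφ) (φ a) = b a := by
  rw [b.reindex_apply]
  exact congr_arg b ((Equiv.ofBijective φ hφ).symm_apply_apply a)

section lift
variable {F : Type*} [DivisionRing F] {σ : F → F} {P ι : Type} {r c r' : ι → ℕ}

theorem chainIdx_inr_inj {i i' : ι} {k : Fin (r i)} {k' : Fin (r i')} :
    (Sum.inr ⟨i, k⟩ : ChainIdx P r) = Sum.inr ⟨i', k'⟩ ↔ i = i' ∧ (k : ℕ) = k' := by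
  constructor
  · intro h
    cases h
    exact ⟨rfl, rfl⟩
  · rintro ⟨rfl, h⟩
    rw [Fin.ext h]

/-- Appending a last basis vector to the chains with `c i = r i + 1`, and `T` new chains of
length one. -/
def chainExt (P : Type) (hrc : ∀ i, r i ≤ c i) (T : ℕ) :
    (ChainIdx P r ⊕ {i // c i = r i + 1}) ⊕ Fin T → ChainIdx P (Sum.elim c fun _ : Fin T => 1)
  | .inl (.inl (.inl a)) => .inl a
  | .inl (.inl (.inr s)) => .inr ⟨.inl s.1, Fin.castLE (hrc s.1) s.2⟩
  | .inl (.inr i) => .inr ⟨.inl i.1, ⟨r i.1, by have := i.2; simp only [Sum.elim_inl]; omega⟩⟩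
  | .inr t => .inr ⟨.inr t, ⟨0, by simp⟩⟩

/-- Adding `T` empty chains does not change the index set. -/
def chainExtRow (P : Type) (r : ι → ℕ) (T : ℕ) :
    ChainIdx P r → ChainIdx P (Sum.elim r fun _ : Fin T => 0)
  | .inl a => .inl a
  | .inr s => .inr ⟨.inl s.1, s.2⟩

theorem chainExtRow_bijective (T : ℕ) : Function.Bijective (chainExtRow P r T) := by
  constructor
  · rintro (a | ⟨i, k⟩) (b | ⟨i', k'⟩) h
    · simpa [chainExtRow] using h
    · simp [chainExtRow] at h
    · simp [chainExtRow] at h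
    · cases h
      rfl
  · rintro (a | ⟨i | t, k⟩)
    · exact ⟨.inl a, rfl⟩
    · exact ⟨.inr ⟨i, k⟩, rfl⟩
    · exact absurd k.2 (by simp)

theorem chainExt_bijective (hrc : ∀ i, r i ≤ c i) (hcr : ∀ i, c i ≤ r i + 1) (T : ℕ) :
    Function.Bijective (chainExt P hrc T) := by
  constructor
  · rintro (((a | ⟨i, k⟩) | ⟨i, hi⟩) | t) (((a' | ⟨i', k'⟩) | ⟨i', hi'⟩) | t') h <;>
      simp only [chainExt, Sum.inr.injEq, Sum.inl.injEq, Sigma.mk.injEq, reduceCtorEq,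
        false_and] at h
    · rw [h]
    · obtain ⟨rfl, h⟩ := h
      have h5 : k = k' := Fin.ext (congr_arg (Fin.val (n := c i)) (eq_of_heq h))
      rw [h5]
    · obtain ⟨rfl, h⟩ := h
      have h5 : (k : ℕ) = r i := congr_arg Fin.val (eq_of_heq h)
      have := k.2
      omega
    · obtain ⟨rfl, h⟩ := h
      have h5 : r i = (k' : ℕ) := congr_arg Fin.val (eq_of_heq h)
      have := k'.2
      omega
    · obtain ⟨rfl, h⟩ := h
      rfl
    · rw [h.1]
  · rintro (a | ⟨i | t, k⟩)
    · exact ⟨.inl (.inl (.inl a)), rfl⟩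
    · by_cases hk : (k : ℕ) < r i
      · exact ⟨.inl (.inl (.inr ⟨i, k, hk⟩)), rfl⟩
      · have hk2 : (k : ℕ) < c i := k.2
        have h1 := hcr i
        refine ⟨.inl (.inr ⟨i, by omega⟩), ?_⟩
        simp only [chainExt, Sum.inr.injEq, Sigma.mk.injEq, true_and, heq_eq_eq]
        ext
        simp only
        omega
    · refine ⟨.inr t, ?_⟩
      have hk2 : (k : ℕ) < 1 := k.2
      simp only [chainExt, Sum.inr.injEq, Sigma.mk.injEq, true_and, heq_eq_eq]
      ext
      simp only
      omega

theorem chainExt_inl_inl (hrc : ∀ i, r i ≤ c i) (T : ℕ)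
    (hT : ∀ i : ι ⊕ Fin T, Sum.elim r (fun _ => 0) i ≤ Sum.elim c (fun _ => 1) i)
    (s : ChainIdx P r) :
    chainExt P hrc T (.inl (.inl s)) = chainEmb P hT (chainExtRow P r T s) := by
  rcases s with a | ⟨i, k⟩ <;> rfl

theorem chainExt_mem_range (hrc : ∀ i, r i ≤ c i) (T : ℕ)
    (hT : ∀ i : ι ⊕ Fin T, Sum.elim r (fun _ => 0) i ≤ Sum.elim c (fun _ => 1) i)
    (x : (ChainIdx P r ⊕ {i // c i = r i + 1}) ⊕ Fin T)
    (hx : chainExt P hrc T x ∉ Set.range (chainEmb P hT)) :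
    (∃ i, x = .inl (.inr i)) ∨ ∃ t, x = .inr t := by
  rcases x with (s | i) | t
  · exact absurd ⟨_, (chainExt_inl_inl hrc T hT s).symm⟩ hx
  · exact Or.inl ⟨i, rfl⟩
  · exact Or.inr ⟨t, rfl⟩

/-- The entry with which the row `s` pairs to a vector appended to the chain `i`. -/
def lastPair (F : Type*) [DivisionRing F] [DecidableEq ι] (i : ι) : ChainIdx P r → F
  | .inl _ => 0
  | .inr s => if s.1 = i ∧ (s.2 : ℕ) + 1 = r i then 1 else 0

theorem chainMat_chainExt [DecidableEq ι] {K : Matrix P P F} (hrc : ∀ i, r i ≤ c i) {T : ℕ}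
    {X Y : Type*} {g : X → Y → F} {f : ChainIdx P r → X}
    {e : (ChainIdx P r ⊕ {i // c i = r i + 1}) ⊕ Fin T → Y}
    (h1 : ∀ s t, g (f s) (e (.inl (.inl t))) = chainMat K s t)
    (h2 : ∀ s i, g (f s) (e (.inl (.inr i))) = lastPair F i.1 s)
    (h3 : ∀ s t, g (f s) (e (.inr t)) = 0) (s : ChainIdx P r)
    (x : (ChainIdx P r ⊕ {i // c i = r i + 1}) ⊕ Fin T) :
    g (f s) (e x) = chainMat K (chainExtRow P r T s) (chainExt P hrc T x) := by
  rcases x with (t | i) | t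
  · rw [h1]
    rcases s with a | ⟨i, k⟩ <;> rcases t with b | ⟨i', k'⟩ <;>
      simp [chainMat, chainExtRow, chainExt]
  · rw [h2]
    rcases s with a | ⟨i', k⟩
    · rfl
    · simp only [chainMat, chainExtRow, chainExt, lastPair, Sum.inl.injEq]
  · rw [h3]
    rcases s with a | ⟨i', k⟩
    · rfl
    · simp [chainMat, chainExtRow, chainExt]

variable {X Y : Type*} [Fintype P] [Fintype ι] [DecidableEq ι] [DecidableEq P]
  [AddCommGroup X] [Module Fᵐᵒᵖ X] [AddCommGroup Y] [Module Fᵐᵒᵖ Y] {g : X → Y → F}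

/-- Vectors that are linearly independent modulo the left annihilator of `N` have a dual family
in `N`. -/
theorem IsSesquilinear.exists_dual (hσ : IsInvolution σ) (h : IsSesquilinear σ g)
    (N : Submodule Fᵐᵒᵖ Y) {A : Type*} [Fintype A] [DecidableEq A] (x : A → X)
    (hx : ∀ a : A → Fᵐᵒᵖ, ∑ i, a i • x i ∈ leftAnn h N → a = 0) :
    ∃ y : A → Y, (∀ b, y b ∈ N) ∧ ∀ a b, g (x a) (y b) = if a = b then 1 else 0 := by
  obtain ⟨y, hy⟩ := exists_dual_family (fun a => (h.toFun (x a)).domRestrict N) (fun d hd => by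
    have := hx (fun a => op (σ (d a))) (fun y hy => by
      rw [h.sum_left]
      simp only [h.op_smul_left, unop_op, hσ.involutive]
      exact hd ⟨y, hy⟩)
    ext a
    have h1 := congr_fun this a
    exact hσ.eq_zero (op_injective h1))
  exact ⟨fun b => y b, fun b => (y b).2, hy⟩

/-- The right kernel of a form. -/
def rightKer (h : IsSesquilinear σ g) : Submodule Fᵐᵒᵖ Y where
  carrier := {y | ∀ x, g x y = 0}
  add_mem' {a b} ha hb x := by rw [h.add_right, ha x, hb x, add_zero]
  zero_mem' x := h.zero_right x
  smul_mem' a y hy x := by rw [h.op_smul_right, hy x, zero_mul]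

/-- A decomposition of the derived form on `(X / L) × X` lifts to the form on `X × Y`. The image
under `j` of the basis of `X` is extended to a basis of `Y` by one vector for each chain whose last
row in `X / L` is not paired yet, and by vectors of the right kernel, which become `T` chains of
lengths `(0, 1)`. -/
theorem SubHas.lift [Module.Finite Fᵐᵒᵖ Y] (hσ : IsInvolution σ) (h : IsSesquilinear σ g)
    {K : Matrix P P F} (hK : IsUnit K) {j : X →ₗ[Fᵐᵒᵖ] Y} (hj : Function.Injective j)
    (h1 : ∀ i, r' i ≤ r i) (h2 : ∀ i, r i ≤ r' i + 1) (h3 : ∀ i, 1 ≤ r i)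
    (H : QuotHas (leftAnn h ⊤).mkQ (quotForm h j) (chainEmb P h1) (chainMat K)) :
    ∃ (T : ℕ) (hT : ∀ i : ι ⊕ Fin T,
        Sum.elim r (fun _ => 0) i ≤ Sum.elim (fun i => r' i + 1) (fun _ => 1) i),
      SubHas j g (chainEmb P hT) (chainMat K) := by
  obtain ⟨f', e', hfe, hz, hg⟩ := H
  have hrow : ∀ s, s ∉ Set.range (chainEmb P h1) → ∀ y, g (e' s) y = 0 := fun s hs y =>
    ((Submodule.Quotient.mk_eq_zero _).mp (hz s hs)) y trivial
  have hg1 : ∀ s t, g (e' s) (j (e' t)) = chainMat K s t := by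
    intro s t
    by_cases hs : s ∈ Set.range (chainEmb P h1)
    · obtain ⟨s, rfl⟩ := hs
      rw [← quotForm_mkQ h j, hfe, hg, chainMat_emb_left]
    · rw [hrow s hs]
      rcases s with a | ⟨i, k⟩
      · exact absurd (inl_mem_range_chainEmb h1 a) hs
      · rw [inr_mem_range_chainEmb] at hs
        rcases t with b | ⟨i', k'⟩
        · rfl
        · simp only [chainMat]
          rw [if_neg]
          rintro ⟨rfl, h5⟩
          have := k'.2
          have := h2 i
          omega
  obtain ⟨v, -, hv⟩ := h.exists_dual hσ ⊤ (fun s => e' (chainEmb P h1 s)) (fun a ha => by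
    have : ∑ s, a s • f' s = 0 := by
      have h5 := (Submodule.Quotient.mk_eq_zero _).mpr ha
      rw [← Submodule.mkQ_apply, map_sum] at h5
      simpa only [map_smul, hfe] using h5
    ext s : 1
    exact Fintype.linearIndependent_iff.mp f'.linearIndependent a this s)
  -- a chain with `r i = r' i` gets a last vector, dual to its last row in `X / L`
  let v0 : {i // r' i + 1 = r i + 1} → Y := fun i => v (.inr ⟨i.1, r i.1 - 1, by
    have := h3 i.1; have := i.2; omega⟩)
  have hg2 : ∀ s i, g (e' s) (v0 i) = lastPair F i.1 s := by
    rintro s ⟨i, hi⟩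
    by_cases hs : s ∈ Set.range (chainEmb P h1)
    · obtain ⟨s, rfl⟩ := hs
      rw [hv]
      rcases s with a | ⟨i', k⟩
      · simp [chainEmb, lastPair]
      · simp only [chainEmb, lastPair, Sum.map_inr, Sigma.map, id, Fin.val_castLE]
        congr 1
        apply propext
        rw [chainIdx_inr_inj]
        constructor <;> rintro ⟨rfl, h5⟩ <;> exact ⟨rfl, by have := h3 i'; simp only at h5 ⊢; omega⟩
    · rw [hrow s hs]
      rcases s with a | ⟨i', k⟩
      · rfl
      · rw [inr_mem_range_chainEmb] at hs
        simp only [lastPair]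
        rw [if_neg]
        rintro ⟨rfl, h5⟩
        omega
  let u : ChainIdx P r ⊕ {i // r' i + 1 = r i + 1} → Y := Sum.elim (fun t => j (e' t)) v0
  have hu : LinearIndependent Fᵐᵒᵖ u := by
    rw [Fintype.linearIndependent_iff]
    intro a ha
    rw [Fintype.sum_sum_type] at ha
    simp only [u, Sum.elim_inl, Sum.elim_inr] at ha
    have hb : ∀ i, a (.inr i) = 0 := by
      intro i
      have h3i := h3 i.1
      have h5 := congr_arg (g (e' (.inr ⟨i.1, r i.1 - 1, by omega⟩))) ha
      rw [h.add_right, h.sum_right, h.sum_right, h.zero_right] at h5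
      simp only [h.op_smul_right, hg1, hg2] at h5
      rw [Finset.sum_eq_zero, zero_add, Finset.sum_eq_single i] at h5
      · simp only [lastPair] at h5
        rw [if_pos ⟨trivial, by omega⟩, one_mul] at h5
        exact unop_injective h5
      · intro i' _ hne
        simp only [lastPair]
        rw [if_neg, zero_mul]
        rintro ⟨h6, -⟩
        exact hne (Subtype.ext h6.symm)
      · simp
      · rintro (b | ⟨i', k'⟩) -
        · simp [chainMat]
        · simp only [chainMat]
          rw [if_neg, zero_mul]
          rintro ⟨rfl, h6⟩
          have := k'.2
          omega
    simp only [hb, zero_smul, Finset.sum_const_zero, add_zero] at ha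
    have h5 : j (∑ t, a (.inl t) • e' t) = 0 := by
      rw [map_sum]; simpa only [map_smul] using ha
    have h6 := hj (h5.trans (map_zero j).symm)
    rintro (t | i)
    · exact Fintype.linearIndependent_iff.mp e'.linearIndependent (fun t => a (.inl t)) h6 t
    · exact hb i
  have hmem : ∀ x, u x ∈ Submodule.span Fᵐᵒᵖ (Set.range u) := fun x =>
    Submodule.subset_span ⟨x, rfl⟩
  -- the span of `u` contains a family dual to the basis of `X / L`, so it covers `Y` modulo the
  -- right kernel
  have hw : ∀ s : ChainIdx P r', ∃ w ∈ Submodule.span Fᵐᵒᵖ (Set.range u),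
      ∀ s', g (e' (chainEmb P h1 s')) w = if s' = s then 1 else 0 := by
    rintro (a | ⟨i, k⟩)
    · obtain ⟨K', hK', -⟩ := isUnit_iff_exists.mp hK
      refine ⟨∑ b, op (K' b a) • u (.inl (.inl b)), Submodule.sum_mem _ fun b _ =>
        Submodule.smul_mem _ _ (hmem _), fun s' => ?_⟩
      rw [h.sum_right]
      simp only [h.op_smul_right, u, Sum.elim_inl, hg1]
      rcases s' with a' | ⟨i', k'⟩
      · have := congr_fun (congr_fun hK' a') a
        simpa [Matrix.mul_apply, chainMat, chainEmb, Matrix.one_apply] using this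
      · simp [chainMat, chainEmb]
    · by_cases hk : (k : ℕ) + 1 < r i
      · refine ⟨_, hmem (.inl (.inr ⟨i, k + 1, hk⟩)), fun s' => ?_⟩
        simp only [u, Sum.elim_inl, hg1]
        rcases s' with a' | ⟨i', k'⟩
        · simp [chainMat, chainEmb]
        · simp only [chainMat, chainEmb, Sum.map_inr, Sigma.map, id, Fin.val_castLE]
          congr 1
          apply propext
          rw [chainIdx_inr_inj]
          constructor <;> rintro ⟨rfl, h5⟩ <;> exact ⟨rfl, by omega⟩
      · have h1i := h1 i
        have hk2 := k.2
        refine ⟨_, hmem (.inr ⟨i, by omega⟩), fun s' => ?_⟩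
        simp only [u, Sum.elim_inr, hg2]
        rcases s' with a' | ⟨i', k'⟩
        · simp [lastPair, chainEmb]
        · simp only [lastPair, chainEmb, Sum.map_inr, Sigma.map, id, Fin.val_castLE]
          congr 1
          apply propext
          rw [chainIdx_inr_inj]
          constructor <;> rintro ⟨rfl, h5⟩ <;> exact ⟨rfl, by omega⟩
  choose w hwm hw using hw
  obtain ⟨T, e0, he0, hR⟩ := exists_basis_extension u hu (rightKer h) (fun y => by
    refine ⟨∑ s, op (g (e' (chainEmb P h1 s)) y) • w s, Submodule.sum_mem _ fun s _ =>
      Submodule.smul_mem _ _ (hwm s), fun x => ?_⟩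
    rw [h.basis_left e']
    refine Finset.sum_eq_zero fun s _ => ?_
    by_cases hs : s ∈ Set.range (chainEmb P h1)
    · obtain ⟨s, rfl⟩ := hs
      rw [h.sub_right, h.sum_right]
      simp [h.op_smul_right, hw]
    · rw [hrow s hs, mul_zero])
  have hT : ∀ i : ι ⊕ Fin T,
      Sum.elim r (fun _ => 0) i ≤ Sum.elim (fun i => r' i + 1) (fun _ => 1) i := by
    rintro (i | t)
    · exact h2 i
    · simp
  have hbij := chainExt_bijective (P := P) (c := fun i => r' i + 1) h2
    (fun i => by have := h1 i; omega) T
  refine ⟨T, hT, e'.reindex (Equiv.ofBijective _ (chainExtRow_bijective T)),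
    e0.reindex (Equiv.ofBijective _ hbij), ?_, ?_⟩
  · rw [(chainExtRow_bijective (P := P) (r := r) T).surjective.forall]
    intro s
    rw [← chainExt_inl_inl h2, reindex_ofBijective_apply, reindex_ofBijective_apply, he0]
    rfl
  · rw [(chainExtRow_bijective (P := P) (r := r) T).surjective.forall]
    intro s
    rw [hbij.surjective.forall]
    intro x
    rw [reindex_ofBijective_apply, reindex_ofBijective_apply]
    refine chainMat_chainExt h2 (fun s t => ?_) (fun s i => ?_) (fun s t => hR t _) s x
    · rw [he0]; exact hg1 s t
    · rw [he0]; exact hg2 s i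

/-- A decomposition of the derived form on `N × X` lifts to the form on `X × Y`. Preimages
in `Y` of the basis of `X` are completed by a basis of `ker q`: one vector for each basis vector
of `X` outside `N`, dual to it, and vectors of the right kernel, which become `T` chains of lengths
`(0, 1)`. -/
theorem QuotHas.lift [Module.Finite Fᵐᵒᵖ Y] (hσ : IsInvolution σ) (h : IsSesquilinear σ g)
    {K : Matrix P P F} {q : Y →ₗ[Fᵐᵒᵖ] X} (hq : Function.Surjective q)
    (h1 : ∀ i, r' i ≤ r i) (h2 : ∀ i, r i ≤ r' i + 1)
    (H : SubHas (leftAnn h (LinearMap.ker q)).subtype (subForm h hq) (chainEmb P h1)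
      (chainMat K)) :
    ∃ (T : ℕ) (hT : ∀ i : ι ⊕ Fin T,
        Sum.elim r (fun _ => 0) i ≤ Sum.elim (fun i => r i + (r i - r' i)) (fun _ => 1) i),
      QuotHas q g (chainEmb P hT) (chainMat K) := by
  obtain ⟨f', e', hfe, hg⟩ := H
  simp only [Submodule.subtype_apply] at hfe
  -- the chains with `r i = r' i + 1`, each with one basis vector of `X` outside `N`
  let ι1 := {i // r i + (r i - r' i) = r i + 1}
  have hι : ∀ i : ι1, r' i.1 < r i.1 := fun i => by have := i.2; omega
  let top : ι1 → ChainIdx P r := fun i => .inr ⟨i.1, r' i.1, hι i⟩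
  have htop : ∀ s, s ∉ Set.range (chainEmb P h1) → ∃ i, s = top i := by
    rintro (a | ⟨i, k⟩) hs
    · exact absurd (inl_mem_range_chainEmb h1 a) hs
    · rw [inr_mem_range_chainEmb] at hs
      have := k.2
      have := h2 i
      refine ⟨⟨i, by omega⟩, ?_⟩
      rw [chainIdx_inr_inj]
      exact ⟨rfl, by simp only; omega⟩
  have htop' : ∀ i, top i ∉ Set.range (chainEmb P h1) := fun i => by
    rw [inr_mem_range_chainEmb]; simp
  have hcoord : ∀ x : leftAnn h (LinearMap.ker q), ∀ t, t ∉ Set.range (chainEmb P h1) →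
      e'.repr (x : X) t = 0 := by
    intro x t ht
    have : e'.coord t ∘ₗ (leftAnn h (LinearMap.ker q)).subtype = 0 := f'.ext fun s => by
      have hne : t ≠ chainEmb P h1 s := fun h => ht ⟨s, h.symm⟩
      simp [hfe, hne]
    exact congr($this x)
  obtain ⟨v, hvq, hv⟩ := h.exists_dual hσ (LinearMap.ker q) (fun i : ι1 => e' (top i))
    (fun a ha => by
      ext i : 1
      have h5 := hcoord ⟨_, ha⟩ (top i) (htop' i)
      rw [map_sum, Finsupp.finsetSum_apply, Finset.sum_eq_single i] at h5
      · simpa using h5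
      · intro i' _ hne
        have : top i' ≠ top i := fun h6 => hne (by
          rw [chainIdx_inr_inj] at h6
          exact Subtype.ext h6.1)
        simp [this.symm]
      · simp)
  have hgr : ∀ s, ∀ y ∈ LinearMap.ker q, g (e' (chainEmb P h1 s)) y = 0 := fun s y hy => by
    rw [← hfe]
    exact (f' s).2 y hy
  have hg2 : ∀ s (i : ι1), g (e' s) (v i) = lastPair F i.1 s := by
    intro s i
    by_cases hs : s ∈ Set.range (chainEmb P h1)
    · obtain ⟨s, rfl⟩ := hs
      rw [hgr s _ (hvq i)]
      rcases s with a | ⟨i', k⟩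
      · rfl
      · simp only [chainEmb, lastPair, Sum.map_inr, Sigma.map, id, Fin.val_castLE]
        rw [if_neg]
        rintro ⟨h5, h6⟩
        have h7 := hι i
        have h8 := k.2
        have h9 : r' i' = r' i.1 := congr_arg r' h5
        omega
    · obtain ⟨i', rfl⟩ := htop s hs
      rw [hv]
      have h5 := hι i'
      have h6 := h2 i'.1
      simp only [lastPair, top]
      congr 1
      apply propext
      rw [Subtype.ext_iff]
      constructor
      · intro h; exact ⟨h, by rw [← h]; omega⟩
      · exact fun h => h.1
  choose y0 hy0 using fun t => hq (e' t)
  -- the preimages are corrected by vectors of `ker q` to be orthogonal to the rows outside `N`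
  let y : ChainIdx P r → Y := fun t => y0 t - ∑ i, op (g (e' (top i)) (y0 t)) • v i
  have hvq' : ∀ i, q (v i) = 0 := hvq
  have hy : ∀ t, q (y t) = e' t := fun t => by
    simp only [y, map_sub, map_sum, map_smul, hvq', hy0]
    simp
  have hg1 : ∀ s t, g (e' s) (y t) = chainMat K s t := by
    intro s t
    by_cases hs : s ∈ Set.range (chainEmb P h1)
    · obtain ⟨s, rfl⟩ := hs
      rw [← hfe, ← subForm_apply h hq, hy, hg, chainMat_emb_left]
    · obtain ⟨i, rfl⟩ := htop s hs
      simp only [y]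
      rw [h.sub_right, h.sum_right]
      simp only [h.op_smul_right, hv, unop_op]
      rw [Finset.sum_eq_single i (by intro b _ hb; rw [if_neg hb.symm, zero_mul]) (by simp)]
      rw [if_pos rfl, one_mul, sub_self]
      rcases t with b | ⟨i', k'⟩
      · rfl
      · simp only [chainMat, top]
        rw [if_neg]
        rintro ⟨h5, h6⟩
        have h7 := hι i
        have h8 := h2 i.1
        have h9 := k'.2
        have h10 : r i.1 = r i' := congr_arg r h5
        omega
  let u : ChainIdx P r ⊕ ι1 → Y := Sum.elim y v
  have hu : LinearIndependent Fᵐᵒᵖ u := by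
    rw [Fintype.linearIndependent_iff]
    intro a ha
    rw [Fintype.sum_sum_type] at ha
    simp only [u, Sum.elim_inl, Sum.elim_inr] at ha
    have hb : ∀ t, a (.inl t) = 0 := by
      have h5 := congr_arg q ha
      simp only [map_add, map_sum, map_smul, hvq', hy, smul_zero, Finset.sum_const_zero,
        add_zero, map_zero] at h5
      exact Fintype.linearIndependent_iff.mp e'.linearIndependent (fun t => a (.inl t)) h5
    simp only [hb, zero_smul, Finset.sum_const_zero, zero_add] at ha
    rintro (t | i)
    · exact hb t
    · have h5 := congr_arg (g (e' (top i))) ha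
      rw [h.sum_right, h.zero_right] at h5
      simp only [h.op_smul_right, hv] at h5
      rw [Finset.sum_eq_single i (by intro b _ hb; rw [if_neg hb.symm, zero_mul]) (by simp),
        if_pos rfl, one_mul] at h5
      exact unop_injective h5
  have hmem : ∀ x, u x ∈ Submodule.span Fᵐᵒᵖ (Set.range u) := fun x =>
    Submodule.subset_span ⟨x, rfl⟩
  obtain ⟨T, e0, he0, hR⟩ := exists_basis_extension u hu (LinearMap.ker q ⊓ rightKer h)
    (fun z => by
    let z1 := ∑ t, e'.repr (q z) t • y t
    let z2 := ∑ i, op (g (e' (top i)) (z - z1)) • v i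
    have hz1 : z - z1 ∈ LinearMap.ker q := by
      rw [LinearMap.mem_ker, map_sub, map_sum]
      simp only [map_smul, hy]
      rw [e'.sum_repr, sub_self]
    have hz2 : z2 ∈ LinearMap.ker q :=
      Submodule.sum_mem _ fun i _ => Submodule.smul_mem _ _ (hvq i)
    have hz : z - (z1 + z2) = z - z1 - z2 := by abel
    refine ⟨z1 + z2, Submodule.add_mem _
      (Submodule.sum_mem _ fun t _ => Submodule.smul_mem _ _ (hmem (.inl t)))
      (Submodule.sum_mem _ fun i _ => Submodule.smul_mem _ _ (hmem (.inr i))), ?_, fun x => ?_⟩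
    · rw [hz]; exact Submodule.sub_mem _ hz1 hz2
    rw [h.basis_left e', hz]
    refine Finset.sum_eq_zero fun s _ => ?_
    by_cases hs : s ∈ Set.range (chainEmb P h1)
    · obtain ⟨s, rfl⟩ := hs
      rw [hgr s _ (Submodule.sub_mem _ hz1 hz2), mul_zero]
    · obtain ⟨i, rfl⟩ := htop s hs
      rw [h.sub_right, h.sum_right]
      simp only [h.op_smul_right, hv]
      rw [Finset.sum_eq_single i (by intro b _ hb; rw [if_neg hb.symm, zero_mul]) (by simp),
        if_pos rfl, one_mul, unop_op, sub_self, mul_zero])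
  have h3 : ∀ i, r i ≤ r i + (r i - r' i) := fun i => by omega
  have hT : ∀ i : ι ⊕ Fin T,
      Sum.elim r (fun _ => 0) i ≤ Sum.elim (fun i => r i + (r i - r' i)) (fun _ => 1) i := by
    rintro (i | t)
    · exact h3 i
    · simp
  have hbij := chainExt_bijective (P := P) (c := fun i => r i + (r i - r' i)) h3
    (fun i => by have := h2 i; omega) T
  refine ⟨T, hT, e'.reindex (Equiv.ofBijective _ (chainExtRow_bijective T)),
    e0.reindex (Equiv.ofBijective _ hbij), ?_, ?_, ?_⟩
  · rw [(chainExtRow_bijective (P := P) (r := r) T).surjective.forall]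
    intro s
    rw [← chainExt_inl_inl h3, reindex_ofBijective_apply, reindex_ofBijective_apply, he0]
    exact hy s
  · rw [hbij.surjective.forall]
    intro x hx
    rw [reindex_ofBijective_apply]
    rcases chainExt_mem_range h3 T hT x hx with ⟨i, rfl⟩ | ⟨t, rfl⟩
    · rw [he0]; exact hvq' i
    · exact (hR t).1
  · rw [(chainExtRow_bijective (P := P) (r := r) T).surjective.forall]
    intro s
    rw [hbij.surjective.forall]
    intro x
    rw [reindex_ofBijective_apply, reindex_ofBijective_apply]
    refine chainMat_chainExt h3 (fun s t => ?_) (fun s i => ?_) (fun s t => (hR t).2 _) s x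
    · rw [he0]; exact hg1 s t
    · rw [he0]; exact hg2 s i

end lift

/-! ### Existence and uniqueness of the decomposition into a nonsingular part and chains -/

section starCongruent
variable {F : Type*} [DivisionRing F] {σ : F → F} {ι κ ν : Type*}

theorem conjTr_mul [Fintype κ] (hσ : IsInvolution σ) (A : Matrix ι κ F) (B : Matrix κ ν F) :
    conjTr σ (A * B) = conjTr σ B * conjTr σ A := by
  ext i j
  simp [conjTr, Matrix.mul_apply, hσ.map_sum, hσ.map_mul]

theorem conjTr_one [DecidableEq ι] (hσ : IsInvolution σ) : conjTr σ (1 : Matrix ι ι F) = 1 := by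
  ext i j
  by_cases h : i = j
  · subst h; simp [conjTr, hσ.map_one]
  · simp [conjTr, Matrix.one_apply, h, Ne.symm h, hσ.map_zero]

variable [Fintype ι] [Fintype κ] [DecidableEq ι] [DecidableEq κ] [Fintype ν] [DecidableEq ν]

theorem StarCongruent.isUnit (hσ : IsInvolution σ) {K : Matrix ι ι F} {K' : Matrix κ κ F}
    (h : StarCongruent σ K K') (hK : IsUnit K) : IsUnit K' := by
  obtain ⟨S, R, h1, h2, rfl⟩ := h
  obtain ⟨L, h3, h4⟩ := isUnit_iff_exists.mp hK
  have h5 : conjTr σ R * conjTr σ S = 1 := by rw [← conjTr_mul hσ, h1, conjTr_one hσ]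
  have h6 : conjTr σ S * conjTr σ R = 1 := by rw [← conjTr_mul hσ, h2, conjTr_one hσ]
  refine isUnit_iff_exists.mpr ⟨R * L * conjTr σ R, ?_, ?_⟩
  · calc conjTr σ S * K * S * (R * L * conjTr σ R)
        = conjTr σ S * (K * ((S * R) * L)) * conjTr σ R := by simp only [Matrix.mul_assoc]
      _ = 1 := by rw [h1, Matrix.one_mul, h3, Matrix.mul_one, h6]
  · calc R * L * conjTr σ R * (conjTr σ S * K * S)
        = R * (L * ((conjTr σ R * conjTr σ S) * K)) * S := by simp only [Matrix.mul_assoc]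
      _ = 1 := by rw [h5, Matrix.one_mul, h4, Matrix.mul_one, h2]

theorem coordMatrix_mul {ι κ : Type*} [Fintype κ] [DecidableEq ι] {X : Type*} [AddCommGroup X]
    [Module Fᵐᵒᵖ X]
    (u : Module.Basis ι Fᵐᵒᵖ X) (v : Module.Basis κ Fᵐᵒᵖ X) :
    (Matrix.of fun i j => unop (u.repr (v j) i)) * (Matrix.of fun i j => unop (v.repr (u j) i))
      = (1 : Matrix ι ι F) := by
  ext i j
  have h1 : u.repr (u j) i = ∑ k, v.repr (u j) k * u.repr (v k) i := by
    conv_lhs => rw [← v.sum_repr (u j)]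
    rw [map_sum, Finsupp.finsetSum_apply]
    simp
  have h2 := congr_arg unop h1
  rw [u.repr_self, Finsupp.single_apply, Finset.unop_sum] at h2
  simp only [Matrix.mul_apply, Matrix.of_apply, Matrix.one_apply]
  simp only [unop_mul] at h2
  rw [← h2, apply_ite unop]
  simp [eq_comm]

theorem starCongruent_of_bases {X : Type*} [AddCommGroup X] [Module Fᵐᵒᵖ X] {G : X → X → F}
    (hG : IsSesquilinear σ G) (b : Module.Basis ι Fᵐᵒᵖ X) (b' : Module.Basis κ Fᵐᵒᵖ X) :
    StarCongruent σ (Matrix.of fun i j => G (b i) (b j))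
      (Matrix.of fun i j => G (b' i) (b' j)) := by
  refine ⟨_, _, coordMatrix_mul b b', coordMatrix_mul b' b, ?_⟩
  ext i j
  simp only [Matrix.mul_apply, conjTr, Matrix.of_apply]
  rw [hG.basis_right b]
  refine Finset.sum_congr rfl fun k _ => ?_
  rw [hG.basis_left b (b' i)]

end starCongruent

section decomposition
variable {F : Type*} [DivisionRing F] {σ : F → F}

/-- A form on `X × Y` with `j : X → Y` has a matrix that consists of a nonsingular part and of
nonempty chains. -/
def SubDecomposes {X Y : Type*} [AddCommGroup X] [Module Fᵐᵒᵖ X] [AddCommGroup Y] [Module Fᵐᵒᵖ Y]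
    (j : X →ₗ[Fᵐᵒᵖ] Y) (g : X → Y → F) : Prop :=
  ∃ (p : ℕ) (K : Matrix (Fin p) (Fin p) F) (ι : Type) (_ : Fintype ι) (_ : DecidableEq ι)
    (r c : ι → ℕ) (hrc : ∀ i, r i ≤ c i), IsUnit K ∧ (∀ i, c i ≤ r i + 1) ∧ (∀ i, 1 ≤ c i) ∧
      SubHas j g (chainEmb (Fin p) hrc) (chainMat K)

/-- A form on `X × Y` with `q : Y → X` has a matrix that consists of a nonsingular part and of
nonempty chains. -/
def QuotDecomposes {X Y : Type*} [AddCommGroup X] [Module Fᵐᵒᵖ X] [AddCommGroup Y]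
    [Module Fᵐᵒᵖ Y] (q : Y →ₗ[Fᵐᵒᵖ] X) (g : X → Y → F) : Prop :=
  ∃ (p : ℕ) (K : Matrix (Fin p) (Fin p) F) (ι : Type) (_ : Fintype ι) (_ : DecidableEq ι)
    (r c : ι → ℕ) (hrc : ∀ i, r i ≤ c i), IsUnit K ∧ (∀ i, c i ≤ r i + 1) ∧ (∀ i, 1 ≤ c i) ∧
      QuotHas q g (chainEmb (Fin p) hrc) (chainMat K)

section
variable {X Y : Type*} [AddCommGroup X] [Module Fᵐᵒᵖ X] [AddCommGroup Y] [Module Fᵐᵒᵖ Y]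
  {g : X → Y → F}

theorem SubDecomposes.of_quot [Module.Finite Fᵐᵒᵖ Y] (hσ : IsInvolution σ)
    (h : IsSesquilinear σ g) {j : X →ₗ[Fᵐᵒᵖ] Y} (hj : Function.Injective j)
    (H : QuotDecomposes (leftAnn h ⊤).mkQ (quotForm h j)) : SubDecomposes j g := by
  obtain ⟨p, K, ι, _, _, r', r, hrc, hK, hcr, hc, H⟩ := H
  obtain ⟨T, hT, H⟩ := SubHas.lift hσ h hK hj hrc hcr hc H
  refine ⟨p, K, ι ⊕ Fin T, inferInstance, inferInstance, _, _, hT, hK, ?_, ?_, H⟩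
  · rintro (i | t)
    · have := hrc i
      simp only [Sum.elim_inl]
      omega
    · simp
  · rintro (i | t) <;> simp

theorem QuotDecomposes.of_sub [Module.Finite Fᵐᵒᵖ Y] (hσ : IsInvolution σ)
    (h : IsSesquilinear σ g) {q : Y →ₗ[Fᵐᵒᵖ] X} (hq : Function.Surjective q)
    (H : SubDecomposes (leftAnn h (LinearMap.ker q)).subtype (subForm h hq)) :
    QuotDecomposes q g := by
  obtain ⟨p, K, ι, _, _, r', r, hrc, hK, hcr, hc, H⟩ := H
  obtain ⟨T, hT, H⟩ := QuotHas.lift hσ h hq hrc hcr H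
  refine ⟨p, K, ι ⊕ Fin T, inferInstance, inferInstance, _, _, hT, hK, ?_, ?_, H⟩
  · rintro (i | t)
    · have := hcr i
      simp only [Sum.elim_inl]
      omega
    · simp
  · rintro (i | t)
    · have := hc i
      simp only [Sum.elim_inl]
      omega
    · simp

theorem SubDecomposes.of_nondegenerate [Module.Finite Fᵐᵒᵖ X] (hσ : IsInvolution σ)
    (h : IsSesquilinear σ g) {j : X →ₗ[Fᵐᵒᵖ] Y} (hj : Function.Bijective j) (hL : leftAnn h ⊤ = ⊥) :
    SubDecomposes j g := by
  let f := Module.finBasis Fᵐᵒᵖ X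
  let e := f.map (LinearEquiv.ofBijective j hj)
  let K : Matrix (Fin _) (Fin _) F := Matrix.of fun a b => g (f a) (e b)
  obtain ⟨y, -, hy⟩ := h.exists_dual hσ ⊤ f (fun a ha => by
    rw [hL, Submodule.mem_bot] at ha
    ext i : 1
    exact Fintype.linearIndependent_iff.mp f.linearIndependent a ha i)
  have hK : K * (Matrix.of fun b c => unop (e.repr (y c) b)) = 1 := by
    ext a c
    rw [Matrix.mul_apply, Matrix.one_apply, ← hy a c, h.basis_right e]
    rfl
  have hK' : IsUnit K := isUnit_iff_exists.mpr ⟨_, hK, mul_eq_one_comm.mp hK⟩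
  let φ : Fin (Module.finrank Fᵐᵒᵖ X) ≃
      ChainIdx (Fin (Module.finrank Fᵐᵒᵖ X)) (fun _ : Empty => 0) :=
    (Equiv.sumEmpty _ _).symm
  refine ⟨_, K, Empty, inferInstance, inferInstance, fun _ => 0, fun _ => 0, fun _ => le_rfl, hK',
    fun i => i.elim, fun i => i.elim, f.reindex φ, e.reindex φ, ?_, ?_⟩
  · rintro (a | ⟨i, -⟩)
    · simp [φ, e, chainEmb]
    · exact i.elim
  · rintro (a | ⟨i, -⟩) (b | ⟨i', -⟩)
    · simp [φ, chainMat, K]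
    · exact i'.elim
    · exact i.elim
    · exact i.elim

/-- A form on `X × Y` with an injection `j : X → Y` is nondegenerate with `j` bijective, or its
derived form lives on spaces of smaller total dimension. -/
theorem bijective_or_finrank_derived_sub_lt [Module.Finite Fᵐᵒᵖ X] [Module.Finite Fᵐᵒᵖ Y]
    (h : IsSesquilinear σ g) {j : X →ₗ[Fᵐᵒᵖ] Y} (hj : Function.Injective j) :
    (Function.Bijective j ∧ leftAnn h ⊤ = ⊥) ∨
      Module.finrank Fᵐᵒᵖ (X ⧸ leftAnn h ⊤) + Module.finrank Fᵐᵒᵖ X <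
        Module.finrank Fᵐᵒᵖ X + Module.finrank Fᵐᵒᵖ Y := by
  have h1 := Submodule.finrank_quotient_add_finrank (leftAnn h ⊤)
  have h2 := LinearMap.finrank_le_finrank_of_injective hj
  by_cases h3 : Module.finrank Fᵐᵒᵖ (leftAnn h ⊤) = 0
  · by_cases h4 : Module.finrank Fᵐᵒᵖ X = Module.finrank Fᵐᵒᵖ Y
    · exact Or.inl ⟨⟨hj, (LinearMap.injective_iff_surjective_of_finrank_eq_finrank h4).mp hj⟩,
        Submodule.finrank_eq_zero.mp h3⟩
    · right; omega
  · right; omega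

theorem finrank_derived_quot_le [Module.Finite Fᵐᵒᵖ X] [Module.Finite Fᵐᵒᵖ Y]
    (h : IsSesquilinear σ g) {q : Y →ₗ[Fᵐᵒᵖ] X} (hq : Function.Surjective q) :
    Module.finrank Fᵐᵒᵖ (leftAnn h (LinearMap.ker q)) + Module.finrank Fᵐᵒᵖ X ≤
        Module.finrank Fᵐᵒᵖ X + Module.finrank Fᵐᵒᵖ Y := by
  have h1 := Submodule.finrank_le (leftAnn h (LinearMap.ker q))
  have h2 := LinearMap.finrank_le_finrank_of_surjective hq
  omega

end

universe v

/-- Every form on a subspace or on a quotient decomposes into a nonsingular part and chains. The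
total dimension `N` drops along the derived forms until the form is nondegenerate; it may stay
the same in the step from a quotient to a subspace, so the claim about subspaces comes before
the claim about quotients for each `N`. -/
theorem decomposes_of_finrank (hσ : IsInvolution σ) (N : ℕ) :
    (∀ (X Y : Type v) [AddCommGroup X] [Module Fᵐᵒᵖ X] [AddCommGroup Y] [Module Fᵐᵒᵖ Y]
      [Module.Finite Fᵐᵒᵖ X] [Module.Finite Fᵐᵒᵖ Y] (g : X → Y → F) (_ : IsSesquilinear σ g)
      (j : X →ₗ[Fᵐᵒᵖ] Y) (_ : Function.Injective j),
      Module.finrank Fᵐᵒᵖ X + Module.finrank Fᵐᵒᵖ Y = N → SubDecomposes j g) ∧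
    (∀ (X Y : Type v) [AddCommGroup X] [Module Fᵐᵒᵖ X] [AddCommGroup Y] [Module Fᵐᵒᵖ Y]
      [Module.Finite Fᵐᵒᵖ X] [Module.Finite Fᵐᵒᵖ Y] (g : X → Y → F) (_ : IsSesquilinear σ g)
      (q : Y →ₗ[Fᵐᵒᵖ] X) (_ : Function.Surjective q),
      Module.finrank Fᵐᵒᵖ X + Module.finrank Fᵐᵒᵖ Y = N → QuotDecomposes q g) := by
  induction N using Nat.strong_induction_on with
  | _ N IH =>
  have hS : ∀ (X Y : Type v) [AddCommGroup X] [Module Fᵐᵒᵖ X] [AddCommGroup Y] [Module Fᵐᵒᵖ Y]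
      [Module.Finite Fᵐᵒᵖ X] [Module.Finite Fᵐᵒᵖ Y] (g : X → Y → F) (_ : IsSesquilinear σ g)
      (j : X →ₗ[Fᵐᵒᵖ] Y) (_ : Function.Injective j),
      Module.finrank Fᵐᵒᵖ X + Module.finrank Fᵐᵒᵖ Y = N → SubDecomposes j g := by
    intro X Y _ _ _ _ _ _ g h j hj hN
    rcases bijective_or_finrank_derived_sub_lt h hj with ⟨hb, hL⟩ | hlt
    · exact SubDecomposes.of_nondegenerate hσ h hb hL
    · exact SubDecomposes.of_quot hσ h hj ((IH _ (hN ▸ hlt)).2 _ _ _ (quotForm_sesquilinear h j) _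
        (Submodule.mkQ_surjective _) rfl)
  refine ⟨hS, fun X Y _ _ _ _ _ _ g h q hq hN => QuotDecomposes.of_sub hσ h hq ?_⟩
  rcases (finrank_derived_quot_le h hq).lt_or_eq with hlt | heq
  · exact (IH _ (hN ▸ hlt)).1 _ _ _ (subForm_sesquilinear h hq) _
      (Submodule.injective_subtype _) rfl
  · exact hS _ _ _ (subForm_sesquilinear h hq) _ (Submodule.injective_subtype _) (heq.trans hN)

/-! ### Uniqueness of the decomposition -/

section uniqueness

/-- The lengths `(r, c)` of the nonempty chains are determined by the lengths `(d, r)` of the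
nonempty chains of the derived form and by the total dimension: the derived form forgets only the
chains of lengths `(0, 1)`, whose number is found from the sum of the `c i`. -/
theorem filter_shapes_eq {ι ι' : Type} [Fintype ι] [Fintype ι'] {r c : ι → ℕ} {r' c' : ι' → ℕ}
    (hrc : ∀ i, r i ≤ c i) (hcr : ∀ i, c i ≤ r i + 1) (hrc' : ∀ i, r' i ≤ c' i)
    (hcr' : ∀ i, c' i ≤ r' i + 1) {d : ι → ℕ} {d' : ι' → ℕ} (φ : ℕ × ℕ → ℕ × ℕ)
    (hφ : ∀ i, 1 ≤ r i → φ (d i, r i) = (r i, c i))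
    (hφ' : ∀ i, 1 ≤ r' i → φ (d' i, r' i) = (r' i, c' i))
    (hd : (Finset.univ.val.map fun i => (d i, r i)).filter (fun x => 1 ≤ x.2) =
      (Finset.univ.val.map fun i => (d' i, r' i)).filter (fun x => 1 ≤ x.2))
    (hsum : ∑ i, c i = ∑ i, c' i) :
    (Finset.univ.val.map fun i => (r i, c i)).filter (fun x => 1 ≤ x.2) =
      (Finset.univ.val.map fun i => (r' i, c' i)).filter (fun x => 1 ≤ x.2) := by
  have key : ∀ {ι : Type} [Fintype ι] {r c : ι → ℕ} {d : ι → ℕ} (_ : ∀ i, r i ≤ c i)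
      (_ : ∀ i, c i ≤ r i + 1) (_ : ∀ i, 1 ≤ r i → φ (d i, r i) = (r i, c i)),
      ∃ n : ℕ, (Finset.univ.val.map fun i => (r i, c i)).filter (fun x => 1 ≤ x.2) =
        ((Finset.univ.val.map fun i => (d i, r i)).filter (fun x => 1 ≤ x.2)).map φ +
          Multiset.replicate n (0, 1) := by
    intro ι _ r c d hrc hcr hφ
    set M := (Finset.univ.val.map fun i => (r i, c i)).filter (fun x => 1 ≤ x.2) with hM
    have hmem : ∀ x ∈ M, x.1 ≤ x.2 ∧ x.2 ≤ x.1 + 1 ∧ 1 ≤ x.2 := by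
      intro x hx
      rw [hM, Multiset.mem_filter, Multiset.mem_map] at hx
      obtain ⟨⟨i, -, rfl⟩, h⟩ := hx
      exact ⟨hrc i, hcr i, h⟩
    refine ⟨(M.filter fun x => ¬ 1 ≤ x.1).card, ?_⟩
    rw [← Multiset.filter_add_not (fun x => 1 ≤ x.1) M]
    congr 1
    · rw [hM, Multiset.filter_filter, Multiset.filter_map, Multiset.filter_map, Multiset.map_map]
      have h1 : Multiset.filter ((fun x : ℕ × ℕ => 1 ≤ x.1 ∧ 1 ≤ x.2) ∘ fun i => (r i, c i))
          Finset.univ.val = Multiset.filter ((fun x : ℕ × ℕ => 1 ≤ x.2) ∘ fun i => (d i, r i))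
          Finset.univ.val := Multiset.filter_congr fun i _ => by
        have := hrc i
        simp only [Function.comp]
        omega
      rw [h1]
      refine Multiset.map_congr rfl fun i hi => ?_
      exact (hφ i (Multiset.mem_filter.mp hi).2).symm
    · refine Multiset.eq_replicate.mpr ⟨by rw [Multiset.filter_add_not], fun x hx => ?_⟩
      obtain ⟨h1, h2⟩ := Multiset.mem_filter.mp hx
      have := hmem x h1
      ext <;> simp only <;> omega
  have hs : ∀ {ι : Type} [Fintype ι] {r c : ι → ℕ},
      (((Finset.univ.val.map fun i => (r i, c i)).filter
        (fun x => 1 ≤ x.2)).map Prod.snd).sum = ∑ i, c i := by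
    intro ι _ r c
    rw [Multiset.filter_map, Multiset.map_map]
    change ((Finset.univ.filter fun i => 1 ≤ c i).val.map c).sum = _
    change ∑ i ∈ Finset.univ.filter (fun i => 1 ≤ c i), c i = _
    rw [Finset.sum_filter]
    refine Finset.sum_congr rfl fun i _ => ?_
    split_ifs <;> omega
  obtain ⟨n, hn⟩ := key hrc hcr hφ
  obtain ⟨n', hn'⟩ := key hrc' hcr' hφ'
  have h1 := hs (r := r) (c := c)
  have h2 := hs (r := r') (c := c')
  rw [hn] at h1 ⊢
  rw [hn'] at h2 ⊢
  rw [hd] at h1 ⊢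
  simp only [Multiset.map_add, Multiset.sum_add, Multiset.map_replicate, Multiset.sum_replicate,
    smul_eq_mul, mul_one] at h1 h2
  have : n = n' := by omega
  rw [this]

theorem finrank_chainIdx {P ι : Type} [Fintype P] [Fintype ι] {c : ι → ℕ} {Y : Type*}
    [AddCommGroup Y] [Module Fᵐᵒᵖ Y] (e : Module.Basis (ChainIdx P c) Fᵐᵒᵖ Y) :
    Module.finrank Fᵐᵒᵖ Y = Fintype.card P + ∑ i, c i := by
  rw [Module.finrank_eq_card_basis e]
  simp

theorem StarCongruent.card_eq {P P' : Type} [Fintype P] [DecidableEq P] [Fintype P']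
    [DecidableEq P'] {K : Matrix P P F} {K' : Matrix P' P' F} (h : StarCongruent σ K K') :
    Fintype.card P = Fintype.card P' := by
  obtain ⟨S, R, h1, h2, -⟩ := h
  exact Matrix.square_of_invertible S R h1 h2

/-- In a matrix of a nondegenerate form, all chains are empty. -/
theorem SubHas.chain_eq_zero {X Y : Type*} [AddCommGroup X] [Module Fᵐᵒᵖ X] [AddCommGroup Y]
    [Module Fᵐᵒᵖ Y] {g : X → Y → F} (h : IsSesquilinear σ g) {j : X →ₗ[Fᵐᵒᵖ] Y}
    (hj : Function.Bijective j) (hL : leftAnn h ⊤ = ⊥) {P ι : Type} [Fintype P] [Fintype ι]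
    [DecidableEq ι] {K : Matrix P P F} {r c : ι → ℕ} {hrc : ∀ i, r i ≤ c i}
    (H : SubHas j g (chainEmb P hrc) (chainMat K)) (i : ι) : c i = 0 := by
  obtain ⟨f, e, hfe, hg⟩ := H
  have h1 := finrank_chainIdx f
  rw [(LinearEquiv.ofBijective j hj).finrank_eq, finrank_chainIdx e] at h1
  have h2 := (Finset.sum_eq_sum_iff_of_le fun i _ => hrc i).mp (by omega) i (Finset.mem_univ i)
  by_contra hc
  have h3 : f (.inr ⟨i, r i - 1, by omega⟩) ∈ leftAnn h ⊤ := by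
    intro y _
    rw [h.basis_right e]
    refine Finset.sum_eq_zero fun t _ => ?_
    rw [hg]
    rcases t with b | ⟨i', k'⟩
    · simp [chainMat]
    · simp only [chainMat]
      rw [if_neg, zero_mul]
      rintro ⟨rfl, h5⟩
      have := k'.2
      omega
  rw [hL, Submodule.mem_bot] at h3
  exact f.ne_zero _ h3

theorem SubHas.starCongruent {X Y : Type*} [AddCommGroup X] [Module Fᵐᵒᵖ X] [AddCommGroup Y]
    [Module Fᵐᵒᵖ Y] {g : X → Y → F} (h : IsSesquilinear σ g) {j : X →ₗ[Fᵐᵒᵖ] Y}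
    (hj : Function.Bijective j) (hL : leftAnn h ⊤ = ⊥)
    {P ι P' ι' : Type} [Fintype P] [Fintype ι] [DecidableEq ι] [DecidableEq P]
    [Fintype P'] [Fintype ι'] [DecidableEq ι'] [DecidableEq P'] {K : Matrix P P F}
    {K' : Matrix P' P' F} {r c : ι → ℕ} {hrc : ∀ i, r i ≤ c i} {r' c' : ι' → ℕ}
    {hrc' : ∀ i, r' i ≤ c' i} (H : SubHas j g (chainEmb P hrc) (chainMat K))
    (H' : SubHas j g (chainEmb P' hrc') (chainMat K')) : StarCongruent σ K K' := by
  have hG : IsSesquilinear σ (fun x z => g x (j z)) :=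
    ⟨fun _ _ _ => h.add_left _ _ _, fun _ _ _ => h.smul_left _ _ _,
      fun _ _ _ => by rw [map_add, h.add_right], fun _ _ _ => by rw [map_smul, h.smul_right]⟩
  have key : ∀ {P ι : Type} [Fintype P] [Fintype ι] [DecidableEq ι] {K : Matrix P P F}
      {r c : ι → ℕ} {hrc : ∀ i, r i ≤ c i} (_ : SubHas j g (chainEmb P hrc) (chainMat K)),
      ∃ b : Module.Basis P Fᵐᵒᵖ X, K = Matrix.of fun i k => g (b i) (j (b k)) := by
    intro P ι _ _ _ K r c hrc H
    have : IsEmpty (Σ i, Fin (r i)) := ⟨fun ⟨i, k⟩ => by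
      have h1 := H.chain_eq_zero h hj hL i
      have h2 := hrc i
      have h3 := k.2
      omega⟩
    obtain ⟨f, e, hfe, hg⟩ := H
    refine ⟨f.reindex (Equiv.sumEmpty _ _), ?_⟩
    ext i k
    simp [hfe, hg, chainEmb, chainMat]
  obtain ⟨b, rfl⟩ := key H
  obtain ⟨b', rfl⟩ := key H'
  exact starCongruent_of_bases hG b b'

/-- The nonsingular part is unique up to `*`-congruence, and the nonempty chains are unique, by
induction along the derived forms. -/
theorem unique_of_finrank (hσ : IsInvolution σ) {P ι P' ι' : Type} [Fintype P] [Fintype ι]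
    [DecidableEq ι] [DecidableEq P] [Fintype P'] [Fintype ι'] [DecidableEq ι'] [DecidableEq P']
    {K : Matrix P P F} {K' : Matrix P' P' F} (hK : IsUnit K) (hK' : IsUnit K') (N : ℕ) :
    (∀ (X Y : Type v) [AddCommGroup X] [Module Fᵐᵒᵖ X] [AddCommGroup Y] [Module Fᵐᵒᵖ Y]
      [Module.Finite Fᵐᵒᵖ X] [Module.Finite Fᵐᵒᵖ Y] (g : X → Y → F) (_ : IsSesquilinear σ g)
      (j : X →ₗ[Fᵐᵒᵖ] Y) (_ : Function.Injective j)
      (r c : ι → ℕ) (hrc : ∀ i, r i ≤ c i) (_ : ∀ i, c i ≤ r i + 1)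
      (r' c' : ι' → ℕ) (hrc' : ∀ i, r' i ≤ c' i) (_ : ∀ i, c' i ≤ r' i + 1),
      Module.finrank Fᵐᵒᵖ X + Module.finrank Fᵐᵒᵖ Y = N →
      SubHas j g (chainEmb P hrc) (chainMat K) → SubHas j g (chainEmb P' hrc') (chainMat K') →
      StarCongruent σ K K' ∧
      (Finset.univ.val.map fun i => (r i, c i)).filter (fun x => 1 ≤ x.2) =
        (Finset.univ.val.map fun i => (r' i, c' i)).filter (fun x => 1 ≤ x.2)) ∧
    (∀ (X Y : Type v) [AddCommGroup X] [Module Fᵐᵒᵖ X] [AddCommGroup Y] [Module Fᵐᵒᵖ Y]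
      [Module.Finite Fᵐᵒᵖ X] [Module.Finite Fᵐᵒᵖ Y] (g : X → Y → F) (_ : IsSesquilinear σ g)
      (q : Y →ₗ[Fᵐᵒᵖ] X) (_ : Function.Surjective q)
      (r c : ι → ℕ) (hrc : ∀ i, r i ≤ c i) (_ : ∀ i, c i ≤ r i + 1)
      (r' c' : ι' → ℕ) (hrc' : ∀ i, r' i ≤ c' i) (_ : ∀ i, c' i ≤ r' i + 1),
      Module.finrank Fᵐᵒᵖ X + Module.finrank Fᵐᵒᵖ Y = N →
      QuotHas q g (chainEmb P hrc) (chainMat K) → QuotHas q g (chainEmb P' hrc') (chainMat K') →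
      StarCongruent σ K K' ∧
      (Finset.univ.val.map fun i => (r i, c i)).filter (fun x => 1 ≤ x.2) =
        (Finset.univ.val.map fun i => (r' i, c' i)).filter (fun x => 1 ≤ x.2)) := by
  induction N using Nat.strong_induction_on with
  | _ N IH =>
  have hS : ∀ (X Y : Type v) [AddCommGroup X] [Module Fᵐᵒᵖ X] [AddCommGroup Y] [Module Fᵐᵒᵖ Y]
      [Module.Finite Fᵐᵒᵖ X] [Module.Finite Fᵐᵒᵖ Y] (g : X → Y → F) (_ : IsSesquilinear σ g)
      (j : X →ₗ[Fᵐᵒᵖ] Y) (_ : Function.Injective j)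
      (r c : ι → ℕ) (hrc : ∀ i, r i ≤ c i) (_ : ∀ i, c i ≤ r i + 1)
      (r' c' : ι' → ℕ) (hrc' : ∀ i, r' i ≤ c' i) (_ : ∀ i, c' i ≤ r' i + 1),
      Module.finrank Fᵐᵒᵖ X + Module.finrank Fᵐᵒᵖ Y = N →
      SubHas j g (chainEmb P hrc) (chainMat K) → SubHas j g (chainEmb P' hrc') (chainMat K') →
      StarCongruent σ K K' ∧
      (Finset.univ.val.map fun i => (r i, c i)).filter (fun x => 1 ≤ x.2) =
        (Finset.univ.val.map fun i => (r' i, c' i)).filter (fun x => 1 ≤ x.2) := by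
    intro X Y _ _ _ _ _ _ g h j hj r c hrc hcr r' c' hrc' hcr' hN H H'
    rcases bijective_or_finrank_derived_sub_lt h hj with ⟨hb, hL⟩ | hlt
    · refine ⟨H.starCongruent h hb hL H', ?_⟩
      rw [Multiset.filter_eq_nil.mpr, Multiset.filter_eq_nil.mpr]
      · intro x hx
        obtain ⟨i, -, rfl⟩ := Multiset.mem_map.mp hx
        simp [H'.chain_eq_zero h hb hL i]
      · intro x hx
        obtain ⟨i, -, rfl⟩ := Multiset.mem_map.mp hx
        simp [H.chain_eq_zero h hb hL i]
    · -- a chain of lengths `(d, r)` of the derived form is one of lengths `(r, d + 1)` here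
      obtain ⟨h1, h2⟩ := (IH _ (hN ▸ hlt)).2 _ _ _ (quotForm_sesquilinear h j) _
        (Submodule.mkQ_surjective _) _ _ (fun i => by have := hcr i; omega)
        (fun i => by have := hrc i; omega) _ _ (fun i => by have := hcr' i; omega)
        (fun i => by have := hrc' i; omega) rfl
        (H.push hσ h hK j hrc fun i => by have := hcr i; omega)
        (H'.push hσ h hK' j hrc' fun i => by have := hcr' i; omega)
      refine ⟨h1, filter_shapes_eq hrc hcr hrc' hcr' (fun x => (x.2, x.1 + 1)) ?_ ?_ h2 ?_⟩
      · intro i hi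
        have := hrc i
        ext <;> simp only
        omega
      · intro i hi
        have := hrc' i
        ext <;> simp only
        omega
      · obtain ⟨f, e, -⟩ := H
        obtain ⟨f', e', -⟩ := H'
        have h3 := finrank_chainIdx e
        rw [finrank_chainIdx e', h1.card_eq] at h3
        omega
  refine ⟨hS, ?_⟩
  intro X Y _ _ _ _ _ _ g h q hq r c hrc hcr r' c' hrc' hcr' hN H H'
  have key : StarCongruent σ K K' ∧
      (Finset.univ.val.map fun i => (r i - (c i - r i), r i)).filter (fun x => 1 ≤ x.2) =
        (Finset.univ.val.map fun i => (r' i - (c' i - r' i), r' i)).filter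
          (fun x => 1 ≤ x.2) := by
    have hr : ∀ i, r i - (c i - r i) ≤ r i := fun i => by omega
    have hr' : ∀ i, r' i - (c' i - r' i) ≤ r' i := fun i => by omega
    have hr2 : ∀ i, r i ≤ r i - (c i - r i) + 1 := fun i => by have := hcr i; omega
    have hr2' : ∀ i, r' i ≤ r' i - (c' i - r' i) + 1 := fun i => by have := hcr' i; omega
    rcases (finrank_derived_quot_le h hq).lt_or_eq with hlt | heq
    · exact (IH _ (hN ▸ hlt)).1 _ _ _ (subForm_sesquilinear h hq) _
        (Submodule.injective_subtype _) _ _ hr hr2 _ _ hr' hr2' rfl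
        (H.push hσ h hq hrc hcr hr) (H'.push hσ h hq hrc' hcr' hr')
    · exact hS _ _ _ (subForm_sesquilinear h hq) _
        (Submodule.injective_subtype _) _ _ hr hr2 _ _ hr' hr2' (heq.trans hN)
        (H.push hσ h hq hrc hcr hr) (H'.push hσ h hq hrc' hcr' hr')
  obtain ⟨h1, h2⟩ := key
  -- a chain of lengths `(d, r)` of the derived form is one of lengths `(r, 2 r - d)` here
  refine ⟨h1, filter_shapes_eq hrc hcr hrc' hcr' (fun x => (x.2, x.2 + (x.2 - x.1))) ?_ ?_ h2 ?_⟩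
  · intro i hi
    have := hrc i
    have := hcr i
    ext <;> simp only
    omega
  · intro i hi
    have := hrc' i
    have := hcr' i
    ext <;> simp only
    omega
  · obtain ⟨f, e, -⟩ := H
    obtain ⟨f', e', -⟩ := H'
    have h3 := finrank_chainIdx e
    rw [finrank_chainIdx e', h1.card_eq] at h3
    omega

end uniqueness

end decomposition

/-! ### Block matrices with singular summands and chains -/

/-- The matrix `[A|B]` as one matrix. -/
def BlockMatrix.full {F : Type*} (M : BlockMatrix F) (i : M.ι) : M.ι ⊕ M.κ → F :=
  Sum.elim (M.A i) (M.B i)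

section hasMatrix
variable {F : Type*} [DivisionRing F] {σ : F → F} {V : Type*} [AddCommGroup V] [Module Fᵐᵒᵖ V]
  {U : Submodule Fᵐᵒᵖ V}

theorem hasMatrix_onSub_iff {g : U → V → F} (hg : IsSesquilinear σ g) (M : BlockMatrix F) :
    (SubspaceForm.onSub g hg).HasMatrix M ↔
      SubHas U.subtype g (Sum.inl : M.ι → M.ι ⊕ M.κ) M.full := by
  constructor
  · rintro ⟨e, hU, hspan, hA, hB⟩
    have hli : LinearIndependent Fᵐᵒᵖ fun i => e (Sum.inl i) :=
      e.linearIndependent.comp _ Sum.inl_injective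
    let f := (Module.Basis.span hli).map (LinearEquiv.ofEq _ _ hspan)
    have hf : ∀ i, f i = ⟨e (Sum.inl i), hU i⟩ := fun i => by
      ext
      simp [f, Module.Basis.span_apply]
    refine ⟨f, e, fun s => by rw [hf]; rfl, ?_⟩
    rintro s (t | t)
    · rw [hf]; exact hA s t
    · rw [hf]; exact hB s t
  · rintro ⟨f, e, hfe, hg'⟩
    have hU : ∀ i, e (Sum.inl i) ∈ U := fun i => by rw [← hfe]; exact (f i).2
    have hf : ∀ i, (⟨e (Sum.inl i), hU i⟩ : U) = f i := fun i => Subtype.ext (hfe i).symm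
    refine ⟨e, hU, ?_, fun i j => ?_, fun i j => ?_⟩
    · have : (Set.range fun i => e (Sum.inl i)) = U.subtype '' Set.range f := by
        rw [← Set.range_comp]
        exact congr_arg Set.range (funext fun i => (hfe i).symm)
      rw [this, Submodule.span_image, f.span_eq, Submodule.map_top, Submodule.range_subtype]
    · rw [hf]; exact hg' i (Sum.inl j)
    · rw [hf]; exact hg' i (Sum.inr j)

theorem mem_span_inr_iff {A B : Type*} (e : Module.Basis (A ⊕ B) Fᵐᵒᵖ V) (x : V) :
    x ∈ Submodule.span Fᵐᵒᵖ (Set.range fun j => e (Sum.inr j)) ↔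
      ∀ a, e.repr x (Sum.inl a) = 0 := by
  have : (Set.range fun j => e (Sum.inr j)) = e '' Set.range Sum.inr := by
    rw [← Set.range_comp]; rfl
  rw [this, Module.Basis.mem_span_image]
  constructor
  · intro h a
    by_contra hne
    obtain ⟨b, hb⟩ := h (Finsupp.mem_support_iff.mpr hne)
    exact Sum.inr_ne_inl hb
  · rintro h (a | b) hx
    · exact absurd (h a) (Finsupp.mem_support_iff.mp hx)
    · exact ⟨b, rfl⟩

theorem hasMatrix_onQuot_iff {g : V ⧸ U → V → F} (hg : IsSesquilinear σ g) (M : BlockMatrix F) :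
    (SubspaceForm.onQuot g hg).HasMatrix M ↔
      QuotHas U.mkQ g (Sum.inl : M.ι → M.ι ⊕ M.κ) M.full := by
  constructor
  · rintro ⟨e, hspan, hA, hB⟩
    obtain ⟨⟨f, hf⟩, hz⟩ := exists_basis_quotient e Sum.inl Sum.inl_injective U (fun x => by
      rw [← mem_span_inr_iff, hspan])
    refine ⟨f, e, fun s => (hf s).symm, hz, ?_⟩
    rintro s (t | t)
    · rw [hf]; exact hA s t
    · rw [hf]; exact hB s t
  · rintro ⟨f, e, hfe, hz, hg'⟩
    refine ⟨e, ?_, fun i j => ?_, fun i j => ?_⟩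
    · ext x
      rw [mem_span_inr_iff, ← Submodule.Quotient.mk_eq_zero, ← Submodule.mkQ_apply]
      constructor
      · intro h
        apply f.repr.injective
        ext s
        rw [repr_of_matched f e Sum.inl_injective hfe hz, h s]
        simp
      · intro h s
        rw [← repr_of_matched f e Sum.inl_injective hfe hz, h]
        simp
    · rw [← Submodule.mkQ_apply, hfe]; exact hg' i (Sum.inl j)
    · rw [← Submodule.mkQ_apply, hfe]; exact hg' i (Sum.inr j)

end hasMatrix

section reindex
variable {F : Type*} {R C R' C' : Type} {emb : R → C} {M : R → C → F} {emb' : R' → C'}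
  {M' : R' → C' → F}

/-- Two matrices with matched rows and columns agree up to renaming the rows and columns. -/
def SameFormat (emb : R → C) (M : R → C → F) (emb' : R' → C') (M' : R' → C' → F) : Prop :=
  ∃ (ρ : R ≃ R') (γ : C ≃ C'), (∀ s, γ (emb s) = emb' (ρ s)) ∧ ∀ s t, M s t = M' (ρ s) (γ t)

theorem SameFormat.symm (h : SameFormat emb M emb' M') : SameFormat emb' M' emb M := by
  obtain ⟨ρ, γ, h1, h2⟩ := h
  refine ⟨ρ.symm, γ.symm, fun s => ?_, fun s t => ?_⟩
  · rw [Equiv.symm_apply_eq, h1, Equiv.apply_symm_apply]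
  · rw [h2, Equiv.apply_symm_apply, Equiv.apply_symm_apply]

theorem SameFormat.trans {R'' C'' : Type} {emb'' : R'' → C''} {M'' : R'' → C'' → F}
    (h : SameFormat emb M emb' M') (h' : SameFormat emb' M' emb'' M'') :
    SameFormat emb M emb'' M'' := by
  obtain ⟨ρ, γ, h1, h2⟩ := h
  obtain ⟨ρ', γ', h1', h2'⟩ := h'
  refine ⟨ρ.trans ρ', γ.trans γ', fun s => ?_, fun s t => ?_⟩
  · simp [h1, h1']
  · simp [h2, h2']

variable [DivisionRing F] {σ : F → F} {X Y : Type*}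
  [AddCommGroup X] [Module Fᵐᵒᵖ X] [AddCommGroup Y] [Module Fᵐᵒᵖ Y] {g : X → Y → F}

theorem SubHas.reindex {j : X →ₗ[Fᵐᵒᵖ] Y} (h : SameFormat emb M emb' M')
    (H : SubHas j g emb M) : SubHas j g emb' M' := by
  obtain ⟨ρ, γ, h1, h2⟩ := h
  obtain ⟨f, e, hfe, hg⟩ := H
  refine ⟨f.reindex ρ, e.reindex γ, ρ.surjective.forall.mpr fun s => ?_,
    ρ.surjective.forall.mpr fun s => γ.surjective.forall.mpr fun t => ?_⟩
  · simp [← h1, hfe]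
  · simp [← h2, hg]

theorem QuotHas.reindex {q : Y →ₗ[Fᵐᵒᵖ] X} (h : SameFormat emb M emb' M')
    (H : QuotHas q g emb M) : QuotHas q g emb' M' := by
  obtain ⟨ρ, γ, h1, h2⟩ := h
  obtain ⟨f, e, hfe, hz, hg⟩ := H
  refine ⟨f.reindex ρ, e.reindex γ, ρ.surjective.forall.mpr fun s => ?_,
    γ.surjective.forall.mpr fun t ht => ?_,
    ρ.surjective.forall.mpr fun s => γ.surjective.forall.mpr fun t => ?_⟩
  · simp [← h1, hfe]
  · simp only [Module.Basis.reindex_apply, Equiv.symm_apply_apply]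
    refine hz t ?_
    rintro ⟨s, rfl⟩
    exact ht ⟨ρ s, (h1 s).symm⟩
  · simp [← h2, hg]

theorem chain_sameFormat {P ι ι' : Type} [DecidableEq ι] [DecidableEq ι'] (K : Matrix P P F)
    {r c : ι → ℕ} {r' c' : ι' → ℕ} (hrc : ∀ i, r i ≤ c i) (hrc' : ∀ i, r' i ≤ c' i)
    (φ : ι ≃ ι') (hr : ∀ i, r i = r' (φ i)) (hc : ∀ i, c i = c' (φ i)) :
    SameFormat (chainEmb P hrc) (chainMat K) (chainEmb P hrc') (chainMat K) := by
  refine ⟨Equiv.sumCongr (Equiv.refl P) (Equiv.sigmaCongr φ fun i => finCongr (hr i)),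
    Equiv.sumCongr (Equiv.refl P) (Equiv.sigmaCongr φ fun i => finCongr (hc i)), ?_, ?_⟩
  · rintro (a | ⟨i, k⟩) <;> rfl
  · rintro (a | ⟨i, k⟩) (b | ⟨i', k'⟩) <;> simp [chainMat, Equiv.sigmaCongr]

/-- A nonsingular matrix `S` with inverse `R` changes the part `P` of a basis. -/
theorem exists_basis_change {P P' Q : Type} [Fintype P] [Fintype P'] [Fintype Q] [DecidableEq P]
    [DecidableEq P'] {S : Matrix P P' F} {R : Matrix P' P F} (h1 : S * R = 1) (h2 : R * S = 1)
    (f : Module.Basis (P ⊕ Q) Fᵐᵒᵖ X) :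
    ∃ f' : Module.Basis (P' ⊕ Q) Fᵐᵒᵖ X,
      (∀ b, f' (.inl b) = ∑ a, op (S a b) • f (.inl a)) ∧ ∀ q, f' (.inr q) = f (.inr q) := by
  let u : P' ⊕ Q → X := Sum.elim (fun b => ∑ a, op (S a b) • f (.inl a)) fun q => f (.inr q)
  have hu : ∀ a, f (.inl a) = ∑ b, op (R b a) • u (.inl b) := by
    intro a
    simp only [u, Sum.elim_inl, Finset.smul_sum, smul_smul, ← op_mul]
    rw [Finset.sum_comm]
    simp only [← Finset.sum_smul, ← Finset.op_sum, ← Matrix.mul_apply, h1, Matrix.one_apply]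
    rw [Finset.sum_eq_single a]
    · simp
    · intro b _ hb; simp [hb]
    · simp
  have hspan : ⊤ ≤ Submodule.span Fᵐᵒᵖ (Set.range u) := by
    rw [← f.span_eq, Submodule.span_le]
    rintro _ ⟨a | q, rfl⟩
    · rw [hu]
      exact Submodule.sum_mem _ fun b _ => Submodule.smul_mem _ _ (Submodule.subset_span ⟨_, rfl⟩)
    · exact Submodule.subset_span ⟨.inr q, rfl⟩
  have hcard : Fintype.card (P' ⊕ Q) = Module.finrank Fᵐᵒᵖ X := by
    rw [Module.finrank_eq_card_basis f, Fintype.card_sum, Fintype.card_sum,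
      Matrix.square_of_invertible S R h1 h2]
  have hli := linearIndependent_of_top_le_span_of_card_eq_finrank hspan hcard
  exact ⟨Module.Basis.mk hli hspan, fun b => by simp [u], fun q => by simp [u]⟩

section congr
variable {P P' ι : Type} [Fintype P] [DecidableEq ι] {K : Matrix P P F} {K' : Matrix P' P' F}
  {r c : ι → ℕ} {hrc : ∀ i, r i ≤ c i}

theorem chainMat_basis_change (hg : IsSesquilinear σ g) {S : Matrix P P' F}
    {f : ChainIdx P r → X} {e : ChainIdx P c → Y} {f' : ChainIdx P' r → X}
    {e' : ChainIdx P' c → Y} (hf : ∀ b, f' (.inl b) = ∑ a, op (S a b) • f (.inl a))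
    (hf' : ∀ q, f' (.inr q) = f (.inr q)) (he : ∀ b, e' (.inl b) = ∑ a, op (S a b) • e (.inl a))
    (he' : ∀ q, e' (.inr q) = e (.inr q)) (h : ∀ s t, g (f s) (e t) = chainMat K s t)
    (s : ChainIdx P' r) (t : ChainIdx P' c) :
    g (f' s) (e' t) = chainMat (conjTr σ S * K * S) s t := by
  rcases s with a | s <;> rcases t with b | t
  · simp only [hf, he, hg.sum_left, hg.sum_right, hg.op_smul_left, hg.op_smul_right, h, chainMat,
      Matrix.mul_apply, conjTr, Matrix.of_apply, unop_op, Finset.sum_mul]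
    rw [Finset.sum_comm]
    simp only [mul_assoc]
  · simp [hf, he', hg.sum_left, hg.op_smul_left, h, chainMat]
  · simp [hf', he, hg.sum_right, hg.op_smul_right, h, chainMat]
  · rw [hf', he', h]
    rfl

variable [Fintype P'] [Fintype ι] [DecidableEq P] [DecidableEq P']

theorem SubHas.congr (hg : IsSesquilinear σ g) {j : X →ₗ[Fᵐᵒᵖ] Y} (h : StarCongruent σ K K')
    (H : SubHas j g (chainEmb P hrc) (chainMat K)) :
    SubHas j g (chainEmb P' hrc) (chainMat K') := by
  obtain ⟨S, R, h1, h2, rfl⟩ := h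
  obtain ⟨f, e, hfe, hgm⟩ := H
  obtain ⟨f', hf, hf'⟩ := exists_basis_change h1 h2 f
  obtain ⟨e', he, he'⟩ := exists_basis_change h1 h2 e
  refine ⟨f', e', ?_, chainMat_basis_change hg hf hf' he he' hgm⟩
  rintro (b | q)
  · change _ = e' (.inl b)
    rw [hf, he, map_sum]
    simp only [map_smul, hfe]
    rfl
  · rw [hf', hfe]
    exact (he' _).symm

theorem QuotHas.congr (hg : IsSesquilinear σ g) {q : Y →ₗ[Fᵐᵒᵖ] X} (h : StarCongruent σ K K')
    (H : QuotHas q g (chainEmb P hrc) (chainMat K)) :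
    QuotHas q g (chainEmb P' hrc) (chainMat K') := by
  obtain ⟨S, R, h1, h2, rfl⟩ := h
  obtain ⟨f, e, hfe, hz, hgm⟩ := H
  obtain ⟨f', hf, hf'⟩ := exists_basis_change h1 h2 f
  obtain ⟨e', he, he'⟩ := exists_basis_change h1 h2 e
  refine ⟨f', e', ?_, ?_, chainMat_basis_change hg hf hf' he he' hgm⟩
  · rintro (b | s)
    · change q (e' (.inl b)) = _
      rw [hf, he, map_sum]
      simp only [map_smul, ← hfe]
      rfl
    · rw [hf', ← hfe]
      exact congr_arg q (he' _)
  · rintro (b | ⟨i, k⟩) ht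
    · exact absurd (inl_mem_range_chainEmb hrc b) ht
    · rw [inr_mem_range_chainEmb] at ht
      rw [he']
      exact hz _ (by rwa [inr_mem_range_chainEmb])

end congr
end reindex

section singular
variable (F : Type*) [DivisionRing F]

/-- The numbers of rows and of columns of `[A|B]` for a singular summand. -/
def SingularSummand.shape : SingularSummand → ℕ × ℕ
  | .jordan q _ => (q, q)
  | .jordanE q => (q, q + 1)

theorem SingularSummand.shape_injective : Function.Injective SingularSummand.shape := by
  rintro (⟨q, hq⟩ | q) (⟨q', hq'⟩ | q') h <;> simp only [shape, Prod.mk.injEq] at h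
  · obtain ⟨rfl, -⟩ := h; rfl
  · omega
  · omega
  · obtain ⟨rfl, -⟩ := h; rfl

theorem SingularSummand.one_le_shape (s : SingularSummand) : 1 ≤ s.shape.2 := by
  rcases s with ⟨q, hq⟩ | q
  · exact hq
  · exact Nat.le_add_left 1 q

theorem SingularSummand.exists_shape {r c : ℕ} (h1 : r ≤ c) (h2 : c ≤ r + 1) (h3 : 1 ≤ c) :
    ∃ s : SingularSummand, s.shape = (r, c) := by
  rcases h1.eq_or_lt with rfl | h
  · exact ⟨.jordan r h3, rfl⟩
  · obtain rfl : c = r + 1 := by omega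
    exact ⟨.jordanE r, rfl⟩

theorem SingularSummand.exists_format (s : SingularSummand) :
    s.shape.1 ≤ s.shape.2 ∧ s.shape.2 ≤ s.shape.1 + 1 ∧
    ∃ (ρ : (s.toBlock F).ι ≃ Fin s.shape.1)
      (γ : (s.toBlock F).ι ⊕ (s.toBlock F).κ ≃ Fin s.shape.2),
      (∀ i, (γ (.inl i) : ℕ) = ρ i) ∧
      ∀ i t, (s.toBlock F).full i t = if (ρ i : ℕ) + 1 = γ t then 1 else 0 := by
  rcases s with ⟨q, hq⟩ | q
  · refine ⟨le_rfl, Nat.le_succ _, Equiv.refl (Fin q), Equiv.sumEmpty (Fin q) (Fin 0),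
      fun i => rfl, ?_⟩
    rintro (i : Fin q) ((t : Fin q) | t)
    · change jordanBlock q (0 : F) i t = if (i : ℕ) + 1 = t then 1 else 0
      simp only [jordanBlock, Matrix.of_apply]
      by_cases h : i = t
      · subst h; simp
      · simp [h]
    · exact Fin.elim0 t
  · refine ⟨Nat.le_succ _, le_rfl, Equiv.refl (Fin q), finSumFinEquiv, fun i => rfl, ?_⟩
    rintro (i : Fin q) ((t : Fin q) | (t : Fin 1))
    · change jordanBlock q (0 : F) i t = if (i : ℕ) + 1 = t then 1 else 0
      simp only [jordanBlock, Matrix.of_apply]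
      by_cases h : i = t
      · subst h; simp
      · simp [h]
    · change lastColumn F q i t = if (i : ℕ) + 1 = q + (t : ℕ) then 1 else 0
      have : (t : ℕ) = 0 := by omega
      rw [this]
      rfl

/-- Putting a chain in front of a family of chains. -/
def consChain {ι : Type} (a : ℕ) (r : ι → ℕ) :
    Fin a ⊕ (Σ i, Fin (r i)) ≃ Σ i : Option ι, Fin (i.elim a r) where
  toFun
    | .inl k => ⟨none, k⟩
    | .inr s => ⟨some s.1, s.2⟩
  invFun
    | ⟨none, k⟩ => .inl k
    | ⟨some i, k⟩ => .inr ⟨i, k⟩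
  left_inv := by rintro (k | ⟨i, k⟩) <;> rfl
  right_inv := by rintro ⟨_ | i, k⟩ <;> rfl

/-- A sum of singular summands is a family of chains of the corresponding shapes. -/
theorem singularSum_format (L : List SingularSummand) :
    ∃ (ι : Type) (_ : Fintype ι) (_ : DecidableEq ι) (r c : ι → ℕ),
      (Finset.univ.val.map fun i => (r i, c i)) = (L.map SingularSummand.shape : List _) ∧
      (∀ i, r i ≤ c i) ∧ (∀ i, c i ≤ r i + 1) ∧
      ∃ (ρ : (singularSum F L).ι ≃ Σ i, Fin (r i))
        (γ : (singularSum F L).ι ⊕ (singularSum F L).κ ≃ Σ i, Fin (c i)),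
        (∀ x, (γ (.inl x)).1 = (ρ x).1 ∧ ((γ (.inl x)).2 : ℕ) = (ρ x).2) ∧
        ∀ x t, (singularSum F L).full x t =
          if (ρ x).1 = (γ t).1 ∧ ((ρ x).2 : ℕ) + 1 = (γ t).2 then 1 else 0 := by
  induction L with
  | nil =>
    have h0 : IsEmpty (singularSum F []).ι := inferInstanceAs (IsEmpty (Fin 0))
    have h1 : IsEmpty (singularSum F []).κ := inferInstanceAs (IsEmpty (Fin 0))
    exact ⟨Empty, inferInstance, inferInstance, fun _ => 0, fun _ => 0, rfl, fun i => i.elim,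
      fun i => i.elim, Equiv.equivOfIsEmpty _ _, Equiv.equivOfIsEmpty _ _,
      fun x => h0.elim x, fun x => h0.elim x⟩
  | cons s L IH =>
    obtain ⟨ι, _, _, r, c, hM, hrc, hcr, ρ, γ, h1, h2⟩ := IH
    obtain ⟨hs1, hs2, ρ', γ', h1', h2'⟩ := s.exists_format F
    let shuffle : ((s.toBlock F).ι ⊕ (singularSum F L).ι) ⊕
        ((s.toBlock F).κ ⊕ (singularSum F L).κ) ≃
        ((s.toBlock F).ι ⊕ (s.toBlock F).κ) ⊕ ((singularSum F L).ι ⊕ (singularSum F L).κ) :=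
      Equiv.sumSumSumComm _ _ _ _
    refine ⟨Option ι, inferInstance, inferInstance, fun i => i.elim s.shape.1 r,
      fun i => i.elim s.shape.2 c, ?_, ?_, ?_,
      (Equiv.sumCongr ρ' ρ).trans (consChain _ _),
      shuffle.trans ((Equiv.sumCongr γ' γ).trans (consChain _ _)), ?_, ?_⟩
    · rw [List.map_cons, ← Multiset.cons_coe, ← hM]
      rw [univ_option]
      change (none ::ₘ Finset.univ.val.map some).map _ = _
      rw [Multiset.map_cons, Multiset.map_map]
      rfl
    · rintro (_ | i)
      · exact hs1
      · exact hrc i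
    · rintro (_ | i)
      · exact hs2
      · exact hcr i
    · rintro (x | x)
      · exact ⟨rfl, h1' x⟩
      · exact ⟨congr_arg some (h1 x).1, (h1 x).2⟩
    · have hne : ∀ {i : ι} {p : Prop} [Decidable p],
          (0 : F) = if (none : Option ι) = some i ∧ p then 1 else 0 := by simp
      have hne' : ∀ {i : ι} {p : Prop} [Decidable p],
          (0 : F) = if some i = (none : Option ι) ∧ p then 1 else 0 := by simp
      have heq : ∀ {p : Prop} [Decidable p], (if p then (1 : F) else 0) =
          if (none : Option ι) = none ∧ p then 1 else 0 := by simp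
      have heq' : ∀ {i i' : ι} {p : Prop} [Decidable p], (if i = i' ∧ p then (1 : F) else 0) =
          if some i = some i' ∧ p then 1 else 0 := by simp
      rintro (x | x) ((t | t) | (t | t))
      · exact (h2' x (.inl t)).trans heq
      · exact hne
      · exact (h2' x (.inr t)).trans heq
      · exact hne
      · exact hne'
      · exact (h2 x (.inl t)).trans heq'
      · exact hne'
      · exact (h2 x (.inr t)).trans heq'

/-- A nonsingular block matrix together with singular summands is, up to renaming of rows and
columns, a nonsingular part together with chains. -/
theorem sum_singularSum_format (M : BlockMatrix F) [IsEmpty M.κ] (L : List SingularSummand) :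
    ∃ (ι : Type) (_ : Fintype ι) (_ : DecidableEq ι) (r c : ι → ℕ),
      (Finset.univ.val.map fun i => (r i, c i)) = (L.map SingularSummand.shape : List _) ∧
      (∀ i, c i ≤ r i + 1) ∧ ∃ hrc : ∀ i, r i ≤ c i,
      SameFormat (Sum.inl : (M.sum (singularSum F L)).ι → _ ⊕ (M.sum (singularSum F L)).κ)
        (M.sum (singularSum F L)).full (chainEmb M.ι hrc) (chainMat M.A) := by
  obtain ⟨ι, i1, i2, r, c, hM, hrc, hcr, ρ, γ, h1, h2⟩ := singularSum_format F L
  let shuffle : (M.ι ⊕ (singularSum F L).ι) ⊕ (M.κ ⊕ (singularSum F L).κ) ≃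
        (M.ι ⊕ M.κ) ⊕ ((singularSum F L).ι ⊕ (singularSum F L).κ) :=
      Equiv.sumSumSumComm _ _ _ _
  refine ⟨ι, i1, i2, r, c, hM, hcr, hrc, Equiv.sumCongr (Equiv.refl _) ρ,
    shuffle.trans (Equiv.sumCongr (Equiv.sumEmpty _ _) γ), ?_, ?_⟩
  · rintro (a | x)
    · rfl
    · change Sum.inr (γ (.inl x)) = Sum.inr ⟨(ρ x).1, Fin.castLE (hrc _) (ρ x).2⟩
      congr 1
      obtain ⟨h3, h4⟩ := h1 x
      generalize γ (.inl x) = y at h3 h4 ⊢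
      obtain ⟨i, k⟩ := y
      simp only at h3 h4
      subst h3
      congr 1
      exact Fin.ext h4
  · rintro (a | x) ((b | y) | (b | y))
    · rfl
    · rfl
    · exact isEmptyElim b
    · rfl
    · rfl
    · exact h2 x (.inl y)
    · exact isEmptyElim b
    · exact h2 x (.inr y)

end singular

theorem exists_equiv_of_map_univ_eq {ι ι' α : Type} [Fintype ι] [Fintype ι'] [DecidableEq α]
    {f : ι → α} {g : ι' → α} (h : Finset.univ.val.map f = Finset.univ.val.map g) :
    ∃ φ : ι ≃ ι', ∀ i, f i = g (φ i) := by
  classical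
  have key : ∀ y, Nonempty ({x // f x = y} ≃ {x // g x = y}) := fun y => by
    rw [← Fintype.card_eq, Fintype.card_subtype, Fintype.card_subtype]
    have := congr_arg (Multiset.count y) h
    simp only [Multiset.count_map, @eq_comm _ y] at this
    exact this
  let φ := (Equiv.sigmaFiberEquiv f).symm.trans
    ((Equiv.sigmaCongrRight fun y => (key y).some).trans (Equiv.sigmaFiberEquiv g))
  refine ⟨φ, fun i => ?_⟩
  exact (((key (f i)).some ⟨i, rfl⟩).2).symm

/-! ### The regularizing decomposition -/

section regularization
variable {F : Type*} [DivisionRing F] {σ : F → F} {V : Type*} [AddCommGroup V] [Module Fᵐᵒᵖ V]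
  [Module.Finite Fᵐᵒᵖ V] {U : Submodule Fᵐᵒᵖ V}

/-- Every form on a subspace or on a quotient has a matrix that consists of a nonsingular block and
of singular summands. -/
theorem exists_hasMatrix (hσ : IsInvolution σ) (G : SubspaceForm σ U) :
    ∃ (p : ℕ) (K : Matrix (Fin p) (Fin p) F) (L : List SingularSummand),
      IsUnit K ∧ G.HasMatrix ((BlockMatrix.regular K).sum (singularSum F L)) := by
  have key : ∀ {ι : Type} [Fintype ι] [DecidableEq ι] {r c : ι → ℕ} (hrc : ∀ i, r i ≤ c i)
      (_ : ∀ i, c i ≤ r i + 1) (_ : ∀ i, 1 ≤ c i) {p : ℕ} (K : Matrix (Fin p) (Fin p) F),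
      ∃ L : List SingularSummand, SameFormat (chainEmb (Fin p) hrc) (chainMat K)
        (Sum.inl : ((BlockMatrix.regular K).sum (singularSum F L)).ι → _ ⊕
          ((BlockMatrix.regular K).sum (singularSum F L)).κ)
        ((BlockMatrix.regular K).sum (singularSum F L)).full := by
    intro ι _ _ r c hrc hcr hc p K
    choose s hs using fun i => SingularSummand.exists_shape (hrc i) (hcr i) (hc i)
    have : IsEmpty (BlockMatrix.regular K).κ := inferInstanceAs (IsEmpty (Fin 0))
    obtain ⟨ι', _, _, r', c', hM, -, hrc', hfmt⟩ :=
      sum_singularSum_format F (BlockMatrix.regular K) ((Finset.univ : Finset ι).toList.map s)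
    refine ⟨_, SameFormat.trans ?_ hfmt.symm⟩
    rw [List.map_map, ← Multiset.map_coe, Finset.coe_toList] at hM
    obtain ⟨φ, hφ⟩ := exists_equiv_of_map_univ_eq hM.symm
    simp only [Function.comp, hs, Prod.mk.injEq] at hφ
    exact chain_sameFormat K hrc hrc' φ (fun i => (hφ i).1) fun i => (hφ i).2
  rcases G with ⟨g, hg⟩ | ⟨g, hg⟩
  · obtain ⟨p, K, ι, _, _, r, c, hrc, hK, hcr, hc, H⟩ :=
      (decomposes_of_finrank hσ _).1 _ _ g hg U.subtype U.injective_subtype rfl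
    obtain ⟨L, hL⟩ := key hrc hcr hc K
    exact ⟨p, K, L, hK, (hasMatrix_onSub_iff hg _).mpr (H.reindex hL)⟩
  · obtain ⟨p, K, ι, _, _, r, c, hrc, hK, hcr, hc, H⟩ :=
      (decomposes_of_finrank hσ _).2 _ _ g hg U.mkQ U.mkQ_surjective rfl
    obtain ⟨L, hL⟩ := key hrc hcr hc K
    exact ⟨p, K, L, hK, (hasMatrix_onQuot_iff hg _).mpr (H.reindex hL)⟩

theorem perm_iff_shape {L L' : List SingularSummand} : L.Perm L' ↔
    (L.map SingularSummand.shape : Multiset (ℕ × ℕ)) = (L'.map SingularSummand.shape : List _) := by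
  rw [← Multiset.map_coe, ← Multiset.map_coe,
    (Multiset.map_injective SingularSummand.shape_injective).eq_iff, Multiset.coe_eq_coe]

theorem filter_shape (L : List SingularSummand) :
    Multiset.filter (fun x : ℕ × ℕ => 1 ≤ x.2) (L.map SingularSummand.shape : List _) =
      (L.map SingularSummand.shape : List _) := by
  rw [Multiset.filter_eq_self]
  intro x hx
  rw [Multiset.mem_coe, List.mem_map] at hx
  obtain ⟨s, -, rfl⟩ := hx
  exact s.one_le_shape

/-- The matrices of a form that consist of a nonsingular block and of singular summands are
determined up to `*`-congruence of the block and permutation of the summands. -/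
theorem hasMatrix_iff (hσ : IsInvolution σ) (G : SubspaceForm σ U) (M M' : BlockMatrix F)
    [IsEmpty M.κ] [IsEmpty M'.κ] (L L' : List SingularSummand) (hM : IsUnit M.A)
    (H : G.HasMatrix (M.sum (singularSum F L))) :
    (IsUnit M'.A ∧ G.HasMatrix (M'.sum (singularSum F L'))) ↔
      (StarCongruent σ M.A M'.A ∧ L.Perm L') := by
  obtain ⟨ι, _, _, r, c, hL, hcr, hrc, hfmt⟩ := sum_singularSum_format F M L
  obtain ⟨ι', _, _, r', c', hL', hcr', hrc', hfmt'⟩ := sum_singularSum_format F M' L'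
  constructor
  · rintro ⟨hM', H'⟩
    have key : StarCongruent σ M.A M'.A ∧
        (Finset.univ.val.map fun i => (r i, c i)).filter (fun x => 1 ≤ x.2) =
        (Finset.univ.val.map fun i => (r' i, c' i)).filter (fun x => 1 ≤ x.2) := by
      rcases G with ⟨g, hg⟩ | ⟨g, hg⟩
      · rw [hasMatrix_onSub_iff] at H H'
        exact (unique_of_finrank hσ hM hM' _).1 _ _ g hg _ U.injective_subtype _ _ hrc hcr _ _
          hrc' hcr' rfl (H.reindex hfmt) (H'.reindex hfmt')
      · rw [hasMatrix_onQuot_iff] at H H'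
        exact (unique_of_finrank hσ hM hM' _).2 _ _ g hg _ U.mkQ_surjective _ _ hrc hcr _ _
          hrc' hcr' rfl (H.reindex hfmt) (H'.reindex hfmt')
    refine ⟨key.1, ?_⟩
    rw [perm_iff_shape, ← filter_shape, ← hL, key.2, hL', filter_shape]
  · rintro ⟨hK, hp⟩
    refine ⟨hK.isUnit hσ hM, ?_⟩
    rw [perm_iff_shape, ← hL, ← hL'] at hp
    obtain ⟨φ, hφ⟩ := exists_equiv_of_map_univ_eq hp
    simp only [Prod.mk.injEq] at hφ
    have hc := chain_sameFormat M'.A hrc hrc' φ (fun i => (hφ i).1) fun i => (hφ i).2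
    rcases G with ⟨g, hg⟩ | ⟨g, hg⟩
    · rw [hasMatrix_onSub_iff] at H ⊢
      exact (((H.reindex hfmt).congr hg hK).reindex hc).reindex hfmt'.symm
    · rw [hasMatrix_onQuot_iff] at H ⊢
      exact (((H.reindex hfmt).congr hg hK).reindex hc).reindex hfmt'.symm

end regularization

end regularization

/-! ### Nonsingular sesquilinear forms over the complex numbers and their cosquares -/

section cosquare
variable {σ : ℂ →+* ℂ} {W : Type*} [AddCommGroup W] [Module ℂ W]

/-- `Φ` is the cosquare of the nondegenerate form `B`, sesquilinear for the involution `σ`. -/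
structure IsCosquare (σ : ℂ →+* ℂ) (B : W →ₛₗ[σ] W →ₗ[ℂ] ℂ) (Φ : Module.End ℂ W) : Prop where
  invol : ∀ a, σ (σ a) = a
  apply : ∀ x y, B x y = σ (B (Φ y) x)
  right_sep : ∀ y, (∀ x, B x y = 0) → y = 0

/-- The operator `Φ - c`. -/
def shift (Φ : Module.End ℂ W) (c : ℂ) : Module.End ℂ W := Φ - c • 1

theorem shift_apply (Φ : Module.End ℂ W) (c : ℂ) (x : W) : shift Φ c x = Φ x - c • x := rfl

theorem apply_eq_shift (Φ : Module.End ℂ W) (c : ℂ) (x : W) : Φ x = c • x + shift Φ c x := by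
  rw [shift_apply]; abel

theorem commute_shift (Φ : Module.End ℂ W) (c : ℂ) : Commute Φ (shift Φ c) :=
  (Commute.refl Φ).sub_right ((Commute.one_right Φ).smul_right c)

/-- A matrix of a form in some basis. -/
def Realizes {ι : Type*} (B : W →ₛₗ[σ] W →ₗ[ℂ] ℂ) (M : Matrix ι ι ℂ) : Prop :=
  ∃ b : Module.Basis ι ℂ W, ∀ i j, B (b i) (b j) = M i j

namespace IsCosquare
variable {B : W →ₛₗ[σ] W →ₗ[ℂ] ℂ} {Φ : Module.End ℂ W}

theorem injective (h : IsCosquare σ B Φ) : Function.Injective Φ := by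
  rw [injective_iff_map_eq_zero]
  intro y hy
  refine h.right_sep y fun x => ?_
  rw [h.apply, hy]
  simp

theorem isometry (h : IsCosquare σ B Φ) (x y : W) : B (Φ x) (Φ y) = B x y := by
  rw [h.apply x y, h.apply (Φ y) x, h.invol]

theorem bijective [FiniteDimensional ℂ W] (h : IsCosquare σ B Φ) : Function.Bijective Φ :=
  ⟨h.injective, LinearMap.injective_iff_surjective.mp h.injective⟩

theorem pow_bijective [FiniteDimensional ℂ W] (h : IsCosquare σ B Φ) (k : ℕ) :
    Function.Bijective (Φ ^ k) := by
  rw [Module.End.coe_pow]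
  exact h.bijective.iterate k

theorem left_sep [FiniteDimensional ℂ W] (h : IsCosquare σ B Φ) (x : W) (hx : ∀ y, B x y = 0) :
    x = 0 := by
  refine h.right_sep x fun y => ?_
  obtain ⟨y, rfl⟩ := h.bijective.2 y
  have := h.apply x y
  rw [hx, eq_comm, map_eq_zero] at this
  exact this

theorem map_inv_inv (h : IsCosquare σ B Φ) (c : ℂ) : (σ (σ c)⁻¹)⁻¹ = c := by
  rw [map_inv₀, h.invol, inv_inv]

/-- The operators `Φ - c` and `Φ - (σ c)⁻¹` are adjoint up to `Φ` and a scalar. -/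
theorem adjoint (h : IsCosquare σ B Φ) {c : ℂ} (hc : c ≠ 0) (x y : W) :
    B x (shift Φ c y) = -c * B (shift Φ (σ c)⁻¹ x) (Φ y) := by
  simp only [shift_apply, map_sub, map_smulₛₗ, map_inv₀, h.invol, LinearMap.sub_apply,
    LinearMap.smul_apply, smul_eq_mul, RingHom.id_apply, h.isometry]
  field_simp
  ring

theorem adjoint_pow (h : IsCosquare σ B Φ) {c : ℂ} (hc : c ≠ 0) (k : ℕ) (x y : W) :
    B x ((shift Φ c ^ k) y) = (-c) ^ k * B ((shift Φ (σ c)⁻¹ ^ k) x) ((Φ ^ k) y) := by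
  induction k generalizing x y with
  | zero => simp
  | succ k ih =>
    rw [pow_succ', Module.End.mul_apply, h.adjoint hc,
      ← Module.End.mul_apply Φ, ((commute_shift Φ c).pow_right k).eq, Module.End.mul_apply, ih,
      ← Module.End.mul_apply, ← Module.End.mul_apply, ← pow_succ, ← pow_succ, pow_succ]
    ring

theorem adjoint_pow' (h : IsCosquare σ B Φ) {c : ℂ} (hc : c ≠ 0) (k : ℕ) (x y : W) :
    B x ((shift Φ (σ c)⁻¹ ^ k) y) =
      (-(σ c)⁻¹) ^ k * B ((shift Φ c ^ k) x) ((Φ ^ k) y) := by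
  have := h.adjoint_pow (c := (σ c)⁻¹) (inv_ne_zero ((map_ne_zero σ).mpr hc)) k x y
  rwa [h.map_inv_inv] at this

theorem apply_eigenvector (h : IsCosquare σ B Φ) {c : ℂ} (hc : c ≠ 0) {a : W}
    (ha : shift Φ c a = 0) (k : ℕ) (y : W) : B a ((Φ ^ k) y) = ((σ c)⁻¹) ^ k * B a y := by
  have hΦ : Φ a = c • a := by rw [apply_eq_shift Φ c, ha, add_zero]
  have hc' : σ c ≠ 0 := (map_ne_zero σ).mpr hc
  induction k with
  | zero => simp
  | succ k ih =>
    have h1 := h.isometry a ((Φ ^ k) y)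
    rw [hΦ, map_smulₛₗ, LinearMap.smul_apply, smul_eq_mul] at h1
    rw [pow_succ', Module.End.mul_apply, pow_succ', mul_assoc, ← ih, ← h1]
    field_simp

theorem exists_pow_apply_eq [FiniteDimensional ℂ W] (h : IsCosquare σ B Φ) {c : ℂ} (k m : ℕ)
    {v : W} (hv : (shift Φ c ^ m) v = 0) : ∃ w, (Φ ^ k) w = v ∧ (shift Φ c ^ m) w = 0 := by
  obtain ⟨w, rfl⟩ := (h.pow_bijective k).2 v
  refine ⟨w, rfl, (h.pow_bijective k).1 ?_⟩
  rw [map_zero, ← Module.End.mul_apply, (((commute_shift Φ c).pow_left k).pow_right m).eq]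
  exact hv

/-- A chain of maximal length for an eigenvalue `c` is paired to a vector that is annihilated by
the same power of `Φ - (σ c)⁻¹`. -/
theorem exists_pair [FiniteDimensional ℂ W] [Nontrivial W] (h : IsCosquare σ B Φ) :
    ∃ (c : ℂ) (n : ℕ) (x z : W), c ≠ 0 ∧ 1 ≤ n ∧ (shift Φ c ^ n) x = 0 ∧
      (shift Φ (σ c)⁻¹ ^ n) z = 0 ∧ B ((shift Φ c ^ (n - 1)) x) z ≠ 0 := by
  obtain ⟨c, hc⟩ := Module.End.exists_eigenvalue Φ
  obtain ⟨v, hv⟩ := hc.exists_hasEigenvector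
  have hvΦ := hv.apply_eq_smul
  have hv0 := hv.2
  have hc0 : c ≠ 0 := by
    rintro rfl
    rw [zero_smul] at hvΦ
    exact hv0 (h.injective (hvΦ.trans (map_zero Φ).symm))
  have hvs : shift Φ c v = 0 := by rw [shift_apply, hvΦ, sub_self]
  obtain ⟨m1, hm1⟩ := Filter.eventually_atTop.mp
    (LinearMap.eventually_isCompl_ker_pow_range_pow (shift Φ c))
  obtain ⟨m2, hm2⟩ := Filter.eventually_atTop.mp
    (LinearMap.eventually_isCompl_ker_pow_range_pow (shift Φ (σ c)⁻¹))
  set m := max m1 m2 + 1 with hm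
  have hC := hm1 m (by omega)
  have hC' := hm2 m (by omega)
  classical
  have hex : ∃ k, ∀ x, (shift Φ c ^ m) x = 0 → (shift Φ c ^ k) x = 0 := ⟨m, fun x hx => hx⟩
  set n := Nat.find hex with hn
  have hn1 := Nat.find_spec hex
  rw [← hn] at hn1
  have hn0 : 1 ≤ n := by
    by_contra hcon
    have h0 : n = 0 := by omega
    rw [h0] at hn1
    refine hv0 (hn1 v ?_)
    rw [hm, pow_succ, Module.End.mul_apply, hvs, map_zero]
  have hn2 := Nat.find_min hex (m := n - 1) (by omega)
  push Not at hn2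
  obtain ⟨x, hx, hxn⟩ := hn2
  have ha : shift Φ c ((shift Φ c ^ (n - 1)) x) = 0 := by
    rw [← Module.End.mul_apply, ← pow_succ', Nat.sub_add_cancel hn0, hn1 x hx]
  have hz : ∃ z, (shift Φ (σ c)⁻¹ ^ m) z = 0 ∧ B ((shift Φ c ^ (n - 1)) x) z ≠ 0 := by
    by_contra! hcon
    refine hxn (h.left_sep _ fun y => ?_)
    obtain ⟨y1, hy1, y2, ⟨u, rfl⟩, rfl⟩ := Submodule.mem_sup.mp (hC'.sup_eq_top ▸
      Submodule.mem_top (x := y))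
    rw [map_add, hcon y1 hy1, h.adjoint_pow' hc0, hm, pow_succ (shift Φ c), Module.End.mul_apply,
      ha]
    simp
  obtain ⟨z, hz, hzx⟩ := hz
  refine ⟨c, n, x, z, hc0, hn0, hn1 x hx, ?_, hzx⟩
  refine h.right_sep _ fun y => ?_
  obtain ⟨y1, hy1, y2, ⟨u, rfl⟩, rfl⟩ := Submodule.mem_sup.mp (hC.sup_eq_top ▸
    Submodule.mem_top (x := y))
  rw [map_add, LinearMap.add_apply, h.adjoint_pow' hc0, hn1 y1 hy1]
  have h5 : (shift Φ (σ c)⁻¹ ^ m) ((shift Φ (σ c)⁻¹ ^ n) z) = 0 := by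
    rw [← Module.End.mul_apply, ← pow_add, add_comm, pow_add, Module.End.mul_apply, hz, map_zero]
  obtain ⟨w, hw, hw'⟩ := h.exists_pow_apply_eq m m h5
  have h6 := h.adjoint_pow' hc0 m u w
  rw [hw', map_zero, hw, eq_comm, mul_eq_zero] at h6
  rw [h6.resolve_left (pow_ne_zero _ (neg_ne_zero.mpr (inv_ne_zero ((map_ne_zero σ).mpr hc0))))]
  simp

end IsCosquare

/-! ### Orthogonal splitting -/

/-- The restriction of a form to a subspace. -/
def restrictForm (B : W →ₛₗ[σ] W →ₗ[ℂ] ℂ) (X : Submodule ℂ W) : X →ₛₗ[σ] X →ₗ[ℂ] ℂ :=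
  B.domRestrict₁₂ X X

theorem restrictForm_apply (B : W →ₛₗ[σ] W →ₗ[ℂ] ℂ) (X : Submodule ℂ W) (x y : X) :
    restrictForm B X x y = B x y := rfl

variable {B : W →ₛₗ[σ] W →ₗ[ℂ] ℂ} {Φ : Module.End ℂ W}

/-- A `Φ`-stable subspace on which the form is nondegenerate. -/
structure IsRegularSubspace (B : W →ₛₗ[σ] W →ₗ[ℂ] ℂ) (Φ : Module.End ℂ W) (X : Submodule ℂ W) :
    Prop where
  stable : ∀ x ∈ X, Φ x ∈ X
  nondeg : ∀ y ∈ X, (∀ x ∈ X, B x y = 0) → y = 0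

theorem IsRegularSubspace.isCosquare (h : IsCosquare σ B Φ) {X : Submodule ℂ W}
    (hX : IsRegularSubspace B Φ X) :
    IsCosquare σ (restrictForm B X) (Φ.restrict hX.stable) where
  invol := h.invol
  apply x y := h.apply x y
  right_sep y hy := Subtype.ext (hX.nondeg y y.2 fun x hx => hy ⟨x, hx⟩)

/-- A `Φ`-stable subspace on which the form is nondegenerate has an orthogonal complement of the
same kind. -/
theorem IsRegularSubspace.exists_complement [FiniteDimensional ℂ W] (h : IsCosquare σ B Φ)
    {X : Submodule ℂ W} (hX : IsRegularSubspace B Φ X) :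
    ∃ X' : Submodule ℂ W, IsRegularSubspace B Φ X' ∧ IsCompl X X' ∧
      (∀ x ∈ X, ∀ y ∈ X', B x y = 0) ∧ ∀ x ∈ X, ∀ y ∈ X', B y x = 0 := by
  let b := Module.finBasis ℂ X
  let f : W →ₗ[ℂ] (Fin (Module.finrank ℂ X) → ℂ) := LinearMap.pi fun i => B (b i)
  have hf : ∀ y, y ∈ LinearMap.ker f ↔ ∀ x ∈ X, B x y = 0 := by
    intro y
    rw [LinearMap.mem_ker]
    constructor
    · intro hy x hx
      have h1 : x = ∑ i, b.repr ⟨x, hx⟩ i • (b i : W) := by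
        have h2 := congr_arg X.subtype (b.sum_repr ⟨x, hx⟩)
        rw [map_sum] at h2
        exact h2.symm
      rw [h1, map_sum, LinearMap.sum_apply]
      refine Finset.sum_eq_zero fun i _ => ?_
      have h2 : B (b i) y = 0 := congr_fun hy i
      rw [map_smulₛₗ, LinearMap.smul_apply, h2, smul_zero]
    · intro hy
      ext i
      exact hy _ (b i).2
  have hsurjX : ∀ x ∈ X, ∃ x' ∈ X, Φ x' = x := by
    have h1 : Function.Surjective (Φ.restrict hX.stable) :=
      (IsCosquare.bijective (hX.isCosquare h)).2
    intro x hx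
    obtain ⟨x', hx'⟩ := h1 ⟨x, hx⟩
    exact ⟨x', x'.2, congr_arg Subtype.val hx'⟩
  have hsymm : ∀ x ∈ X, ∀ y ∈ LinearMap.ker f, B y x = 0 := fun x hx y hy => by
    rw [h.apply, (hf y).mp hy _ (hX.stable x hx), map_zero]
  have hdisj : Disjoint X (LinearMap.ker f) := by
    rw [Submodule.disjoint_def]
    intro x hx hxf
    exact hX.nondeg x hx ((hf x).mp hxf)
  have hcompl : IsCompl X (LinearMap.ker f) := by
    refine ⟨hdisj, ?_⟩
    rw [codisjoint_iff]
    apply Submodule.eq_top_of_finrank_eq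
    have h1 := Submodule.finrank_sup_add_finrank_inf_eq X (LinearMap.ker f)
    rw [hdisj.eq_bot, finrank_bot, add_zero] at h1
    have h2 := LinearMap.finrank_range_add_finrank_ker f
    have h3 := Submodule.finrank_le (LinearMap.range f)
    have h4 := Submodule.finrank_le (X ⊔ LinearMap.ker f)
    rw [Module.finrank_fin_fun] at h3
    omega
  refine ⟨LinearMap.ker f, ⟨fun y hy => ?_, fun y hy hy0 => ?_⟩, hcompl,
    fun x hx y hy => (hf y).mp hy x hx, hsymm⟩
  · rw [hf]
    intro x hx
    obtain ⟨x', hx', rfl⟩ := hsurjX x hx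
    rw [h.isometry]
    exact (hf y).mp hy x' hx'
  · refine h.right_sep y fun x => ?_
    obtain ⟨x1, hx1, x2, hx2, rfl⟩ := Submodule.mem_sup.mp (hcompl.sup_eq_top ▸
      Submodule.mem_top (x := x))
    rw [map_add, LinearMap.add_apply, (hf y).mp hy x1 hx1, hy0 x2 hx2, add_zero]

theorem Realizes.fromBlocks {X X' : Submodule ℂ W} (hc : IsCompl X X')
    (h1 : ∀ x ∈ X, ∀ y ∈ X', B x y = 0) (h2 : ∀ x ∈ X, ∀ y ∈ X', B y x = 0)
    {ι ι' : Type*} {M : Matrix ι ι ℂ} {M' : Matrix ι' ι' ℂ} (hM : Realizes (restrictForm B X) M)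
    (hM' : Realizes (restrictForm B X') M') : Realizes B (Matrix.fromBlocks M 0 0 M') := by
  obtain ⟨b, hb⟩ := hM
  obtain ⟨b', hb'⟩ := hM'
  have h3 : ∀ i, ((b.prod b').map (Submodule.prodEquivOfIsCompl X X' hc)) (.inl i) = b i :=
    fun i => by simp
  have h4 : ∀ i, ((b.prod b').map (Submodule.prodEquivOfIsCompl X X' hc)) (.inr i) = b' i :=
    fun i => by simp
  refine ⟨(b.prod b').map (Submodule.prodEquivOfIsCompl X X' hc), ?_⟩
  rintro (i | i) (j | j)
  · rw [h3, h3]; exact hb i j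
  · rw [h3, h4]; exact h1 _ (b i).2 _ (b' j).2
  · rw [h3, h4]; exact h2 _ (b j).2 _ (b' i).2
  · rw [h4, h4]; exact hb' i j

/-- If every nonzero form splits off a summand of a given kind, then every form is a direct sum
of such summands. -/
theorem exists_realizes_listSum {S : Type} (block : S → BlockMatrix ℂ)
    (hS : ∀ (W : Type) [AddCommGroup W] [Module ℂ W] [FiniteDimensional ℂ W] [Nontrivial W]
      (B : W →ₛₗ[σ] W →ₗ[ℂ] ℂ) (Φ : Module.End ℂ W), IsCosquare σ B Φ →
      ∃ (X : Submodule ℂ W) (s : S), IsRegularSubspace B Φ X ∧ X ≠ ⊥ ∧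
        Realizes (restrictForm B X) (block s).A) (n : ℕ) :
    ∀ (W : Type) [AddCommGroup W] [Module ℂ W] [FiniteDimensional ℂ W]
      (B : W →ₛₗ[σ] W →ₗ[ℂ] ℂ) (Φ : Module.End ℂ W), IsCosquare σ B Φ →
      Module.finrank ℂ W = n → ∃ C : List S, Realizes B (BlockMatrix.listSum (C.map block)).A := by
  induction n using Nat.strong_induction_on with
  | _ n ih =>
  intro W _ _ _ B Φ h hn
  rcases subsingleton_or_nontrivial W with hW | hW
  · refine ⟨[], ?_⟩
    exact ⟨(Module.Basis.empty W : Module.Basis (Fin 0) ℂ W), fun i => i.elim0⟩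
  · obtain ⟨X, s, hX, hX0, hs⟩ := hS W B Φ h
    obtain ⟨X', hX', hc, h1, h2⟩ := hX.exists_complement h
    have h3 := Submodule.finrank_add_eq_of_isCompl hc
    have h4 : Module.finrank ℂ X ≠ 0 := fun h0 => hX0 (Submodule.finrank_eq_zero.mp h0)
    obtain ⟨C, hC⟩ := ih (Module.finrank ℂ X') (by omega) X' _ _ (hX'.isCosquare h) rfl
    exact ⟨s :: C, Realizes.fromBlocks hc h1 h2 hs hC⟩

theorem Realizes.starCongruent {ι κ : Type*} [Fintype ι] [Fintype κ] [DecidableEq ι]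
    [DecidableEq κ] {K : Matrix ι ι ℂ} {K' : Matrix κ κ ℂ} (h : Realizes B K)
    (h' : Realizes B K') : StarCongruent σ K K' := by
  obtain ⟨b, hb⟩ := h
  obtain ⟨b', hb'⟩ := h'
  refine ⟨b.toMatrix b', b'.toMatrix b, b.toMatrix_mul_toMatrix_flip b',
    b'.toMatrix_mul_toMatrix_flip b, ?_⟩
  ext i j
  rw [← hb', ← b.sum_toMatrix_smul_self b' i, ← b.sum_toMatrix_smul_self b' j]
  simp only [map_sum, LinearMap.sum_apply, map_smulₛₗ, LinearMap.smul_apply, smul_eq_mul,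
    RingHom.id_apply, hb, Matrix.mul_apply, conjTr, Matrix.of_apply, Finset.sum_mul,
    Finset.mul_sum]
  refine Finset.sum_congr rfl fun k _ => Finset.sum_congr rfl fun l _ => ?_
  ring

end cosquare

/-! ### Square roots of operators -/

section squareRoot
open Polynomial

/-- Modulo a product of linear factors with nonzero square roots, `X` is a square. -/
theorem exists_prod_dvd_sq_sub_X {K : Type*} [Field K] (h2 : (2 : K) ≠ 0) (s : Multiset K)
    (hs : ∀ a ∈ s, a ≠ 0 ∧ IsSquare a) :
    ∃ p : K[X], (s.map fun a => X - C a).prod ∣ p ^ 2 - X := by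
  induction s using Multiset.induction_on with
  | empty => exact ⟨0, by simp⟩
  | cons a s ih =>
    obtain ⟨p, hp⟩ := ih fun b hb => hs b (Multiset.mem_cons_of_mem hb)
    obtain ⟨ha, r, hr⟩ := hs a (Multiset.mem_cons_self a s)
    rw [Multiset.map_cons, Multiset.prod_cons]
    set f := (s.map fun a => X - C a).prod with hf
    obtain ⟨g, hg⟩ := hp
    have hga := congr_arg (Polynomial.eval a) hg
    simp only [eval_sub, eval_pow, eval_X, eval_mul] at hga
    -- the correction `c • f` makes the cofactor vanish at `a`
    obtain ⟨c, hc⟩ : ∃ c : K, g.eval a + 2 * c * p.eval a + c ^ 2 * f.eval a = 0 := by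
      by_cases hfa : f.eval a = 0
      · rw [hfa, zero_mul] at hga
        have hpa : p.eval a ≠ 0 := by
          intro h0
          rw [h0] at hga
          exact ha (by linear_combination -hga)
        refine ⟨-(g.eval a) / (2 * p.eval a), ?_⟩
        rw [hfa]
        field_simp
        ring
      · refine ⟨(r - p.eval a) / f.eval a, ?_⟩
        field_simp
        linear_combination -hga - hr
    refine ⟨p + C c * f, ?_⟩
    have h3 : (p + C c * f) ^ 2 - X = (g + 2 * C c * p + C c ^ 2 * f) * f := by
      linear_combination hg
    rw [h3]
    refine mul_dvd_mul ?_ dvd_rfl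
    rw [dvd_iff_isRoot, IsRoot.def, ← hc]
    simp

variable {W : Type*} [AddCommGroup W] [Module ℂ W]

/-- An injective operator has a square root that is a polynomial in it. -/
theorem exists_aeval_sq_eq [FiniteDimensional ℂ W] (S : Module.End ℂ W)
    (hS : Function.Injective S) : ∃ p : ℂ[X], (aeval S p) ^ 2 = S := by
  have h0 : ∀ a ∈ (minpoly ℂ S).roots, a ≠ 0 := by
    rintro a ha rfl
    obtain ⟨v, hv⟩ := (Module.End.hasEigenvalue_of_isRoot
      (Polynomial.isRoot_of_mem_roots ha)).exists_hasEigenvector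
    have h0 := hv.apply_eq_smul
    rw [zero_smul] at h0
    exact hv.2 (hS (h0.trans (map_zero S).symm))
  obtain ⟨p, hp⟩ := exists_prod_dvd_sq_sub_X (two_ne_zero : (2 : ℂ) ≠ 0) (minpoly ℂ S).roots
    (fun a ha => ⟨h0 a ha, IsAlgClosed.exists_eq_mul_self a⟩)
  have h1 := (IsAlgClosed.splits (minpoly ℂ S)).eq_prod_roots_of_monic
    (minpoly.monic (Algebra.IsIntegral.isIntegral S))
  rw [← h1] at hp
  have h2 := (minpoly.dvd_iff).mp hp
  rw [map_sub, map_pow, aeval_X, sub_eq_zero] at h2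
  exact ⟨p, h2⟩

/-- An operator with the single eigenvalue `a > 0` has a square root that is a polynomial with real
coefficients in it. -/
theorem exists_aeval_map_sq_eq (S : Module.End ℂ W) {a : ℝ} (ha : 0 < a) {n : ℕ}
    (hS : shift S (a : ℂ) ^ n = 0) :
    ∃ p : ℝ[X], (aeval S (p.map Complex.ofRealHom)) ^ 2 = S := by
  obtain ⟨p, q, hpq⟩ := exists_prod_dvd_sq_sub_X (two_ne_zero : (2 : ℝ) ≠ 0)
    (Multiset.replicate n a) (fun b hb => by
      rw [Multiset.eq_of_mem_replicate hb]
      exact ⟨ha.ne', Real.sqrt a, (Real.mul_self_sqrt ha.le).symm⟩)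
  refine ⟨p, ?_⟩
  have h1 := congr_arg (fun f : ℝ[X] => aeval S (f.map Complex.ofRealHom)) hpq
  have h2 : (S - algebraMap ℂ (Module.End ℂ W) (a : ℂ)) ^ n = 0 := hS
  simp only [Multiset.map_replicate, Multiset.prod_replicate, Polynomial.map_sub,
    Polynomial.map_pow, Polynomial.map_mul, Polynomial.map_X, Polynomial.map_C, map_sub, map_pow,
    map_mul, aeval_X, aeval_C, Complex.ofRealHom_eq_coe, h2, zero_mul] at h1
  exact sub_eq_zero.mp h1

end squareRoot

section cosquare
variable {σ : ℂ →+* ℂ} {W : Type*} [AddCommGroup W] [Module ℂ W]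
  {W' : Type*} [AddCommGroup W'] [Module ℂ W']
  {B : W →ₛₗ[σ] W →ₗ[ℂ] ℂ} {Φ : Module.End ℂ W}
  {B' : W' →ₛₗ[σ] W' →ₗ[ℂ] ℂ} {Φ' : Module.End ℂ W'}

/-- Two forms with similar cosquares differ by an operator that is selfadjoint for the first
form. -/
theorem IsCosquare.exists_selfadjoint [FiniteDimensional ℂ W] (h : IsCosquare σ B Φ)
    (h' : IsCosquare σ B' Φ') (φ : W ≃ₗ[ℂ] W') (hφ : ∀ x, φ (Φ x) = Φ' (φ x)) :
    ∃ S : Module.End ℂ W, (∀ x y, B' (φ x) (φ y) = B x (S y)) ∧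
      (∀ x y, B (S x) y = B x (S y)) ∧ (∀ x, S (Φ x) = Φ (S x)) ∧ Function.Injective S := by
  let b := Module.finBasis ℂ W
  let f : W →ₗ[ℂ] (Fin (Module.finrank ℂ W) → ℂ) := LinearMap.pi fun i => B (b i)
  have hext : ∀ y y', (∀ i, B (b i) y = B (b i) y') → y = y' := by
    intro y y' hy
    rw [← sub_eq_zero]
    refine h.right_sep _ fun x => ?_
    have h1 : B.flip (y - y') = 0 := b.ext fun i => by simp [hy i]
    exact LinearMap.congr_fun h1 x
  have hf : Function.Injective f := fun y y' hy => hext y y' fun i => congr_fun hy i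
  have hfs : Function.Surjective f :=
    (LinearMap.injective_iff_surjective_of_finrank_eq_finrank (by simp)).mp hf
  let e := LinearEquiv.ofBijective f ⟨hf, hfs⟩
  let S : Module.End ℂ W := e.symm.toLinearMap ∘ₗ
    (LinearMap.pi fun i => (B' (φ (b i))) ∘ₗ φ.toLinearMap)
  have hS : ∀ x y, B' (φ x) (φ y) = B x (S y) := by
    intro x y
    have h1 : (B'.flip (φ y)).comp φ.toLinearMap = B.flip (S y) := by
      refine b.ext fun i => ?_
      have h2 : e (S y) = LinearMap.pi (fun i => (B' (φ (b i))) ∘ₗ φ.toLinearMap) y :=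
        e.apply_symm_apply _
      exact (congr_fun h2 i).symm
    exact LinearMap.congr_fun h1 x
  refine ⟨S, hS, fun x y => ?_, fun x => ?_, ?_⟩
  · rw [← hS, h'.apply, ← hφ, hS, h.apply (S x) y]
  · refine (h.bijective.1).eq_iff.mp ?_
    refine congr_arg Φ ?_
    rw [← sub_eq_zero]
    refine h.right_sep _ fun y => ?_
    obtain ⟨y, rfl⟩ := h.bijective.2 y
    rw [map_sub, ← hS, h.isometry, ← hS, hφ, hφ, h'.isometry, sub_self]
  · rw [injective_iff_map_eq_zero]
    intro y hy
    have h1 : φ y = 0 := h'.right_sep _ fun x => by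
      obtain ⟨x, rfl⟩ := φ.surjective x
      rw [hS, hy, map_zero]
    exact φ.map_eq_zero_iff.mp h1

/-- A selfadjoint square root `r` of the operator that compares two forms gives an isometry. -/
theorem Realizes.of_selfadjoint_sq [FiniteDimensional ℂ W] {φ : W ≃ₗ[ℂ] W'}
    {r S : Module.End ℂ W} (hS : ∀ x y, B' (φ x) (φ y) = B x (S y)) (hr : r ^ 2 = S)
    (hra : ∀ x y, B (r x) y = B x (r y)) (hSi : Function.Injective S) {ι : Type*}
    {M : Matrix ι ι ℂ} (hM : Realizes B' M) : Realizes B M := by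
  obtain ⟨b, hb⟩ := hM
  have hri : Function.Injective r := by
    intro x y hxy
    refine hSi ?_
    rw [← hr, pow_two, Module.End.mul_apply, Module.End.mul_apply, hxy]
  have hrb : Function.Bijective r := ⟨hri, LinearMap.injective_iff_surjective.mp hri⟩
  refine ⟨(b.map φ.symm).map (LinearEquiv.ofBijective r hrb), fun i j => ?_⟩
  rw [Module.Basis.map_apply, Module.Basis.map_apply, Module.Basis.map_apply,
    Module.Basis.map_apply, LinearEquiv.ofBijective_apply, LinearEquiv.ofBijective_apply, hra,
    ← Module.End.mul_apply, ← pow_two, hr, ← hS, LinearEquiv.apply_symm_apply,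
    LinearEquiv.apply_symm_apply, hb]

open Polynomial in
theorem aeval_selfadjoint {S : Module.End ℂ W} (hS : ∀ x y, B (S x) y = B x (S y)) {p : ℂ[X]}
    (hp : ∀ k, σ (p.coeff k) = p.coeff k) (x y : W) :
    B (aeval S p x) y = B x (aeval S p y) := by
  have hk : ∀ k x y, B ((S ^ k) x) y = B x ((S ^ k) y) := by
    intro k
    induction k with
    | zero => intro x y; rfl
    | succ k ih =>
      intro x y
      rw [pow_succ', Module.End.mul_apply, hS, ih, ← Module.End.mul_apply, ← pow_succ, pow_succ']
  rw [aeval_eq_sum_range]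
  simp only [LinearMap.sum_apply, LinearMap.smul_apply, map_sum, map_smulₛₗ, hp, hk,
    RingHom.id_apply]

/-- Bilinear forms with similar cosquares are congruent. -/
theorem Realizes.of_similar_id [FiniteDimensional ℂ W] {B : W →ₛₗ[RingHom.id ℂ] W →ₗ[ℂ] ℂ}
    {B' : W' →ₛₗ[RingHom.id ℂ] W' →ₗ[ℂ] ℂ} (h : IsCosquare (RingHom.id ℂ) B Φ)
    (h' : IsCosquare (RingHom.id ℂ) B' Φ') (φ : W ≃ₗ[ℂ] W') (hφ : ∀ x, φ (Φ x) = Φ' (φ x))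
    {ι : Type*} {M : Matrix ι ι ℂ} (hM : Realizes B' M) : Realizes B M := by
  obtain ⟨S, hS, hSa, -, hSi⟩ := h.exists_selfadjoint h' φ hφ
  obtain ⟨p, hp⟩ := exists_aeval_sq_eq S hSi
  exact Realizes.of_selfadjoint_sq hS hp (aeval_selfadjoint hSa fun _ => rfl) hSi hM

/-! ### Jordan bases -/

/-- `Φ` has a Jordan basis whose cells are indexed by `s : S` and have size `n s` and eigenvalue
`c s`; in each cell the operator `Φ - c s` shifts the basis vectors upwards. -/
def HasJordanBasis {S : Type*} (Φ : Module.End ℂ W) (n : S → ℕ) (c : S → ℂ) : Prop :=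
  ∃ b : Module.Basis (Σ s, Fin (n s)) ℂ W, ∀ s (i : Fin (n s)),
    shift Φ (c s) (b ⟨s, i⟩) = if h : (i : ℕ) + 1 < n s then b ⟨s, ⟨i + 1, h⟩⟩ else 0

theorem HasJordanBasis.exists_equiv {S : Type*} {n : S → ℕ} {c : S → ℂ}
    (h : HasJordanBasis Φ n c) (h' : HasJordanBasis Φ' n c) :
    ∃ φ : W ≃ₗ[ℂ] W', ∀ x, φ (Φ x) = Φ' (φ x) := by
  obtain ⟨b, hb⟩ := h
  obtain ⟨b', hb'⟩ := h'
  refine ⟨b.equiv b' (Equiv.refl _), fun x => ?_⟩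
  have h1 : (b.equiv b' (Equiv.refl _)).toLinearMap ∘ₗ Φ =
      Φ' ∘ₗ (b.equiv b' (Equiv.refl _)).toLinearMap := by
    refine b.ext ?_
    rintro ⟨s, i⟩
    simp only [LinearMap.comp_apply, LinearEquiv.coe_coe, Module.Basis.equiv_apply,
      Equiv.refl_apply]
    rw [apply_eq_shift Φ (c s), apply_eq_shift Φ' (c s), hb, hb', map_add, map_smul,
      Module.Basis.equiv_apply, Equiv.refl_apply]
    split_ifs <;> simp
  exact LinearMap.congr_fun h1 x

theorem hasJordanBasis_of_chains {S : Type*} {n : S → ℕ} {c : S → ℂ} {u : S → W}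
    (hu : ∀ s, (shift Φ (c s) ^ n s) (u s) = 0)
    (hli : LinearIndependent ℂ fun p : Σ s, Fin (n s) => (shift Φ (c p.1) ^ (p.2 : ℕ)) (u p.1))
    (hsp : ⊤ ≤ Submodule.span ℂ
      (Set.range fun p : Σ s, Fin (n s) => (shift Φ (c p.1) ^ (p.2 : ℕ)) (u p.1))) :
    HasJordanBasis Φ n c := by
  refine ⟨Module.Basis.mk hli hsp, fun s i => ?_⟩
  rw [Module.Basis.mk_apply, ← Module.End.mul_apply, ← pow_succ']
  split_ifs with h
  · rw [Module.Basis.mk_apply]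
  · have h1 : (i : ℕ) + 1 = n s := by omega
    rw [h1, hu]

end cosquare

section cosquare
variable {σ : ℂ →+* ℂ} {W : Type*} [AddCommGroup W] [Module ℂ W]
  {B : W →ₛₗ[σ] W →ₗ[ℂ] ℂ} {Φ : Module.End ℂ W}

/-- A Jordan basis determines the dimensions of the kernels of the powers of `Φ - d`. -/
theorem HasJordanBasis.finrank_ker {S : Type*} [Fintype S] {n : S → ℕ} {c : S → ℂ}
    (h : HasJordanBasis Φ n c) (d : ℂ) (k : ℕ) :
    Module.finrank ℂ (LinearMap.ker (shift Φ d ^ k)) =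
      ∑ s, open Classical in if c s = d then min k (n s) else 0 := by
  classical
  obtain ⟨b, hb⟩ := h
  have hfd : FiniteDimensional ℂ W := b.finiteDimensional_of_finite
  have hpow : ∀ s (k : ℕ) (i : Fin (n s)), (shift Φ (c s) ^ k) (b ⟨s, i⟩) =
      if h : (i : ℕ) + k < n s then b ⟨s, ⟨i + k, h⟩⟩ else 0 := by
    intro s k
    induction k with
    | zero => intro i; simp
    | succ k ih =>
      intro i
      rw [pow_succ', Module.End.mul_apply, ih]
      by_cases h1 : (i : ℕ) + k < n s
      · rw [dif_pos h1, hb]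
        rfl
      · rw [dif_neg h1, dif_neg (by omega), map_zero]
  -- basis vectors in the kernel, and in the range
  let A : Finset (Σ s, Fin (n s)) :=
    Finset.univ.filter fun p => c p.1 = d ∧ n p.1 ≤ (p.2 : ℕ) + k
  let R : Finset (Σ s, Fin (n s)) :=
    Finset.univ.filter fun p => ¬ (c p.1 = d ∧ (p.2 : ℕ) < k)
  have hA : A.card ≤ Module.finrank ℂ (LinearMap.ker (shift Φ d ^ k)) := by
    have h1 : LinearIndependent ℂ fun p : A => b p := b.linearIndependent.comp _
      Subtype.val_injective
    have h2 : ∀ p : A, b p ∈ LinearMap.ker (shift Φ d ^ k) := by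
      rintro ⟨⟨s, i⟩, hp⟩
      obtain ⟨h3, h4⟩ := (Finset.mem_filter.mp hp).2
      dsimp only at h3 h4
      rw [LinearMap.mem_ker, ← h3, hpow, dif_neg (by omega)]
    have h3 : LinearIndependent ℂ fun p : A => (⟨b p, h2 p⟩ : LinearMap.ker (shift Φ d ^ k)) :=
      LinearIndependent.of_comp (Submodule.subtype _) h1
    simpa using h3.fintype_card_le_finrank
  have hR : R.card ≤ Module.finrank ℂ (LinearMap.range (shift Φ d ^ k)) := by
    have h1 : LinearIndependent ℂ fun p : R => b p := b.linearIndependent.comp _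
      Subtype.val_injective
    have h2 : ∀ p : R, b p ∈ LinearMap.range (shift Φ d ^ k) := by
      rintro ⟨⟨s, i⟩, hp⟩
      have h3 := (Finset.mem_filter.mp hp).2
      dsimp only at h3 ⊢
      by_cases hs : c s = d
      · have h4 : k ≤ (i : ℕ) := by
          by_contra hlt
          exact h3 ⟨hs, by omega⟩
        refine ⟨b ⟨s, ⟨i - k, by omega⟩⟩, ?_⟩
        rw [← hs, hpow, dif_pos (show (i : ℕ) - k + k < n s by omega)]
        exact congr_arg (fun j => b ⟨s, j⟩) (Fin.ext (Nat.sub_add_cancel h4))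
      · -- `Φ - d` acts bijectively on a cell with another eigenvalue
        have hcd : c s - d ≠ 0 := sub_ne_zero.mpr hs
        have key : ∀ (k m : ℕ) (i : Fin (n s)), n s ≤ (i : ℕ) + m →
            b ⟨s, i⟩ ∈ LinearMap.range (shift Φ d ^ k) := by
          intro k
          induction k with
          | zero => intro m i _; exact ⟨b ⟨s, i⟩, rfl⟩
          | succ k ihk =>
            intro m
            induction m with
            | zero => intro i hi; omega
            | succ m ihm =>
              intro i hi
              have h5 : b ⟨s, i⟩ = (c s - d)⁻¹ • (shift Φ d (b ⟨s, i⟩) -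
                  shift Φ (c s) (b ⟨s, i⟩)) := by
                rw [shift_apply, shift_apply, sub_sub_sub_cancel_left, ← sub_smul,
                  inv_smul_smul₀ hcd]
              rw [h5]
              refine Submodule.smul_mem _ _ (Submodule.sub_mem _ ?_ ?_)
              · obtain ⟨w, hw⟩ := ihk (n s) i (by omega)
                exact ⟨w, by rw [pow_succ', Module.End.mul_apply, hw]⟩
              · rw [hb]
                split_ifs with h6
                · exact ihm _ (by simp only; omega)
                · exact Submodule.zero_mem _
        exact key k (n s) i (by omega)
    have h3 : LinearIndependent ℂ fun p : R => (⟨b p, h2 p⟩ : LinearMap.range (shift Φ d ^ k)) :=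
      LinearIndependent.of_comp (Submodule.subtype _) h1
    simpa using h3.fintype_card_le_finrank
  have hcount : A.card = ∑ s, if c s = d then min k (n s) else 0 := by
    have h1 : A = Finset.univ.sigma fun s => Finset.univ.filter fun i : Fin (n s) =>
        c s = d ∧ n s ≤ (i : ℕ) + k := by
      ext ⟨s, i⟩
      simp [A]
    rw [h1, Finset.card_sigma]
    refine Finset.sum_congr rfl fun s _ => ?_
    split_ifs with h2
    · simp only [h2, true_and]
      have h3 : (Finset.univ.filter fun i : Fin (n s) => n s ≤ (i : ℕ) + k).card +
          (Finset.univ.filter fun i : Fin (n s) => ¬ n s ≤ (i : ℕ) + k).card = n s := by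
        rw [Finset.card_filter_add_card_filter_not, Finset.card_univ, Fintype.card_fin]
      have h4 : (Finset.univ.filter fun i : Fin (n s) => ¬ n s ≤ (i : ℕ) + k) =
          Finset.univ.filter fun i : Fin (n s) => (i : ℕ) < n s - k :=
        Finset.filter_congr fun i _ => by omega
      rw [h4, Fin.card_filter_val_lt] at h3
      omega
    · simp [h2]
  have hcount' : R.card = ∑ s, if c s = d then n s - k else n s := by
    have h1 : R = Finset.univ.sigma fun s => Finset.univ.filter fun i : Fin (n s) =>
        ¬ (c s = d ∧ (i : ℕ) < k) := by
      ext ⟨s, i⟩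
      simp [R]
    rw [h1, Finset.card_sigma]
    refine Finset.sum_congr rfl fun s _ => ?_
    split_ifs with h2
    · simp only [h2, true_and]
      have h3 : (Finset.univ.filter fun i : Fin (n s) => (i : ℕ) < k).card +
          (Finset.univ.filter fun i : Fin (n s) => ¬ (i : ℕ) < k).card = n s := by
        rw [Finset.card_filter_add_card_filter_not, Finset.card_univ, Fintype.card_fin]
      rw [Fin.card_filter_val_lt] at h3
      omega
    · simp [h2]
  have htot : A.card + R.card = Module.finrank ℂ W := by
    rw [hcount, hcount', ← Finset.sum_add_distrib, Module.finrank_eq_card_basis b,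
      Fintype.card_sigma]
    refine Finset.sum_congr rfl fun s _ => ?_
    rw [Fintype.card_fin]
    split_ifs <;> omega
  have hrn := LinearMap.finrank_range_add_finrank_ker (shift Φ d ^ k)
  rw [← hcount]
  omega

/-! ### Stable subspaces spanned by chains -/

theorem coe_shift_restrict_pow {X : Submodule ℂ W} (hX : ∀ x ∈ X, Φ x ∈ X) (c : ℂ) (k : ℕ)
    (x : X) : (((shift (Φ.restrict hX) c) ^ k) x : W) = (shift Φ c ^ k) x := by
  induction k generalizing x with
  | zero => rfl
  | succ k ih =>
    rw [pow_succ, pow_succ, Module.End.mul_apply, Module.End.mul_apply, ih]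
    rfl

theorem stable_span {ι : Type*} {v : ι → W} (hv : ∀ i, Φ (v i) ∈ Submodule.span ℂ (Set.range v)) :
    ∀ x ∈ Submodule.span ℂ (Set.range v), Φ x ∈ Submodule.span ℂ (Set.range v) := by
  intro x hx
  have h1 : Submodule.span ℂ (Set.range v) ≤ (Submodule.span ℂ (Set.range v)).comap Φ := by
    rw [Submodule.span_le]
    rintro _ ⟨i, rfl⟩
    exact hv i
  exact h1 hx

theorem apply_mem_span_chains {S : Type*} {n : S → ℕ} {c : S → ℂ} {u : S → W}
    (hu : ∀ s, (shift Φ (c s) ^ n s) (u s) = 0) (p : Σ s, Fin (n s)) :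
    Φ ((shift Φ (c p.1) ^ (p.2 : ℕ)) (u p.1)) ∈ Submodule.span ℂ
      (Set.range fun p : Σ s, Fin (n s) => (shift Φ (c p.1) ^ (p.2 : ℕ)) (u p.1)) := by
  rw [apply_eq_shift Φ (c p.1)]
  refine Submodule.add_mem _ (Submodule.smul_mem _ _ (Submodule.subset_span ⟨p, rfl⟩)) ?_
  rw [← Module.End.mul_apply, ← pow_succ']
  by_cases h : (p.2 : ℕ) + 1 < n p.1
  · exact Submodule.subset_span ⟨⟨p.1, ⟨p.2 + 1, h⟩⟩, rfl⟩
  · have h1 : (p.2 : ℕ) + 1 = n p.1 := by have := p.2.2; omega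
    rw [h1, hu]
    exact Submodule.zero_mem _

theorem hasJordanBasis_restrict_span {S : Type*} {n : S → ℕ} {c : S → ℂ} {u : S → W}
    (hu : ∀ s, (shift Φ (c s) ^ n s) (u s) = 0)
    (hli : LinearIndependent ℂ fun p : Σ s, Fin (n s) => (shift Φ (c p.1) ^ (p.2 : ℕ)) (u p.1)) :
    HasJordanBasis (Φ.restrict (stable_span (apply_mem_span_chains hu))) n c := by
  refine ⟨Module.Basis.span hli, fun s i => Subtype.ext ?_⟩
  have h1 := coe_shift_restrict_pow (stable_span (apply_mem_span_chains hu)) (c s) 1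
    (Module.Basis.span hli ⟨s, i⟩)
  rw [pow_one, pow_one] at h1
  rw [h1, Module.Basis.span_apply, ← Module.End.mul_apply, ← pow_succ']
  split_ifs with h
  · rw [Module.Basis.span_apply]
  · have h1 : (i : ℕ) + 1 = n s := by omega
    rw [h1, hu]
    rfl

theorem isRegularSubspace_of_left [FiniteDimensional ℂ W] (h : IsCosquare σ B Φ)
    {X : Submodule ℂ W} (hs : ∀ x ∈ X, Φ x ∈ X)
    (hX : ∀ y ∈ X, (∀ x ∈ X, B y x = 0) → y = 0) : IsRegularSubspace B Φ X := by
  refine ⟨hs, fun y hy hy0 => h.injective ?_⟩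
  rw [map_zero]
  refine hX _ (hs y hy) fun x hx => ?_
  have := h.apply x y
  rw [hy0 x hx, eq_comm, map_eq_zero] at this
  exact this

/-- Only the zero combination of the vectors of such chains is orthogonal to all of them: the
coefficients vanish one level after the other, by pairing with `(Φ - c) ^ (n - 1 - m)` of the first
vectors. -/
theorem IsCosquare.chains_eq_zero [FiniteDimensional ℂ W] (h : IsCosquare σ B Φ) {c : ℂ}
    (hc0 : c ≠ 0) (hc : (σ c)⁻¹ = c) {S : Type*} [Fintype S] [DecidableEq S] {n : ℕ} {u : S → W}
    (hu : ∀ s, (shift Φ c ^ n) (u s) = 0)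
    (hg : IsUnit (Matrix.of fun s t => B ((shift Φ c ^ (n - 1)) (u s)) (u t)))
    (a : (Σ _ : S, Fin n) → ℂ)
    (ha : ∀ t (j : ℕ), B (∑ p, a p • (shift Φ c ^ (p.2 : ℕ)) (u p.1)) ((shift Φ c ^ j) (u t)) = 0) :
    a = 0 := by
  have key : ∀ (m : ℕ) (hm : m < n), ∀ s, a ⟨s, ⟨m, hm⟩⟩ = 0 := by
    intro m
    induction m using Nat.strong_induction_on with
    | _ m ih =>
    intro hm
    have hN : ∀ p : Σ _ : S, Fin n, (shift Φ c ^ (n - 1 - m))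
        (a p • (shift Φ c ^ (p.2 : ℕ)) (u p.1)) =
        if (p.2 : ℕ) = m then a p • (shift Φ c ^ (n - 1)) (u p.1) else 0 := by
      rintro ⟨s, i, hi⟩
      dsimp only
      rw [map_smul, ← Module.End.mul_apply, ← pow_add]
      split_ifs with h1
      · have h2 : n - 1 - m + i = n - 1 := by omega
        rw [h2]
      · rcases Nat.lt_or_gt_of_ne h1 with h2 | h2
        · rw [ih i h2, zero_smul]
        · have h3 : n - 1 - m + i = (i - m - 1) + n := by omega
          rw [h3, pow_add, Module.End.mul_apply, hu, map_zero, smul_zero]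
    have hw : (shift Φ c ^ (n - 1 - m)) (∑ p, a p • (shift Φ c ^ (p.2 : ℕ)) (u p.1)) =
        ∑ s, a ⟨s, ⟨m, hm⟩⟩ • (shift Φ c ^ (n - 1)) (u s) := by
      rw [map_sum, Finset.sum_congr rfl fun p _ => hN p, Fintype.sum_sigma]
      refine Finset.sum_congr rfl fun s _ => ?_
      rw [Finset.sum_eq_single ⟨m, hm⟩]
      · simp
      · intro i _ hi
        exact if_neg fun h1 => hi (Fin.ext h1)
      · simp
    have heig : shift Φ c (∑ s, a ⟨s, ⟨m, hm⟩⟩ • (shift Φ c ^ (n - 1)) (u s)) = 0 := by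
      rw [map_sum]
      refine Finset.sum_eq_zero fun s _ => ?_
      rw [map_smul, ← Module.End.mul_apply, ← pow_succ', Nat.sub_add_cancel (by omega), hu,
        smul_zero]
    have hz : ∀ t, B (∑ s, a ⟨s, ⟨m, hm⟩⟩ • (shift Φ c ^ (n - 1)) (u s)) (u t) = 0 := by
      intro t
      have h1 := h.adjoint_pow hc0 (n - 1 - m) (∑ p, a p • (shift Φ c ^ (p.2 : ℕ)) (u p.1)) (u t)
      rw [ha, hc, hw, h.apply_eigenvector hc0 heig, hc, eq_comm, ← mul_assoc, mul_eq_zero] at h1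
      exact h1.resolve_left (mul_ne_zero (pow_ne_zero _ (neg_ne_zero.mpr hc0))
        (pow_ne_zero _ hc0))
    have hv : Matrix.vecMul (fun s => σ (a ⟨s, ⟨m, hm⟩⟩))
        (Matrix.of fun s t => B ((shift Φ c ^ (n - 1)) (u s)) (u t)) = 0 := by
      ext t
      have := hz t
      simpa [Matrix.vecMul, dotProduct, map_sum, LinearMap.sum_apply, map_smulₛₗ] using this
    have h0 := (Matrix.vecMul_injective_of_isUnit hg) (hv.trans (Matrix.zero_vecMul _).symm)
    intro s
    have := congr_fun h0 s
    simpa using this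
  ext ⟨s, i⟩
  exact key i i.2 s

/-- Chains of equal length for an eigenvalue `c` with `σ c = c⁻¹` span a regular subspace if the
Gram matrix of their last vectors with their first vectors is nonsingular. -/
theorem IsCosquare.exists_isRegularSubspace_of_chains [FiniteDimensional ℂ W]
    (h : IsCosquare σ B Φ) {c : ℂ} (hc0 : c ≠ 0) (hc : (σ c)⁻¹ = c) {S : Type*} [Fintype S]
    [DecidableEq S] {n : ℕ} {u : S → W} (hu : ∀ s, (shift Φ c ^ n) (u s) = 0)
    (hg : IsUnit (Matrix.of fun s t => B ((shift Φ c ^ (n - 1)) (u s)) (u t))) :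
    ∃ (X : Submodule ℂ W) (hX : IsRegularSubspace B Φ X),
      HasJordanBasis (Φ.restrict hX.stable) (fun _ : S => n) (fun _ => c) := by
  have hli : LinearIndependent ℂ
      fun p : Σ _ : S, Fin n => (shift Φ c ^ (p.2 : ℕ)) (u p.1) := by
    rw [Fintype.linearIndependent_iff]
    intro a ha p
    rw [h.chains_eq_zero hc0 hc hu hg a fun t j => by rw [ha]; simp]
    rfl
  have hst := stable_span (apply_mem_span_chains (n := fun _ : S => n) (c := fun _ => c) hu)
  refine ⟨_, isRegularSubspace_of_left h hst ?_,
    hasJordanBasis_restrict_span (n := fun _ : S => n) (c := fun _ => c) hu hli⟩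
  intro y hy hy0
  obtain ⟨a, rfl⟩ := (Submodule.mem_span_range_iff_exists_fun ℂ).mp hy
  rw [h.chains_eq_zero hc0 hc hu hg a fun t j => ?_]
  · simp
  · by_cases hj : j < n
    · exact hy0 _ (Submodule.subset_span ⟨⟨t, ⟨j, hj⟩⟩, rfl⟩)
    · have h1 : j = (j - n) + n := by omega
      rw [h1, pow_add, Module.End.mul_apply, hu, map_zero, map_zero]

end cosquare

/-! ### Pairs of dual chains -/

section cosquare
variable {σ : ℂ →+* ℂ} {W : Type*} [AddCommGroup W] [Module ℂ W]
  {B : W →ₛₗ[σ] W →ₗ[ℂ] ℂ} {Φ : Module.End ℂ W}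

theorem gram_mulVec {ι : Type*} [Fintype ι] {v : ι → W} {M : Matrix ι ι ℂ}
    (hM : ∀ i j, B (v i) (v j) = M i j) (a : ι → ℂ) (i : ι) :
    B (v i) (∑ j, a j • v j) = M.mulVec a i := by
  simp [Matrix.mulVec, dotProduct, hM, mul_comm]

theorem realizes_span_of_gram {ι : Type*} [Fintype ι] [DecidableEq ι] {v : ι → W}
    {M : Matrix ι ι ℂ} (hM : ∀ i j, B (v i) (v j) = M i j) (hu : IsUnit M)
    (hst : ∀ i, Φ (v i) ∈ Submodule.span ℂ (Set.range v)) :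
    IsRegularSubspace B Φ (Submodule.span ℂ (Set.range v)) ∧
      Realizes (restrictForm B (Submodule.span ℂ (Set.range v))) M := by
  have h0 : ∀ a : ι → ℂ, (∀ i, B (v i) (∑ j, a j • v j) = 0) → a = 0 := by
    intro a ha
    refine Matrix.mulVec_injective_of_isUnit hu ?_
    rw [Matrix.mulVec_zero]
    ext i
    rw [← gram_mulVec hM, ha]
    rfl
  have hli : LinearIndependent ℂ v := by
    rw [Fintype.linearIndependent_iff]
    intro a ha i
    rw [h0 a fun i => by rw [ha, map_zero]]
    rfl
  refine ⟨⟨stable_span hst, fun y hy hy0 => ?_⟩, Module.Basis.span hli, fun i j => ?_⟩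
  · obtain ⟨a, rfl⟩ := (Submodule.mem_span_range_iff_exists_fun ℂ).mp hy
    rw [h0 a fun i => hy0 _ (Submodule.subset_span ⟨i, rfl⟩)]
    simp
  · rw [restrictForm_apply, Module.Basis.span_apply, Module.Basis.span_apply, hM]

theorem isUnit_jordanBlock (n : ℕ) {c : ℂ} (hc : c ≠ 0) : IsUnit (jordanBlock n c) := by
  rw [Matrix.isUnit_iff_isUnit_det, Matrix.det_of_isUpperTriangular]
  · simp [jordanBlock, hc]
  · intro i j hij
    have h1 : (j : ℕ) < i := hij
    simp only [jordanBlock, Matrix.of_apply]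
    rw [if_neg (by rintro rfl; omega), if_neg (by omega)]

theorem isUnit_hMatrix (n : ℕ) {c : ℂ} (hc : c ≠ 0) : IsUnit (hMatrix n c) := by
  obtain ⟨J, hJ⟩ := isUnit_jordanBlock n hc
  refine IsUnit.of_mul_eq_one (Matrix.fromBlocks 0 (J⁻¹ : (Matrix (Fin n) (Fin n) ℂ)ˣ) 1 0) ?_
  rw [hMatrix, ← hJ, Matrix.fromBlocks_multiply]
  simp

section pair
variable {c : ℂ} {n : ℕ} {x z : W}

/-- The pairing of a chain for `c` (in reversed order) and a chain for `(σ c)⁻¹`. -/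
noncomputable def pairMatrix (B : W →ₛₗ[σ] W →ₗ[ℂ] ℂ) (Φ : Module.End ℂ W) (c : ℂ) (n : ℕ)
    (x z : W) :
    Matrix (Fin n) (Fin n) ℂ :=
  Matrix.of fun i j => B ((shift Φ c ^ (n - 1 - (i : ℕ))) x) ((shift Φ (σ c)⁻¹ ^ (j : ℕ)) z)

/-- The pairing matrix is lower triangular with nonzero diagonal. -/
theorem IsCosquare.isUnit_pairMatrix (h : IsCosquare σ B Φ) (hc0 : c ≠ 0)
    (hx : (shift Φ c ^ n) x = 0) (hxz : B ((shift Φ c ^ (n - 1)) x) z ≠ 0) :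
    IsUnit (pairMatrix B Φ c n x z) := by
  have hc' : (σ c)⁻¹ ≠ 0 := inv_ne_zero ((map_ne_zero σ).mpr hc0)
  rw [Matrix.isUnit_iff_isUnit_det, Matrix.det_of_isLowerTriangular, isUnit_iff_ne_zero,
    Finset.prod_ne_zero_iff]
  · intro i _
    have hi := i.2
    rw [pairMatrix, Matrix.of_apply, h.adjoint_pow' hc0, ← Module.End.mul_apply, ← pow_add,
      show (i : ℕ) + (n - 1 - i) = n - 1 by omega, h.apply_eigenvector hc0]
    · exact mul_ne_zero (pow_ne_zero _ (neg_ne_zero.mpr hc')) (mul_ne_zero (pow_ne_zero _ hc') hxz)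
    · rw [← Module.End.mul_apply, ← pow_succ', Nat.sub_add_cancel (by omega), hx]
  · intro i j hij
    have h1 : (i : ℕ) < j := hij
    have hj := j.2
    rw [pairMatrix, Matrix.of_apply, h.adjoint_pow' hc0, ← Module.End.mul_apply, ← pow_add,
      show (j : ℕ) + (n - 1 - i) = (j - 1 - i) + n by omega, pow_add, Module.End.mul_apply, hx]
    simp

/-- Two dual isotropic chains span a regular subspace with the matrix `hMatrix n c`. -/
theorem IsCosquare.exists_hMatrix (h : IsCosquare σ B Φ) (hc0 : c ≠ 0)
    (hx : (shift Φ c ^ n) x = 0) (hz : (shift Φ (σ c)⁻¹ ^ n) z = 0)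
    (hxz : B ((shift Φ c ^ (n - 1)) x) z ≠ 0)
    (hxx : ∀ i j : ℕ, B ((shift Φ c ^ i) x) ((shift Φ c ^ j) x) = 0)
    (hzz : ∀ i j : ℕ, B ((shift Φ (σ c)⁻¹ ^ i) z) ((shift Φ (σ c)⁻¹ ^ j) z) = 0) :
    ∃ X : Submodule ℂ W, IsRegularSubspace B Φ X ∧ Realizes (restrictForm B X) (hMatrix n c) := by
  obtain ⟨P, hP⟩ := h.isUnit_pairMatrix hc0 hx hxz
  set Q : Matrix (Fin n) (Fin n) ℂ := (P⁻¹ : (Matrix (Fin n) (Fin n) ℂ)ˣ).val with hQ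
  have hPQ : pairMatrix B Φ c n x z * Q = 1 := by rw [← hP, hQ, Units.mul_inv]
  have hQP : Q * pairMatrix B Φ c n x z = 1 := by rw [← hP, hQ, Units.inv_mul]
  let y : Fin n → W := fun i => (shift Φ c ^ (n - 1 - (i : ℕ))) x
  let w : Fin n → W := fun j => ∑ k : Fin n, Q k j • (shift Φ (σ c)⁻¹ ^ (k : ℕ)) z
  have hw : ∀ l : Fin n, (shift Φ (σ c)⁻¹ ^ (l : ℕ)) z = ∑ j, pairMatrix B Φ c n x z j l • w j := by
    intro l
    simp only [w, Finset.smul_sum, smul_smul]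
    rw [Finset.sum_comm]
    simp only [← Finset.sum_smul, mul_comm (pairMatrix B Φ c n x z _ l), ← Matrix.mul_apply, hQP,
      Matrix.one_apply]
    simp
  have hy : ∀ j, Φ (y j) = ∑ i, jordanBlock n c i j • y i := by
    intro j
    have hj := j.2
    rw [apply_eq_shift Φ c, ← Module.End.mul_apply, ← pow_succ']
    have h1 : ∀ i : Fin n, jordanBlock n c i j • y i =
        (if i = j then c • y j else 0) + if (i : ℕ) + 1 = j then y i else 0 := by
      intro i
      simp only [jordanBlock, Matrix.of_apply]
      split_ifs with h2 h3 h3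
      · subst h2; omega
      · rw [h2, add_zero]
      · rw [one_smul, zero_add]
      · rw [zero_smul, add_zero]
    rw [Finset.sum_congr rfl fun i _ => h1 i, Finset.sum_add_distrib, Finset.sum_ite_eq' ,
      if_pos (Finset.mem_univ j)]
    congr 1
    by_cases hj0 : (j : ℕ) = 0
    · rw [Finset.sum_eq_zero fun i _ => if_neg (by omega), hj0,
        show n - 1 - 0 + 1 = n by omega, hx]
    · rw [Finset.sum_eq_single ⟨j - 1, by omega⟩]
      · rw [if_pos (show (j : ℕ) - 1 + 1 = j by omega)]
        simp only [y]
        congr 2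
        omega
      · intro i _ hi
        exact if_neg fun h2 => hi (Fin.ext (show (i : ℕ) = j - 1 by omega))
      · simp
  have hyw : ∀ i j, B (y i) (w j) = (1 : Matrix (Fin n) (Fin n) ℂ) i j := by
    intro i j
    rw [← hPQ, Matrix.mul_apply]
    simp [w, y, pairMatrix, mul_comm]
  have hyy : ∀ i j, B (y i) (y j) = 0 := fun i j => hxx _ _
  have hww : ∀ i j, B (w i) (w j) = 0 := fun i j => by simp [w, hzz]
  have hwy : ∀ i j, B (w i) (y j) = jordanBlock n c i j := by
    intro i j
    rw [h.apply, hy]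
    simp only [map_sum, map_smulₛₗ, LinearMap.sum_apply, LinearMap.smul_apply, hyw, smul_eq_mul,
      map_mul, h.invol, Matrix.one_apply]
    simp
  have hG : ∀ i j, B (Sum.elim y w i) (Sum.elim y w j) = hMatrix n c i j := by
    rintro (i | i) (j | j)
    · exact hyy i j
    · exact hyw i j
    · exact hwy i j
    · exact hww i j
  have hmy : ∀ i, y i ∈ Submodule.span ℂ (Set.range (Sum.elim y w)) := fun i =>
    Submodule.subset_span ⟨Sum.inl i, rfl⟩
  have hmw : ∀ i, w i ∈ Submodule.span ℂ (Set.range (Sum.elim y w)) := fun i =>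
    Submodule.subset_span ⟨Sum.inr i, rfl⟩
  have hmz : ∀ l : ℕ, (shift Φ (σ c)⁻¹ ^ l) z ∈ Submodule.span ℂ (Set.range (Sum.elim y w)) := by
    intro l
    by_cases hl : l < n
    · rw [hw ⟨l, hl⟩]
      exact Submodule.sum_mem _ fun j _ => Submodule.smul_mem _ _ (hmw j)
    · rw [show l = (l - n) + n by omega, pow_add, Module.End.mul_apply, hz, map_zero]
      exact Submodule.zero_mem _
  refine ⟨_, realizes_span_of_gram hG (isUnit_hMatrix n hc0) ?_⟩
  rintro (j | j)
  · rw [Sum.elim_inl, hy]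
    exact Submodule.sum_mem _ fun i _ => Submodule.smul_mem _ _ (hmy i)
  · rw [Sum.elim_inr, map_sum]
    refine Submodule.sum_mem _ fun k _ => ?_
    rw [map_smul, apply_eq_shift Φ (σ c)⁻¹, ← Module.End.mul_apply, ← pow_succ']
    exact Submodule.smul_mem _ _ (Submodule.add_mem _ (Submodule.smul_mem _ _ (hmz _)) (hmz _))

end pair

open Polynomial in
/-- The generalized eigenspace of `c` is isotropic if `c ≠ (σ c)⁻¹`. -/
theorem IsCosquare.isotropic (h : IsCosquare σ B Φ) {c : ℂ} (hc0 : c ≠ 0) (hc : (σ c)⁻¹ ≠ c)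
    {n : ℕ} {x y : W} (hx : (shift Φ c ^ n) x = 0) (hy : (shift Φ c ^ n) y = 0) : B x y = 0 := by
  have hs : ∀ d, aeval Φ (X - C d) = shift Φ d := fun d => by
    rw [map_sub, aeval_X, aeval_C]
    rfl
  obtain ⟨a, b, hab⟩ : IsCoprime ((X - C c) ^ n) ((X - C (σ c)⁻¹) ^ n) :=
    (isCoprime_X_sub_C_of_isUnit_sub (sub_ne_zero.mpr hc.symm).isUnit).pow
  have h1 := LinearMap.congr_fun (congr_arg (aeval Φ) hab) y
  rw [mul_comm b, map_add, map_mul, map_mul, map_pow, map_pow, hs, hs, LinearMap.add_apply,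
    Module.End.mul_apply, hy, map_zero, zero_add, map_one, Module.End.one_apply,
    Module.End.mul_apply] at h1
  rw [← h1, h.adjoint_pow' hc0, hx]
  simp

theorem shift_pow_mem_ker {c : ℂ} {n : ℕ} {x : W} (hx : (shift Φ c ^ n) x = 0) (i : ℕ) :
    (shift Φ c ^ n) ((shift Φ c ^ i) x) = 0 := by
  rw [← Module.End.mul_apply, ← pow_add, add_comm, pow_add, Module.End.mul_apply, hx, map_zero]

/-- If `c ≠ (σ c)⁻¹`, paired chains for these eigenvalues split off `hMatrix n c`. -/
theorem IsCosquare.exists_hMatrix_of_ne (h : IsCosquare σ B Φ) {c : ℂ} (hc0 : c ≠ 0)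
    (hc : (σ c)⁻¹ ≠ c) {n : ℕ} {x z : W} (hx : (shift Φ c ^ n) x = 0)
    (hz : (shift Φ (σ c)⁻¹ ^ n) z = 0) (hxz : B ((shift Φ c ^ (n - 1)) x) z ≠ 0) :
    ∃ X : Submodule ℂ W, IsRegularSubspace B Φ X ∧ Realizes (restrictForm B X) (hMatrix n c) := by
  refine h.exists_hMatrix hc0 hx hz hxz (fun i j => ?_) fun i j => ?_
  · exact h.isotropic hc0 hc (shift_pow_mem_ker hx i) (shift_pow_mem_ker hx j)
  · refine h.isotropic (inv_ne_zero ((map_ne_zero σ).mpr hc0)) ?_ (shift_pow_mem_ker hz i)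
      (shift_pow_mem_ker hz j)
    rw [map_inv₀, h.invol, inv_inv]
    exact hc.symm

/-- The Jordan structure of the cosquare of `hMatrix n c`. -/
theorem IsCosquare.hasJordanBasis_hMatrix (h : IsCosquare σ B Φ) {c : ℂ} (hc0 : c ≠ 0) {n : ℕ}
    (hn : 1 ≤ n) (hB : Realizes B (hMatrix n c)) :
    HasJordanBasis Φ (fun _ : Bool => n) (fun s => if s then c else (σ c)⁻¹) := by
  obtain ⟨b, hb⟩ := hB
  have hext : ∀ y y', (∀ i, B y (b i) = B y' (b i)) → y = y' := by
    intro y y' hy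
    have : FiniteDimensional ℂ W := b.finiteDimensional_of_finite
    rw [← sub_eq_zero]
    refine h.left_sep _ fun x => ?_
    have h1 : B (y - y') = 0 := b.ext fun i => by simp [hy i]
    exact LinearMap.congr_fun h1 x
  have hy : ∀ j : Fin n, shift Φ c (b (.inl j)) =
      if h : (j : ℕ) = 0 then 0 else b (.inl ⟨j - 1, by omega⟩) := by
    intro j
    rw [shift_apply, sub_eq_iff_eq_add]
    apply hext
    intro i
    have h1 : B (Φ (b (.inl j))) (b i) = σ (B (b i) (b (.inl j))) := by
      rw [h.apply (b i), h.invol]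
    rw [h1, hb, map_add, LinearMap.add_apply, map_smulₛₗ, LinearMap.smul_apply, hb]
    rcases i with i | i
    · split_ifs with h2
      · simp [hMatrix]
      · rw [hb]
        simp [hMatrix]
    · have hj := j.2
      have h2 : ∀ j' : Fin n, B (b (.inl j')) (b (.inr i)) =
          if (j' : ℕ) = i then 1 else 0 := by
        intro j'
        rw [hb, hMatrix, Matrix.fromBlocks_apply₁₂, Matrix.one_apply]
        simp only [Fin.ext_iff]
      have h3 : hMatrix n c (.inr i) (.inl j) =
          if (i : ℕ) = j then c else if (i : ℕ) + 1 = j then 1 else 0 := by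
        rw [hMatrix, Matrix.fromBlocks_apply₂₁, jordanBlock, Matrix.of_apply]
        simp only [Fin.ext_iff]
      have h4 : hMatrix n c (.inl j) (.inr i) = if (j : ℕ) = i then 1 else 0 := by
        rw [← hb, h2]
      rw [h3, h4]
      by_cases h5 : (j : ℕ) = 0
      · rw [dif_pos h5, map_zero, LinearMap.zero_apply]
        split_ifs <;> first | omega | simp
      · rw [dif_neg h5, h2]
        split_ifs <;> first | (simp only at *; omega) | simp
  have hpow : ∀ (k : ℕ) (j : Fin n), (shift Φ c ^ k) (b (.inl j)) =
      if h : (j : ℕ) < k then 0 else b (.inl ⟨j - k, by omega⟩) := by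
    intro k
    induction k with
    | zero => intro j; simp
    | succ k ih =>
      intro j
      rw [pow_succ', Module.End.mul_apply, ih]
      by_cases h1 : (j : ℕ) < k
      · rw [dif_pos h1, dif_pos (by omega), map_zero]
      · rw [dif_neg h1, hy]
        by_cases h2 : (j : ℕ) < k + 1
        · rw [dif_pos (show (j : ℕ) - k = 0 by omega), dif_pos h2]
        · rw [dif_neg (show ¬ (j : ℕ) - k = 0 by omega), dif_neg h2]
          rfl
  set x : W := b (.inl ⟨n - 1, by omega⟩) with hxdef
  set z : W := b (.inr ⟨0, by omega⟩) with hzdef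
  have hx : (shift Φ c ^ n) x = 0 := by
    rw [hxdef, hpow, dif_pos (show n - 1 < n by omega)]
  have hxi : ∀ i : Fin n, (shift Φ c ^ (n - 1 - (i : ℕ))) x = b (.inl i) := by
    intro i
    have hi := i.2
    rw [hxdef, hpow, dif_neg (show ¬ n - 1 < n - 1 - i by omega)]
    exact congr_arg (fun j => b (.inl j)) (Fin.ext (show n - 1 - (n - 1 - i) = (i : ℕ) by omega))
  have hfd : FiniteDimensional ℂ W := b.finiteDimensional_of_finite
  have hright : ∀ y ∈ Submodule.span ℂ (Set.range fun i => b (.inr i)),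
      (∀ i, B (b (.inl i)) y = 0) → y = 0 := by
    intro y hy0 hyl
    obtain ⟨a, rfl⟩ := (Submodule.mem_span_range_iff_exists_fun ℂ).mp hy0
    have : ∀ i, a i = 0 := by
      intro i
      have := hyl i
      simpa [hb, hMatrix, Matrix.one_apply] using this
    simp [this]
  -- the span of the second half of the basis is stable, since it is its own left complement
  have hst : ∀ j : Fin n, Φ (b (.inr j)) ∈ Submodule.span ℂ (Set.range fun i => b (.inr i)) := by
    intro j
    have h1 : ∀ i, b.repr (Φ (b (.inr j))) (.inl i) = 0 := by
      intro i
      have h2 : B (Φ (b (.inr j))) (b (.inr i)) = σ (B (b (.inr i)) (b (.inr j))) := by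
        rw [h.apply (b (.inr i)), h.invol]
      have h3 : B (b (.inr i)) (b (.inr j)) = 0 := hb _ _
      rw [h3, map_zero, ← b.sum_repr (Φ (b (.inr j))), Fintype.sum_sum_type] at h2
      simpa [hb, hMatrix, Matrix.one_apply] using h2
    rw [← b.sum_repr (Φ (b (.inr j))), Fintype.sum_sum_type]
    simp only [h1, zero_smul, Finset.sum_const_zero, zero_add]
    exact Submodule.sum_mem _ fun i _ => Submodule.smul_mem _ _ (Submodule.subset_span ⟨i, rfl⟩)
  have hzmem : ∀ k : ℕ, (shift Φ (σ c)⁻¹ ^ k) z ∈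
      Submodule.span ℂ (Set.range fun i => b (.inr i)) := by
    intro k
    induction k with
    | zero => exact Submodule.subset_span ⟨_, rfl⟩
    | succ k ih =>
      rw [pow_succ', Module.End.mul_apply, shift_apply]
      exact Submodule.sub_mem _ (stable_span hst _ ih) (Submodule.smul_mem _ _ ih)
  have hz : (shift Φ (σ c)⁻¹ ^ n) z = 0 := by
    refine hright _ (hzmem n) fun i => ?_
    rw [h.adjoint_pow' hc0, hpow, dif_pos i.2]
    simp
  have hxz : B ((shift Φ c ^ (n - 1)) x) z ≠ 0 := by
    have h1 := hxi ⟨0, by omega⟩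
    rw [Nat.sub_zero] at h1
    rw [h1, hb]
    simp [hMatrix]
  have hP := h.isUnit_pairMatrix hc0 hx hxz
  have hchain : LinearIndependent ℂ fun p : Σ _ : Bool, Fin n =>
      (shift Φ (if p.1 then c else (σ c)⁻¹) ^ (p.2 : ℕ)) (if p.1 then x else z) := by
    rw [Fintype.linearIndependent_iff]
    intro a ha
    rw [Fintype.sum_sigma, Fintype.sum_bool] at ha
    simp only [if_true, Bool.false_eq_true, if_false] at ha
    have h1 : ∀ i j : Fin n, B (b (.inl i)) (b (.inl j)) = 0 := fun i j => hb _ _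
    have hxi' : ∀ i : Fin n, ∃ j, (shift Φ c ^ (i : ℕ)) x = b (.inl j) := fun i => by
      refine ⟨⟨n - 1 - i, by omega⟩, ?_⟩
      rw [← hxi]
      congr 2
      have := i.2
      simp only
      omega
    have ha2 : ∀ j, a ⟨false, j⟩ = 0 := by
      have h2 : (pairMatrix B Φ c n x z).mulVec (fun j => a ⟨false, j⟩) = 0 := by
        ext i
        have h3 := congr_arg (B (b (.inl i))) ha
        rw [map_add, map_sum, map_zero, Finset.sum_eq_zero, zero_add, map_sum] at h3
        · rw [Pi.zero_apply, ← h3]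
          simp [Matrix.mulVec, dotProduct, pairMatrix, hxi, mul_comm]
        · intro j _
          obtain ⟨j', hj'⟩ := hxi' j
          rw [hj', map_smul, h1, smul_zero]
      intro j
      exact congr_fun
        (Matrix.mulVec_injective_of_isUnit hP (h2.trans (Matrix.mulVec_zero _).symm)) j
    have ha1 : ∀ j, a ⟨true, j⟩ = 0 := by
      simp only [ha2, zero_smul, Finset.sum_const_zero, add_zero] at ha
      have h2 : LinearIndependent ℂ fun i : Fin n => b (.inl (Fin.rev i)) :=
        b.linearIndependent.comp _ (Sum.inl_injective.comp Fin.rev_injective)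
      refine Fintype.linearIndependent_iff.mp h2 (fun j => a ⟨true, j⟩) ?_
      rw [← ha]
      refine Finset.sum_congr rfl fun j _ => ?_
      rw [← hxi]
      congr 3
      have := j.2
      rw [Fin.val_rev]
      omega
    rintro ⟨s, i⟩
    cases s
    · exact ha2 i
    · exact ha1 i
  refine hasJordanBasis_of_chains (u := fun s : Bool => if s then x else z) ?_ hchain ?_
  · intro s
    cases s
    · simpa using hz
    · simpa using hx
  · rw [hchain.span_eq_top_of_card_eq_finrank']
    rw [Module.finrank_eq_card_basis b]
    simp [two_mul]

end cosquare

/-! ### Forms given by matrices -/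

/-- Every nonsingular matrix is the matrix of a form that has a cosquare. -/
theorem exists_isCosquare_realizes {σ : ℂ →+* ℂ} (hσ : ∀ a, σ (σ a) = a) {ι : Type} [Fintype ι]
    [DecidableEq ι] {K : Matrix ι ι ℂ} (hK : IsUnit K) :
    ∃ (B : (ι → ℂ) →ₛₗ[σ] (ι → ℂ) →ₗ[ℂ] ℂ) (Φ : Module.End ℂ (ι → ℂ)),
      IsCosquare σ B Φ ∧ Realizes B K := by
  let B : (ι → ℂ) →ₛₗ[σ] (ι → ℂ) →ₗ[ℂ] ℂ := LinearMap.mk₂'ₛₗ σ (RingHom.id ℂ)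
    (fun x y => (fun i => σ (x i)) ⬝ᵥ K.mulVec y)
    (fun x x' y => by
      simp only [dotProduct, Pi.add_apply, map_add, add_mul, Finset.sum_add_distrib])
    (fun a x y => by
      simp only [dotProduct, Pi.smul_apply, smul_eq_mul, map_mul, mul_assoc, Finset.mul_sum])
    (fun x y y' => by rw [Matrix.mulVec_add, dotProduct_add])
    (fun a x y => by rw [Matrix.mulVec_smul, dotProduct_smul, RingHom.id_apply])
  have hB : ∀ x y, B x y = (fun i => σ (x i)) ⬝ᵥ K.mulVec y := fun x y => rfl
  have hK' : IsUnit (conjTr σ K) := by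
    have h1 : conjTr σ K = (σ.mapMatrix K).transpose := rfl
    rw [h1]
    exact ((Matrix.isUnit_transpose _).mpr (hK.map σ.mapMatrix))
  obtain ⟨Q, hQ⟩ : ∃ Q, conjTr σ K * Q = 1 := by
    obtain ⟨K', hK'⟩ := hK'
    exact ⟨(K'⁻¹ : (Matrix ι ι ℂ)ˣ), by rw [← hK', Units.mul_inv]⟩
  refine ⟨B, Matrix.mulVecLin (Q * K), ⟨hσ, fun x y => ?_, fun y hy => ?_⟩,
    Pi.basisFun ℂ ι, fun i j => ?_⟩
  · have h1 : (conjTr σ K).mulVec (Matrix.mulVecLin (Q * K) y) =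
        K.mulVec y := by
      rw [Matrix.mulVecLin_apply, Matrix.mulVec_mulVec, ← Matrix.mul_assoc, hQ, Matrix.one_mul]
    rw [hB, hB, ← h1]
    simp only [dotProduct, Matrix.mulVec, conjTr, Matrix.of_apply, map_sum, map_mul, hσ,
      Finset.mul_sum]
    rw [Finset.sum_comm]
    refine Finset.sum_congr rfl fun k _ => Finset.sum_congr rfl fun l _ => ?_
    ring
  · refine Matrix.mulVec_injective_of_isUnit hK ?_
    rw [Matrix.mulVec_zero]
    ext i
    have h1 := hy (Pi.single i 1)
    rw [hB] at h1
    have h2 : (fun j => σ ((Pi.single i (1 : ℂ) : ι → ℂ) j)) = Pi.single i 1 := by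
      ext j
      by_cases hj : j = i
      · subst hj; simp
      · simp [Pi.single_eq_of_ne hj]
    rw [h2, single_dotProduct, one_mul] at h1
    exact h1
  · rw [Pi.basisFun_apply, Pi.basisFun_apply, hB]
    have h2 : (fun k => σ ((Pi.single i (1 : ℂ) : ι → ℂ) k)) = Pi.single i 1 := by
      ext j
      by_cases hj : j = i
      · subst hj; simp
      · simp [Pi.single_eq_of_ne hj]
    rw [h2, single_dotProduct, one_mul, Matrix.mulVec_single_one]
    rfl

/-! ### Forms whose cosquare has a single Jordan cell -/

/-- `T` vanishes above the antidiagonal, has no zeros on it, and `T - l T^*` vanishes on and above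
the antidiagonal and has no zeros just below it. The cosquare of such a matrix is similar to a
Jordan block with eigenvalue `l`. -/
structure IsAntitriangular (σ : ℂ →+* ℂ) (l : ℂ) {n : ℕ} (T : Matrix (Fin n) (Fin n) ℂ) :
    Prop where
  eq_zero : ∀ i j : Fin n, (i : ℕ) + j + 1 < n → T i j = 0
  ne_zero : ∀ i j : Fin n, (i : ℕ) + j + 1 = n → T i j ≠ 0
  rel : ∀ i j : Fin n, (i : ℕ) + j < n → T i j - l * σ (T j i) = 0
  not_rel : ∀ i j : Fin n, (i : ℕ) + j = n → T i j - l * σ (T j i) ≠ 0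

theorem IsAntitriangular.smul {σ : ℂ →+* ℂ} {l : ℂ} {n : ℕ} {T : Matrix (Fin n) (Fin n) ℂ}
    (h : IsAntitriangular σ l T) {a : ℂ} (ha : a ≠ 0) :
    IsAntitriangular σ (a / σ a * l) (a • T) := by
  have ha' : σ a ≠ 0 := (map_ne_zero σ).mpr ha
  have h1 : ∀ i j, (a • T) i j - a / σ a * l * σ ((a • T) j i) = a * (T i j - l * σ (T j i)) := by
    intro i j
    rw [Matrix.smul_apply, Matrix.smul_apply, smul_eq_mul, smul_eq_mul, map_mul]
    field_simp
  refine ⟨fun i j hij => ?_, fun i j hij => ?_, fun i j hij => ?_, fun i j hij => ?_⟩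
  · rw [Matrix.smul_apply, h.eq_zero i j hij, smul_zero]
  · exact mul_ne_zero ha (h.ne_zero i j hij)
  · rw [h1, h.rel i j hij, mul_zero]
  · rw [h1]
    exact mul_ne_zero ha (h.not_rel i j hij)

theorem isAntitriangular_gammaMatrix {σ : ℂ →+* ℂ} (n : ℕ) :
    IsAntitriangular σ ((-1) ^ (n + 1)) (gammaMatrix n) := by
  have hσ : ∀ k : ℕ, σ ((-1) ^ k) = (-1) ^ k := fun k => by simp
  refine ⟨fun i j hij => ?_, fun i j hij => ?_, fun i j hij => ?_, fun i j hij => ?_⟩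
  · rw [gammaMatrix, Matrix.of_apply, if_neg (by omega)]
  · rw [gammaMatrix, Matrix.of_apply, if_pos (by omega)]
    simp
  · simp only [gammaMatrix, Matrix.of_apply]
    by_cases h : (i : ℕ) + j + 1 = n
    · rw [if_pos (by omega), if_pos (by omega), hσ, ← pow_add,
        show n + 1 + (n - 1 - j) = (n - 1 - i) + 2 * (i + 1) by omega, pow_add, pow_mul]
      simp
    · rw [if_neg (by omega), if_neg (by omega)]
      simp
  · have hi := i.2
    simp only [gammaMatrix, Matrix.of_apply]
    rw [if_pos (by omega), if_pos (by omega), hσ, ← pow_add,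
      show n + 1 + (n - 1 - j) = (n - 1 - i) + (2 * i + 1) by omega, pow_add, pow_succ _ (2 * _),
      pow_mul]
    simp only [even_two, Even.neg_pow, one_pow, mul_neg, mul_one, sub_neg_eq_add]
    rw [← two_mul]
    simp

theorem isAntitriangular_deltaMatrix (n : ℕ) :
    IsAntitriangular (starRingEnd ℂ) 1 (deltaMatrix n) := by
  refine ⟨fun i j hij => ?_, fun i j hij => ?_, fun i j hij => ?_, fun i j hij => ?_⟩
  · rw [deltaMatrix, Matrix.of_apply, if_neg (by omega), if_neg (by omega)]
  · rw [deltaMatrix, Matrix.of_apply, if_pos (by omega)]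
    simp
  · simp only [deltaMatrix, Matrix.of_apply]
    by_cases h : (i : ℕ) + j + 1 = n
    · rw [if_pos (by omega), if_pos (by omega)]
      simp
    · rw [if_neg (by omega), if_neg (by omega), if_neg (by omega), if_neg (by omega)]
      simp
  · simp only [deltaMatrix, Matrix.of_apply]
    rw [if_neg (by omega), if_pos (by omega), if_neg (by omega), if_pos (by omega), Complex.conj_I]
    simp only [one_mul, sub_neg_eq_add, ne_eq]
    rw [← two_mul]
    simp

section anti
variable {σ : ℂ →+* ℂ} {l : ℂ} {n : ℕ} {T : Matrix (Fin n) (Fin n) ℂ}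
  {W : Type*} [AddCommGroup W] [Module ℂ W] {B : W →ₛₗ[σ] W →ₗ[ℂ] ℂ} {Φ : Module.End ℂ W}
  {b : Module.Basis (Fin n) ℂ W}

theorem apply_basis_eq_sum (hb : ∀ i j, B (b i) (b j) = T i j) (w : W) (i : Fin n) :
    B w (b i) = ∑ k, σ (b.repr w k) * T k i := by
  conv_lhs => rw [← b.sum_repr w]
  simp only [map_sum, LinearMap.sum_apply, map_smulₛₗ, LinearMap.smul_apply, smul_eq_mul, hb]

theorem IsAntitriangular.repr_eq_zero (h : IsAntitriangular σ l T)
    (hb : ∀ i j, B (b i) (b j) = T i j) {m : ℕ} {w : W}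
    (hw : ∀ i : Fin n, (i : ℕ) < m → B w (b i) = 0) (k : Fin n) (hk : n ≤ (k : ℕ) + m) :
    b.repr w k = 0 := by
  obtain ⟨i, hi⟩ : ∃ i : ℕ, (k : ℕ) + i + 1 = n := ⟨n - 1 - k, by omega⟩
  induction i using Nat.strong_induction_on generalizing k with
  | _ i ih =>
  have h1 := hw ⟨i, by omega⟩ (show i < m by omega)
  rw [apply_basis_eq_sum hb, Finset.sum_eq_single k] at h1
  · rcases mul_eq_zero.mp h1 with h2 | h2
    · exact (map_eq_zero σ).mp h2
    · exact absurd h2 (h.ne_zero _ _ hi)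
  · intro k' _ hk'
    rcases Nat.lt_or_gt_of_ne (Fin.val_ne_of_ne hk') with h2 | h2
    · rw [h.eq_zero _ _ (show (k' : ℕ) + i + 1 < n by omega), mul_zero]
    · rw [ih (n - 1 - k') (by omega) k' (by omega) (by omega), map_zero, zero_mul]
  · simp

theorem IsAntitriangular.apply_basis (h : IsAntitriangular σ l T)
    (hb : ∀ i j, B (b i) (b j) = T i j) {m : ℕ} {w : W}
    (hw : ∀ i : Fin n, (i : ℕ) < m → B w (b i) = 0) (k i : Fin n) (hk : (k : ℕ) + m + 1 = n)
    (hi : (i : ℕ) = m) : B w (b i) = σ (b.repr w k) * T k i := by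
  rw [apply_basis_eq_sum hb, Finset.sum_eq_single k]
  · intro k' _ hk'
    rcases Nat.lt_or_gt_of_ne (Fin.val_ne_of_ne hk') with h2 | h2
    · rw [h.eq_zero _ _ (show (k' : ℕ) + i + 1 < n by omega), mul_zero]
    · rw [h.repr_eq_zero hb hw k' (by omega), map_zero, zero_mul]
  · simp

theorem apply_shift_basis (hΦ : IsCosquare σ B Φ) (hb : ∀ i j, B (b i) (b j) = T i j) (w : W)
    (i : Fin n) :
    B (shift Φ l w) (b i) = ∑ k, σ (b.repr w k) * σ (T i k - l * σ (T k i)) := by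
  have h1 : ∀ k, B (shift Φ l (b k)) (b i) = σ (T i k - l * σ (T k i)) := by
    intro k
    have h2 : B (Φ (b k)) (b i) = σ (T i k) := by rw [← hb, hΦ.apply (b i), hΦ.invol]
    rw [shift_apply, map_sub, LinearMap.sub_apply, h2, map_smulₛₗ, LinearMap.smul_apply, hb,
      smul_eq_mul, map_sub, map_mul, hΦ.invol]
  conv_lhs => rw [← b.sum_repr w]
  simp only [map_sum, LinearMap.sum_apply, map_smulₛₗ, RingHom.id_apply, LinearMap.smul_apply,
    h1, smul_eq_mul]

theorem IsAntitriangular.shift_apply_basis_eq_zero (h : IsAntitriangular σ l T)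
    (hΦ : IsCosquare σ B Φ) (hb : ∀ i j, B (b i) (b j) = T i j) {m : ℕ} {w : W}
    (hw : ∀ i : Fin n, (i : ℕ) < m → B w (b i) = 0) (i : Fin n) (hi : (i : ℕ) < m + 1) :
    B (shift Φ l w) (b i) = 0 := by
  rw [apply_shift_basis hΦ hb]
  refine Finset.sum_eq_zero fun k _ => ?_
  by_cases hk : n ≤ (k : ℕ) + m
  · rw [h.repr_eq_zero hb hw k hk, map_zero, zero_mul]
  · rw [h.rel i k (by omega), map_zero, mul_zero]

theorem IsAntitriangular.shift_apply_basis (h : IsAntitriangular σ l T)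
    (hΦ : IsCosquare σ B Φ) (hb : ∀ i j, B (b i) (b j) = T i j) {m : ℕ} {w : W}
    (hw : ∀ i : Fin n, (i : ℕ) < m → B w (b i) = 0) (k i : Fin n) (hk : (k : ℕ) + m + 1 = n)
    (hi : (i : ℕ) = m + 1) :
    B (shift Φ l w) (b i) = σ (b.repr w k) * σ (T i k - l * σ (T k i)) := by
  rw [apply_shift_basis hΦ hb, Finset.sum_eq_single k]
  · intro k' _ hk'
    rcases Nat.lt_or_gt_of_ne (Fin.val_ne_of_ne hk') with h2 | h2
    · rw [h.rel i k' (by omega), map_zero, mul_zero]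
    · rw [h.repr_eq_zero hb hw k' (by omega), map_zero, zero_mul]
  · simp

end anti

/-- The last basis vector generates the single Jordan chain of the cosquare of an antitriangular
matrix; its height pairing depends on the matrix only. -/
theorem IsAntitriangular.exists_value {σ : ℂ →+* ℂ} {l : ℂ} {n : ℕ}
    {T : Matrix (Fin n) (Fin n) ℂ} (h : IsAntitriangular σ l T) (hn : 1 ≤ n) :
    ∃ v : ℂ, v ≠ 0 ∧ ∀ (W : Type) [AddCommGroup W] [Module ℂ W] (B : W →ₛₗ[σ] W →ₗ[ℂ] ℂ)
      (Φ : Module.End ℂ W), IsCosquare σ B Φ → ∀ b : Module.Basis (Fin n) ℂ W,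
      (∀ i j, B (b i) (b j) = T i j) →
      ∃ u : W, (shift Φ l ^ n) u = 0 ∧ B ((shift Φ l ^ (n - 1)) u) u = v := by
  have key : ∀ m (hm : m < n), ∃ v : ℂ, v ≠ 0 ∧ ∀ (W : Type) [AddCommGroup W] [Module ℂ W]
      (B : W →ₛₗ[σ] W →ₗ[ℂ] ℂ) (Φ : Module.End ℂ W), IsCosquare σ B Φ →
      ∀ b : Module.Basis (Fin n) ℂ W, (∀ i j, B (b i) (b j) = T i j) →
      (∀ i : Fin n, (i : ℕ) < m → B ((shift Φ l ^ m) (b ⟨n - 1, by omega⟩)) (b i) = 0) ∧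
      B ((shift Φ l ^ m) (b ⟨n - 1, by omega⟩)) (b ⟨m, hm⟩) = v := by
    intro m
    induction m with
    | zero =>
      intro hm
      refine ⟨_, h.ne_zero ⟨n - 1, by omega⟩ ⟨0, hm⟩ (show n - 1 + 0 + 1 = n by omega), ?_⟩
      intro W _ _ B Φ hΦ b hb
      exact ⟨fun i hi => absurd hi (by omega), hb _ _⟩
    | succ m ih =>
      intro hm
      obtain ⟨v, hv, hv'⟩ := ih (by omega)
      have hT := h.ne_zero ⟨n - 1 - m, by omega⟩ ⟨m, by omega⟩
        (show n - 1 - m + m + 1 = n by omega)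
      refine ⟨v / T ⟨n - 1 - m, by omega⟩ ⟨m, by omega⟩ *
        σ (T ⟨m + 1, hm⟩ ⟨n - 1 - m, by omega⟩ -
          l * σ (T ⟨n - 1 - m, by omega⟩ ⟨m + 1, hm⟩)), ?_, ?_⟩
      · refine mul_ne_zero (div_ne_zero hv hT) ((map_ne_zero σ).mpr ?_)
        exact h.not_rel _ _ (show m + 1 + (n - 1 - m) = n by omega)
      · intro W _ _ B Φ hΦ b hb
        obtain ⟨h1, h2⟩ := hv' W B Φ hΦ b hb
        refine ⟨fun i hi => ?_, ?_⟩
        · rw [pow_succ', Module.End.mul_apply]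
          exact h.shift_apply_basis_eq_zero hΦ hb h1 i hi
        · rw [pow_succ', Module.End.mul_apply,
            h.shift_apply_basis hΦ hb h1 ⟨n - 1 - m, by omega⟩ _
              (show n - 1 - m + m + 1 = n by omega) rfl]
          rw [h.apply_basis hb h1 ⟨n - 1 - m, by omega⟩ _
              (show n - 1 - m + m + 1 = n by omega) rfl] at h2
          rw [← h2, mul_div_cancel_right₀ _ hT]
  obtain ⟨v, hv, hv'⟩ := key (n - 1) (by omega)
  refine ⟨v, hv, fun W _ _ B Φ hΦ b hb => ?_⟩
  obtain ⟨h1, h2⟩ := hv' W B Φ hΦ b hb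
  refine ⟨b ⟨n - 1, by omega⟩, ?_, h2⟩
  have hp : shift Φ l ^ n = shift Φ l * shift Φ l ^ (n - 1) := by
    rw [← pow_succ', Nat.sub_add_cancel hn]
  rw [hp, Module.End.mul_apply]
  have hfd : FiniteDimensional ℂ W := b.finiteDimensional_of_finite
  refine hΦ.left_sep _ fun y => ?_
  have h3 : B (shift Φ l ((shift Φ l ^ (n - 1)) (b ⟨n - 1, by omega⟩))) = 0 :=
    b.ext fun i => h.shift_apply_basis_eq_zero hΦ hb h1 i (by omega)
  rw [h3]
  rfl

theorem IsCosquare.hasJordanBasis_of_generator {σ : ℂ →+* ℂ} {W : Type*} [AddCommGroup W]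
    [Module ℂ W] [FiniteDimensional ℂ W] {B : W →ₛₗ[σ] W →ₗ[ℂ] ℂ} {Φ : Module.End ℂ W}
    (h : IsCosquare σ B Φ) {c : ℂ} (hc0 : c ≠ 0) (hc : (σ c)⁻¹ = c) {n : ℕ} {u : W}
    (hW : Module.finrank ℂ W = n) (hu : (shift Φ c ^ n) u = 0)
    (hg : B ((shift Φ c ^ (n - 1)) u) u ≠ 0) :
    HasJordanBasis Φ (fun _ : Unit => n) (fun _ => c) := by
  have hg' : IsUnit (Matrix.of fun _ _ : Unit => B ((shift Φ c ^ (n - 1)) u) u) := by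
    rw [Matrix.isUnit_iff_isUnit_det]
    simpa using hg
  have hli : LinearIndependent ℂ fun p : Σ _ : Unit, Fin n => (shift Φ c ^ (p.2 : ℕ)) u := by
    rw [Fintype.linearIndependent_iff]
    intro a ha p
    rw [h.chains_eq_zero hc0 hc (u := fun _ => u) (fun _ => hu) hg' a
      fun t j => by rw [ha]; simp]
    rfl
  refine hasJordanBasis_of_chains (u := fun _ => u) (fun _ => hu) hli ?_
  rw [hli.span_eq_top_of_card_eq_finrank']
  rw [hW]
  simp

theorem IsAntitriangular.hasJordanBasis {σ : ℂ →+* ℂ} {l : ℂ} {n : ℕ}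
    {T : Matrix (Fin n) (Fin n) ℂ} (h : IsAntitriangular σ l T) (hn : 1 ≤ n) (hl0 : l ≠ 0)
    (hl : (σ l)⁻¹ = l) {W : Type} [AddCommGroup W] [Module ℂ W] {B : W →ₛₗ[σ] W →ₗ[ℂ] ℂ}
    {Φ : Module.End ℂ W} (hΦ : IsCosquare σ B Φ) (hB : Realizes B T) :
    HasJordanBasis Φ (fun _ : Unit => n) (fun _ => l) := by
  obtain ⟨v, hv, hv'⟩ := h.exists_value hn
  obtain ⟨b, hb⟩ := hB
  obtain ⟨u, hu, hu'⟩ := hv' W B Φ hΦ b hb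
  have hfd : FiniteDimensional ℂ W := b.finiteDimensional_of_finite
  exact hΦ.hasJordanBasis_of_generator hl0 hl (by rw [Module.finrank_eq_card_basis b]; simp) hu
    (by rw [hu']; exact hv)

theorem IsAntitriangular.isUnit {σ : ℂ →+* ℂ} {l : ℂ} {n : ℕ} {T : Matrix (Fin n) (Fin n) ℂ}
    (h : IsAntitriangular σ l T) : IsUnit T := by
  have h1 : IsUnit (T.submatrix Fin.revPerm (Equiv.refl _)) := by
    rw [Matrix.isUnit_iff_isUnit_det, Matrix.det_of_isUpperTriangular, isUnit_iff_ne_zero,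
      Finset.prod_ne_zero_iff]
    · intro i _
      exact h.ne_zero _ _ (show (Fin.rev i : ℕ) + i + 1 = n by rw [Fin.val_rev]; omega)
    · intro i j hij
      have h2 : (j : ℕ) < i := hij
      exact h.eq_zero _ _ (show (Fin.rev i : ℕ) + j + 1 < n by rw [Fin.val_rev]; omega)
  exact (Matrix.isUnit_submatrix_equiv _ _).mp h1

/-! ### Single Jordan cells for complex conjugation -/

section sign
variable {W : Type*} [AddCommGroup W] [Module ℂ W] {W' : Type*} [AddCommGroup W'] [Module ℂ W']
  {B : W →ₛₗ[starRingEnd ℂ] W →ₗ[ℂ] ℂ} {Φ : Module.End ℂ W}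
  {B' : W' →ₛₗ[starRingEnd ℂ] W' →ₗ[ℂ] ℂ} {Φ' : Module.End ℂ W'}

/-- If the cosquares of two sesquilinear forms are similar to the same unimodular Jordan block,
then the forms are isometric up to sign. -/
theorem Realizes.of_cyclic [FiniteDimensional ℂ W] (h : IsCosquare (starRingEnd ℂ) B Φ)
    (h' : IsCosquare (starRingEnd ℂ) B' Φ') {n : ℕ} (hn : 1 ≤ n) {c : ℂ} (hc0 : c ≠ 0)
    (hc : (starRingEnd ℂ c)⁻¹ = c) (hJ : HasJordanBasis Φ (fun _ : Unit => n) (fun _ => c))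
    (hJ' : HasJordanBasis Φ' (fun _ : Unit => n) (fun _ => c)) {ι : Type*} {M : Matrix ι ι ℂ}
    (hM : Realizes B' M) : Realizes B M ∨ Realizes B (-M) := by
  obtain ⟨φ, hφ⟩ := hJ.exists_equiv hJ'
  obtain ⟨S, hS, hSa, hSΦ, hSi⟩ := h.exists_selfadjoint h' φ hφ
  obtain ⟨b, hb⟩ := hJ
  set N := shift Φ c with hN
  set u := b ⟨(), ⟨0, hn⟩⟩ with hu
  have hbu : ∀ (i : ℕ) (hi : i < n), b ⟨(), ⟨i, hi⟩⟩ = (N ^ i) u := by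
    intro i
    induction i with
    | zero => intro hi; rfl
    | succ i ih =>
      intro hi
      rw [pow_succ', Module.End.mul_apply, ← ih (by omega), hN, hb, dif_pos hi]
  have hNn : (N ^ n) u = 0 := by
    rw [show n = (n - 1) + 1 by omega, pow_succ', Module.End.mul_apply, ← hbu _ (by omega), hN,
      hb, dif_neg (show ¬ (n - 1 + 1 < n) by omega)]
  -- every vector is a polynomial in `N` applied to the generator
  have hrep : ∀ w, w = ∑ i : Fin n, b.repr w ⟨(), i⟩ • (N ^ (i : ℕ)) u := by
    intro w
    conv_lhs => rw [← b.sum_repr w]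
    rw [Fintype.sum_sigma, Fintype.sum_unique]
    exact Finset.sum_congr rfl fun i _ => by rw [← hbu i i.2]
  have hsplit : ∀ w, ∃ (r : ℂ) (y : W), w = r • u + N y := by
    intro w
    refine ⟨b.repr w ⟨(), ⟨0, hn⟩⟩, ∑ i : Fin n, if (i : ℕ) = 0 then 0 else
      b.repr w ⟨(), i⟩ • (N ^ ((i : ℕ) - 1)) u, ?_⟩
    rw [map_sum]
    conv_lhs => rw [hrep w]
    rw [← Finset.add_sum_erase _ _ (Finset.mem_univ (⟨0, hn⟩ : Fin n)),
      ← Finset.add_sum_erase Finset.univ (fun i : Fin n => N (if (i : ℕ) = 0 then 0 else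
      b.repr w ⟨(), i⟩ • (N ^ ((i : ℕ) - 1)) u)) (Finset.mem_univ (⟨0, hn⟩ : Fin n))]
    rw [if_pos rfl, map_zero, zero_add, pow_zero, Module.End.one_apply]
    congr 1
    refine Finset.sum_congr rfl fun i hi => ?_
    have hi0 : (i : ℕ) ≠ 0 := fun h0 => (Finset.mem_erase.mp hi).1 (Fin.ext h0)
    rw [if_neg hi0, map_smul, ← Module.End.mul_apply, ← pow_succ', Nat.sub_add_cancel (by omega)]
  have hSc : Commute S Φ := LinearMap.ext fun x => hSΦ x
  have hSN : Commute S N := hSc.sub_right ((Commute.one_right S).smul_right c)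
  obtain ⟨r, y, hry⟩ := hsplit (S u)
  have hSr : ∀ w, ∃ w', shift S r w = N w' := by
    intro w
    refine ⟨∑ i : Fin n, b.repr w ⟨(), i⟩ • (N ^ (i : ℕ)) y, ?_⟩
    conv_lhs => rw [hrep w]
    rw [map_sum, map_sum]
    refine Finset.sum_congr rfl fun i _ => ?_
    rw [map_smul, map_smul, shift_apply, ← Module.End.mul_apply, (hSN.pow_right i).eq,
      Module.End.mul_apply, hry, map_add, map_smul, add_sub_cancel_left, ← Module.End.mul_apply,
      ← Module.End.mul_apply, (Commute.refl N).pow_left i]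
  have hN0 : N ^ n = 0 := by
    refine LinearMap.ext fun w => ?_
    rw [hrep w, map_sum]
    refine Finset.sum_eq_zero fun i _ => ?_
    rw [map_smul, ← Module.End.mul_apply, ((Commute.refl N).pow_pow n i).eq, Module.End.mul_apply,
      hNn, map_zero, smul_zero]
  have hSrN : Commute (shift S r) N :=
    hSN.sub_left ((Commute.one_left N).smul_left r)
  have hSrn : shift S r ^ n = 0 := by
    have h1 : ∀ k w, ∃ w', (shift S r ^ k) w = (N ^ k) w' := by
      intro k
      induction k with
      | zero => intro w; exact ⟨w, rfl⟩
      | succ k ih =>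
        intro w
        obtain ⟨w', hw'⟩ := ih w
        obtain ⟨w2, hw2⟩ := hSr w'
        refine ⟨w2, ?_⟩
        rw [pow_succ', Module.End.mul_apply, hw', ← Module.End.mul_apply,
          (hSrN.pow_right k).eq, Module.End.mul_apply, hw2, ← Module.End.mul_apply, ← pow_succ]
    refine LinearMap.ext fun w => ?_
    obtain ⟨w', hw'⟩ := h1 n w
    rw [hw', hN0]
    rfl
  set e := (N ^ (n - 1)) u with he
  have hNe : N e = 0 := by
    rw [he, ← Module.End.mul_apply, ← pow_succ', Nat.sub_add_cancel hn, hNn]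
  have hBeN : ∀ y, B e (N y) = 0 := by
    intro y
    rw [hN, h.adjoint hc0, hc, ← hN, hNe]
    simp
  have heu : B e u ≠ 0 := by
    intro h0
    have h1 : e = 0 := by
      refine h.left_sep e fun w => ?_
      obtain ⟨r, y, rfl⟩ := hsplit w
      rw [map_add, map_smul, h0, hBeN, smul_zero, add_zero]
    rw [he, ← hbu (n - 1) (by omega)] at h1
    exact b.ne_zero _ h1
  have hSe : S e = r • e := by
    rw [he, ← Module.End.mul_apply, (hSN.pow_right (n - 1)).eq, Module.End.mul_apply, hry, map_add,
      map_smul, ← Module.End.mul_apply (N ^ (n - 1)) N, ← pow_succ, Nat.sub_add_cancel hn, hN0,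
      LinearMap.zero_apply, add_zero]
  have hr : starRingEnd ℂ r = r := by
    have h1 := hSa e u
    rw [hSe, hry, map_add, hBeN, add_zero, map_smulₛₗ, LinearMap.smul_apply, map_smul] at h1
    exact mul_right_cancel₀ heu h1
  obtain ⟨t, rfl⟩ := Complex.conj_eq_iff_real.mp hr
  have ht : t ≠ 0 := by
    rintro rfl
    rw [Complex.ofReal_zero, zero_smul] at hSe
    have h1 : e = 0 := hSi (hSe.trans (map_zero S).symm)
    rw [h1] at heu
    exact heu (by simp)
  have hcoeff : ∀ (p : Polynomial ℝ) (k : ℕ), starRingEnd ℂ ((p.map Complex.ofRealHom).coeff k) =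
      (p.map Complex.ofRealHom).coeff k := fun p k => by
    rw [Polynomial.coeff_map, Complex.ofRealHom_eq_coe, Complex.conj_ofReal]
  rcases lt_or_gt_of_ne ht with htn | htp
  · right
    have h1 : shift (-S) ((-t : ℝ) : ℂ) ^ n = 0 := by
      have h2 : shift (-S) ((-t : ℝ) : ℂ) = -shift S (t : ℂ) := by
        simp only [shift, Complex.ofReal_neg, neg_smul]
        abel
      rw [h2, neg_pow, hSrn, mul_zero]
    obtain ⟨p, hp⟩ := exists_aeval_map_sq_eq (-S) (neg_pos.mpr htn) h1
    have hS' : ∀ x y, (-B') (φ x) (φ y) = B x ((-S) y) := fun x y => by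
      rw [LinearMap.neg_apply, LinearMap.neg_apply, hS, LinearMap.neg_apply, map_neg]
    refine Realizes.of_selfadjoint_sq hS' hp (aeval_selfadjoint (fun x y => ?_) (hcoeff p)) ?_ ?_
    · rw [LinearMap.neg_apply, LinearMap.neg_apply, map_neg, map_neg, LinearMap.neg_apply, hSa]
    · intro x y hxy
      exact hSi (neg_injective hxy)
    · obtain ⟨b', hb'⟩ := hM
      exact ⟨b', fun i j => by
        rw [LinearMap.neg_apply, LinearMap.neg_apply, hb', Matrix.neg_apply]⟩
  · left
    obtain ⟨p, hp⟩ := exists_aeval_map_sq_eq S htp hSrn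
    exact Realizes.of_selfadjoint_sq hS hp (aeval_selfadjoint hSa (hcoeff p)) hSi hM

end sign

/-! ### Existence of the canonical forms -/

section cosquare
variable {σ : ℂ →+* ℂ} {W : Type*} [AddCommGroup W] [Module ℂ W]
  {B : W →ₛₗ[σ] W →ₗ[ℂ] ℂ} {Φ : Module.End ℂ W}

theorem Realizes.ne_bot {X : Submodule ℂ W} {ι : Type*} [Nonempty ι] {M : Matrix ι ι ℂ}
    (h : Realizes (restrictForm B X) M) : X ≠ ⊥ := by
  rintro rfl
  obtain ⟨b, -⟩ := h
  exact b.ne_zero (Classical.arbitrary ι) (Subsingleton.elim _ _)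

theorem shift_eq_zero_of_pow {c : ℂ} {n : ℕ} (hn : 1 ≤ n) {x : W}
    (hx : (shift Φ c ^ n) x = 0) : shift Φ c ((shift Φ c ^ (n - 1)) x) = 0 := by
  rw [← Module.End.mul_apply, ← pow_succ', Nat.sub_add_cancel hn, hx]

/-- The height pairings of chains for `c` and for `(σ c)⁻¹` determine each other. -/
theorem IsCosquare.height_swap (h : IsCosquare σ B Φ) {c : ℂ} (hc0 : c ≠ 0) {n : ℕ} (hn : 1 ≤ n)
    {x z : W} (hx : (shift Φ c ^ n) x = 0) (hz : (shift Φ (σ c)⁻¹ ^ n) z = 0) :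
    σ (B ((σ c)⁻¹ • (shift Φ (σ c)⁻¹ ^ (n - 1)) z) x) =
      (-(σ c)⁻¹) ^ (n - 1) * (((σ c)⁻¹) ^ (n - 1) * B ((shift Φ c ^ (n - 1)) x) z) := by
  rw [← h.apply_eigenvector hc0 (shift_eq_zero_of_pow hn hx), ← h.adjoint_pow' hc0, h.apply x,
    apply_eq_shift Φ (σ c)⁻¹, shift_eq_zero_of_pow hn hz, add_zero]

theorem IsCosquare.height_swap_ne_zero (h : IsCosquare σ B Φ) {c : ℂ} (hc0 : c ≠ 0) {n : ℕ}
    (hn : 1 ≤ n) {x z : W} (hx : (shift Φ c ^ n) x = 0) (hz : (shift Φ (σ c)⁻¹ ^ n) z = 0)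
    (hxz : B ((shift Φ c ^ (n - 1)) x) z ≠ 0) : B ((shift Φ (σ c)⁻¹ ^ (n - 1)) z) x ≠ 0 := by
  intro h0
  have h1 := h.height_swap hc0 hn hx hz
  have hc' : (σ c)⁻¹ ≠ 0 := inv_ne_zero ((map_ne_zero σ).mpr hc0)
  rw [map_smulₛₗ, LinearMap.smul_apply, h0, smul_zero, map_zero, eq_comm] at h1
  exact mul_ne_zero (pow_ne_zero _ (neg_ne_zero.mpr hc')) (mul_ne_zero (pow_ne_zero _ hc') hxz) h1

/-- The symmetry of the height pairing on the kernel of `(Φ - c) ^ n` if `σ c = c⁻¹`. -/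
theorem IsCosquare.height_symm (h : IsCosquare σ B Φ) {c : ℂ} (hc0 : c ≠ 0) (hc : (σ c)⁻¹ = c)
    {n : ℕ} (hn : 1 ≤ n) {x z : W} (hx : (shift Φ c ^ n) x = 0) (hz : (shift Φ c ^ n) z = 0) :
    c * σ (B ((shift Φ c ^ (n - 1)) z) x) =
      (-c ^ 2) ^ (n - 1) * B ((shift Φ c ^ (n - 1)) x) z := by
  have h1 := h.height_swap hc0 hn hx (by rw [hc]; exact hz)
  rw [hc, map_smulₛₗ, LinearMap.smul_apply, smul_eq_mul, map_mul, h.invol] at h1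
  rw [h1, ← mul_assoc, ← mul_pow]
  ring

end cosquare

theorem exists_isAntitriangular {T : ∀ n, Matrix (Fin n) (Fin n) ℂ}
    (hT : T = gammaMatrix ∨ T = deltaMatrix) (n : ℕ) :
    ∃ l : ℂ, ‖l‖ = 1 ∧ IsAntitriangular (starRingEnd ℂ) l (T n) := by
  rcases hT with rfl | rfl
  · exact ⟨_, by simp, isAntitriangular_gammaMatrix n⟩
  · exact ⟨1, by simp, isAntitriangular_deltaMatrix n⟩

theorem inv_conj_eq_self_iff {c : ℂ} (hc0 : c ≠ 0) : (starRingEnd ℂ c)⁻¹ = c ↔ ‖c‖ = 1 := by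
  have h1 : (starRingEnd ℂ c) ≠ 0 := (map_ne_zero _).mpr hc0
  rw [eq_comm, inv_eq_one_div, eq_div_iff h1, Complex.mul_conj, Complex.normSq_eq_norm_sq]
  norm_cast
  rw [pow_eq_one_iff_of_nonneg (norm_nonneg c) two_ne_zero]

theorem div_conj_of_norm_one {a : ℂ} (ha : ‖a‖ = 1) : a / starRingEnd ℂ a = a ^ 2 := by
  have ha0 : a ≠ 0 := norm_ne_zero_iff.mp (by rw [ha]; exact one_ne_zero)
  rw [div_eq_mul_inv, (inv_conj_eq_self_iff ha0).mpr ha, sq]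

/-- Every nonzero nondegenerate sesquilinear form splits off a canonical summand. -/
theorem exists_starSummand {T : ∀ n, Matrix (Fin n) (Fin n) ℂ}
    (hT : T = gammaMatrix ∨ T = deltaMatrix) (W : Type) [AddCommGroup W] [Module ℂ W]
    [FiniteDimensional ℂ W] [Nontrivial W] (B : W →ₛₗ[starRingEnd ℂ] W →ₗ[ℂ] ℂ)
    (Φ : Module.End ℂ W) (h : IsCosquare (starRingEnd ℂ) B Φ) :
    ∃ (X : Submodule ℂ W) (s : StarCongruenceSummand), IsRegularSubspace B Φ X ∧ X ≠ ⊥ ∧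
      Realizes (restrictForm B X) (s.toBlock T).A := by
  obtain ⟨c, n, x, z, hc0, hn, hx, hz, hxz⟩ := h.exists_pair
  have hne : Nonempty (Fin n) := ⟨⟨0, hn⟩⟩
  by_cases hc : (starRingEnd ℂ c)⁻¹ = c
  · have hc1 : ‖c‖ = 1 := (inv_conj_eq_self_iff hc0).mp hc
    rw [hc] at hz
    obtain ⟨u, hu, hg⟩ : ∃ u, (shift Φ c ^ n) u = 0 ∧ B ((shift Φ c ^ (n - 1)) u) u ≠ 0 := by
      by_contra! hcon
      have h1 := hcon x hx
      have h2 := hcon z hz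
      have h3 := hcon (x + z) (by rw [map_add, hx, hz, add_zero])
      have h4 := hcon (x + Complex.I • z) (by rw [map_add, map_smul, hx, hz, smul_zero, add_zero])
      simp only [map_add, map_smul, map_smulₛₗ, LinearMap.add_apply, LinearMap.smul_apply, h1, h2,
        smul_eq_mul, Complex.conj_I] at h3 h4
      refine hxz ?_
      have h5 : Complex.I * (2 * B ((shift Φ c ^ (n - 1)) x) z) = 0 := by
        linear_combination h4 + Complex.I * h3
      simpa using h5
    have hg' : IsUnit (Matrix.of fun _ _ : Unit => B ((shift Φ c ^ (n - 1)) u) u) := by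
      rw [Matrix.isUnit_iff_isUnit_det]
      simpa using hg
    obtain ⟨X, hX, hJ⟩ := h.exists_isRegularSubspace_of_chains hc0 hc (u := fun _ : Unit => u)
      (fun _ => hu) hg'
    obtain ⟨l, hl1, hl⟩ := exists_isAntitriangular hT n
    have hl0 : l ≠ 0 := norm_ne_zero_iff.mp (by rw [hl1]; exact one_ne_zero)
    obtain ⟨a, ha⟩ := IsAlgClosed.exists_pow_nat_eq (c / l) two_pos
    have ha1 : ‖a‖ = 1 := by
      have h1 : ‖a‖ ^ 2 = 1 := by rw [← norm_pow, ha, norm_div, hc1, hl1, div_one]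
      have h2 := norm_nonneg a
      nlinarith
    have ha0 : a ≠ 0 := norm_ne_zero_iff.mp (by rw [ha1]; exact one_ne_zero)
    have haT := hl.smul ha0
    rw [div_conj_of_norm_one ha1, ha, div_mul_cancel₀ _ hl0] at haT
    obtain ⟨B', Φ', h', hB'⟩ := exists_isCosquare_realizes h.invol haT.isUnit
    rcases Realizes.of_cyclic (hX.isCosquare h) h' hn hc0 hc hJ
      (haT.hasJordanBasis hn hc0 hc h' hB') hB' with hR | hR
    · exact ⟨X, .unimodular n hn a ha1, hX, hR.ne_bot, hR⟩
    · rw [← neg_smul] at hR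
      exact ⟨X, .unimodular n hn (-a) (by rw [norm_neg, ha1]), hX, hR.ne_bot, hR⟩
  · have hc1 : ‖c‖ ≠ 1 := fun h1 => hc ((inv_conj_eq_self_iff hc0).mpr h1)
    rcases lt_or_gt_of_ne hc1 with hlt | hgt
    · have hc0' : (starRingEnd ℂ c)⁻¹ ≠ 0 := inv_ne_zero ((map_ne_zero _).mpr hc0)
      have hcc : (starRingEnd ℂ (starRingEnd ℂ c)⁻¹)⁻¹ = c := h.map_inv_inv c
      obtain ⟨X, hX, hR⟩ := h.exists_hMatrix_of_ne hc0' (by rw [hcc]; exact Ne.symm hc) hz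
        (by rw [hcc]; exact hx) (h.height_swap_ne_zero hc0 hn hx hz hxz)
      refine ⟨X, .h n hn _ ?_, hX, hR.ne_bot, hR⟩
      rw [norm_inv, RCLike.norm_conj]
      exact (one_lt_inv₀ (norm_pos_iff.mpr hc0)).mpr hlt
    · obtain ⟨X, hX, hR⟩ := h.exists_hMatrix_of_ne hc0 hc hx hz hxz
      exact ⟨X, .h n hn c hgt, hX, hR.ne_bot, hR⟩

/-- Every nonzero nondegenerate bilinear form splits off a canonical summand. -/
theorem exists_summand (W : Type) [AddCommGroup W] [Module ℂ W]
    [FiniteDimensional ℂ W] [Nontrivial W] (B : W →ₛₗ[RingHom.id ℂ] W →ₗ[ℂ] ℂ)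
    (Φ : Module.End ℂ W) (h : IsCosquare (RingHom.id ℂ) B Φ) :
    ∃ (X : Submodule ℂ W) (s : CongruenceSummand), IsRegularSubspace B Φ X ∧ X ≠ ⊥ ∧
      Realizes (restrictForm B X) s.toBlock.A := by
  obtain ⟨c, n, x, z, hc0, hn, hx, hz, hxz⟩ := h.exists_pair
  have hne : Nonempty (Fin n) := ⟨⟨0, hn⟩⟩
  by_cases hc : (RingHom.id ℂ c)⁻¹ = c
  · rw [hc] at hz
    have hc2 : c ^ 2 = 1 := by
      rw [RingHom.id_apply] at hc
      nth_rewrite 1 [sq, ← hc]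
      exact inv_mul_cancel₀ hc0
    have hsymm : ∀ x z, (shift Φ c ^ n) x = 0 → (shift Φ c ^ n) z = 0 →
        c * B ((shift Φ c ^ (n - 1)) z) x = (-1) ^ (n - 1) * B ((shift Φ c ^ (n - 1)) x) z := by
      intro x z hx hz
      have h1 := h.height_symm hc0 hc hn hx hz
      rwa [hc2] at h1
    have hpar : ((-1 : ℂ)) ^ (n - 1) = (-1) ^ (n + 1) := by
      rw [show n + 1 = (n - 1) + 2 by omega, pow_add]
      simp
    rw [hpar] at hsymm
    by_cases hcn : c = (-1) ^ (n + 1)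
    · obtain ⟨u, hu, hg⟩ : ∃ u, (shift Φ c ^ n) u = 0 ∧ B ((shift Φ c ^ (n - 1)) u) u ≠ 0 := by
        by_contra! hcon
        have h1 := hcon x hx
        have h2 := hcon z hz
        have h3 := hcon (x + z) (by rw [map_add, hx, hz, add_zero])
        have h4 := hsymm x z hx hz
        rw [← hcn] at h4
        have h5 := mul_left_cancel₀ hc0 h4
        simp only [map_add, LinearMap.add_apply, h1, h2, h5] at h3
        refine hxz ?_
        have h5 : 2 * B ((shift Φ c ^ (n - 1)) x) z = 0 := by
          linear_combination h3
        simpa using h5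
      have hg' : IsUnit (Matrix.of fun _ _ : Unit => B ((shift Φ c ^ (n - 1)) u) u) := by
        rw [Matrix.isUnit_iff_isUnit_det]
        simpa using hg
      obtain ⟨X, hX, hJ⟩ := h.exists_isRegularSubspace_of_chains hc0 hc (u := fun _ : Unit => u)
        (fun _ => hu) hg'
      have hT := isAntitriangular_gammaMatrix (σ := RingHom.id ℂ) n
      rw [← hcn] at hT
      obtain ⟨B', Φ', h', hB'⟩ := exists_isCosquare_realizes h.invol hT.isUnit
      obtain ⟨φ, hφ⟩ := hJ.exists_equiv (hT.hasJordanBasis hn hc0 hc h' hB')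
      have hR := Realizes.of_similar_id (hX.isCosquare h) h' φ hφ hB'
      exact ⟨X, .gamma n hn, hX, hR.ne_bot, hR⟩
    · have hcn' : (-1 : ℂ) ^ (n + 1) = -c := by
        have h1 : c ^ 2 = ((-1) ^ (n + 1)) ^ 2 := by
          rw [hc2, ← pow_mul, mul_comm, pow_mul]
          simp
        rw [(sq_eq_sq_iff_eq_or_eq_neg.mp h1).resolve_left hcn, neg_neg]
      rw [hcn'] at hsymm
      have halt : ∀ x z, (shift Φ c ^ n) x = 0 → (shift Φ c ^ n) z = 0 →
          B ((shift Φ c ^ (n - 1)) z) x = - B ((shift Φ c ^ (n - 1)) x) z := fun x z hx hz =>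
        mul_left_cancel₀ hc0 (by linear_combination hsymm x z hx hz)
      have h0 : ∀ x, (shift Φ c ^ n) x = 0 → B ((shift Φ c ^ (n - 1)) x) x = 0 := fun x hx => by
        have h1 := halt x x hx hx
        have h2 : 2 * B ((shift Φ c ^ (n - 1)) x) x = 0 := by linear_combination h1
        simpa using h2
      let u : Bool → W := fun s => if s then x else z
      have hu : ∀ s, (shift Φ c ^ n) (u s) = 0 := by
        rintro (_ | _)
        · exact hz
        · exact hx
      have hg' : IsUnit (Matrix.of fun s t : Bool => B ((shift Φ c ^ (n - 1)) (u s)) (u t)) := by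
        refine IsUnit.of_mul_eq_one (Matrix.of fun s t : Bool =>
          if s = t then 0 else (if s then (-1 : ℂ) else 1) * (B ((shift Φ c ^ (n - 1)) x) z)⁻¹) ?_
        ext s t
        rw [Matrix.mul_apply, Fintype.sum_bool]
        cases s <;> cases t <;> simp [u, h0 x hx, h0 z hz, halt x z hx hz, hxz]
      obtain ⟨X, hX, hJ⟩ := h.exists_isRegularSubspace_of_chains hc0 hc hu hg'
      obtain ⟨B', Φ', h', hB'⟩ := exists_isCosquare_realizes h.invol (isUnit_hMatrix n hc0)
      have hJ' := h'.hasJordanBasis_hMatrix hc0 hn hB'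
      rw [hc] at hJ'
      simp only [ite_self] at hJ'
      obtain ⟨φ, hφ⟩ := hJ.exists_equiv hJ'
      have hR := Realizes.of_similar_id (hX.isCosquare h) h' φ hφ hB'
      exact ⟨X, .h n hn c hc0 hcn, hX, hR.ne_bot, hR⟩
  · obtain ⟨X, hX, hR⟩ := h.exists_hMatrix_of_ne hc0 hc hx hz hxz
    refine ⟨X, .h n hn c hc0 ?_, hX, hR.ne_bot, hR⟩
    rintro rfl
    refine hc ?_
    rw [RingHom.id_apply, ← inv_pow, inv_neg_one]

theorem exists_starCongruent_blockSum {T : ∀ n, Matrix (Fin n) (Fin n) ℂ}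
    (hT : T = gammaMatrix ∨ T = deltaMatrix) {ι : Type} [Fintype ι] [DecidableEq ι]
    {K : Matrix ι ι ℂ} (hK : IsUnit K) :
    ∃ C, StarCongruent (star : ℂ → ℂ) K (StarCongruenceSummand.blockSum T C).A := by
  obtain ⟨B, Φ, h, hB⟩ := exists_isCosquare_realizes (σ := starRingEnd ℂ) Complex.conj_conj hK
  obtain ⟨C, hC⟩ := exists_realizes_listSum (StarCongruenceSummand.toBlock T)
    (exists_starSummand hT) _ (ι → ℂ) B Φ h rfl
  exact ⟨C, hB.starCongruent hC⟩

theorem exists_congruent_blockSum {ι : Type} [Fintype ι] [DecidableEq ι]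
    {K : Matrix ι ι ℂ} (hK : IsUnit K) :
    ∃ C, StarCongruent (id : ℂ → ℂ) K (CongruenceSummand.blockSum C).A := by
  obtain ⟨B, Φ, h, hB⟩ := exists_isCosquare_realizes (σ := RingHom.id ℂ) (fun _ => rfl) hK
  obtain ⟨C, hC⟩ := exists_realizes_listSum CongruenceSummand.toBlock
    exists_summand _ (ι → ℂ) B Φ h rfl
  exact ⟨C, hB.starCongruent hC⟩

/-! ### Additive invariants of direct sums -/

section cosquare
variable {σ : ℂ →+* ℂ} {W : Type*} [AddCommGroup W] [Module ℂ W]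
  {B : W →ₛₗ[σ] W →ₗ[ℂ] ℂ} {Φ : Module.End ℂ W}

theorem Realizes.of_starCongruent {ι κ : Type*} [Fintype ι] [Fintype κ] [DecidableEq ι]
    [DecidableEq κ] {K : Matrix ι ι ℂ} {K' : Matrix κ κ ℂ} (hK : StarCongruent σ K K')
    (h : Realizes B K) : Realizes B K' := by
  obtain ⟨S, R, hSR, hRS, rfl⟩ := hK
  obtain ⟨b, hb⟩ := h
  have hb' : ∀ j, Module.Basis.ofEquivFun (b.equivFun.trans (Matrix.toLin'OfInv hSR hRS)) j =
      ∑ i, S i j • b i := by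
    intro j
    rw [Module.Basis.coe_ofEquivFun]
    change b.equivFun.symm (Matrix.toLin' S (Pi.single j 1)) = _
    rw [b.equivFun_symm_apply, Matrix.toLin'_apply, Matrix.mulVec_single_one]
    rfl
  refine ⟨Module.Basis.ofEquivFun (b.equivFun.trans (Matrix.toLin'OfInv hSR hRS)), fun i j => ?_⟩
  rw [hb', hb']
  simp only [map_sum, LinearMap.sum_apply, map_smulₛₗ, LinearMap.smul_apply, smul_eq_mul,
    RingHom.id_apply, hb, Matrix.mul_apply, conjTr, Matrix.of_apply, Finset.sum_mul,
    Finset.mul_sum]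
  refine Finset.sum_congr rfl fun k _ => Finset.sum_congr rfl fun l _ => ?_
  ring

/-- A block diagonal matrix of a form comes from an orthogonal decomposition. -/
theorem Realizes.exists_split {ι ι' : Type*} [Fintype ι] [Fintype ι'] {M : Matrix ι ι ℂ}
    {M' : Matrix ι' ι' ℂ} (h : IsCosquare σ B Φ) (hB : Realizes B (Matrix.fromBlocks M 0 0 M')) :
    ∃ X X' : Submodule ℂ W, IsRegularSubspace B Φ X ∧ IsRegularSubspace B Φ X' ∧ IsCompl X X' ∧
      (∀ x ∈ X, ∀ y ∈ X', B x y = 0) ∧ (∀ x ∈ X, ∀ y ∈ X', B y x = 0) ∧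
      Realizes (restrictForm B X) M ∧ Realizes (restrictForm B X') M' := by
  obtain ⟨b, hb⟩ := hB
  have hfd : FiniteDimensional ℂ W := b.finiteDimensional_of_finite
  set X := Submodule.span ℂ (Set.range fun i => b (.inl i)) with hX
  set X' := Submodule.span ℂ (Set.range fun i => b (.inr i)) with hX'
  have hsup : ∀ w, ∃ x ∈ X, ∃ y ∈ X', x + y = w := by
    intro w
    refine ⟨∑ i, b.repr w (.inl i) • b (.inl i), Submodule.sum_mem _ fun i _ =>
      Submodule.smul_mem _ _ (Submodule.subset_span ⟨i, rfl⟩),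
      ∑ i, b.repr w (.inr i) • b (.inr i), Submodule.sum_mem _ fun i _ =>
      Submodule.smul_mem _ _ (Submodule.subset_span ⟨i, rfl⟩), ?_⟩
    rw [← Fintype.sum_sum_type (fun i => b.repr w i • b i), b.sum_repr]
  have hXX' : ∀ x ∈ X, ∀ y ∈ X', B x y = 0 := by
    intro x hx y hy
    obtain ⟨a, rfl⟩ := (Submodule.mem_span_range_iff_exists_fun ℂ).mp hx
    obtain ⟨a', rfl⟩ := (Submodule.mem_span_range_iff_exists_fun ℂ).mp hy
    simp [hb]
  have hX'X : ∀ x ∈ X, ∀ y ∈ X', B y x = 0 := by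
    intro x hx y hy
    obtain ⟨a, rfl⟩ := (Submodule.mem_span_range_iff_exists_fun ℂ).mp hx
    obtain ⟨a', rfl⟩ := (Submodule.mem_span_range_iff_exists_fun ℂ).mp hy
    simp [hb]
  have hnd : ∀ y ∈ X, (∀ x ∈ X, B x y = 0) → y = 0 := fun y hy hy0 => h.right_sep y fun w => by
    obtain ⟨x, hx, x', hx', rfl⟩ := hsup w
    rw [map_add, LinearMap.add_apply, hy0 x hx, hX'X y hy x' hx', add_zero]
  have hnd' : ∀ y ∈ X', (∀ x ∈ X', B x y = 0) → y = 0 := fun y hy hy0 =>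
    h.right_sep y fun w => by
      obtain ⟨x, hx, x', hx', rfl⟩ := hsup w
      rw [map_add, LinearMap.add_apply, hy0 x' hx', hXX' x hx y hy, add_zero]
  have hmem : ∀ w, (∀ y ∈ X', B w y = 0) → w ∈ X := by
    intro w hw
    obtain ⟨x, hx, x', hx', rfl⟩ := hsup w
    have h0 : x' = 0 := h.left_sep x' fun v => by
      obtain ⟨y, hy, y', hy', rfl⟩ := hsup v
      have h2 := hw y' hy'
      rw [map_add, LinearMap.add_apply, hXX' x hx y' hy', zero_add] at h2
      rw [map_add, h2, hX'X y hy x' hx', add_zero]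
    rw [h0, add_zero]
    exact hx
  have hmem' : ∀ w, (∀ y ∈ X, B w y = 0) → w ∈ X' := by
    intro w hw
    obtain ⟨x, hx, x', hx', rfl⟩ := hsup w
    have h0 : x = 0 := h.left_sep x fun v => by
      obtain ⟨y, hy, y', hy', rfl⟩ := hsup v
      have h2 := hw y hy
      rw [map_add, LinearMap.add_apply, hX'X y hy x' hx', add_zero] at h2
      rw [map_add, h2, hXX' x hx y' hy', add_zero]
    rw [h0, zero_add]
    exact hx'
  have hB : ∀ x y, B (Φ y) x = σ (B x y) := fun x y => by rw [h.apply x, h.invol]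
  refine ⟨X, X', ⟨fun x hx => hmem _ fun y hy => by rw [hB, hX'X x hx y hy, map_zero], hnd⟩,
    ⟨fun x hx => hmem' _ fun y hy => by rw [hB, hXX' y hy x hx, map_zero], hnd'⟩, ⟨?_, ?_⟩,
    hXX', hX'X, ?_, ?_⟩
  · rw [Submodule.disjoint_def]
    exact fun x hx hx' => hnd x hx fun y hy => hXX' y hy x hx'
  · rw [codisjoint_iff, eq_top_iff]
    intro w _
    obtain ⟨x, hx, x', hx', rfl⟩ := hsup w
    exact Submodule.add_mem_sup hx hx'
  · have hli : LinearIndependent ℂ fun i => b (.inl i) :=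
      b.linearIndependent.comp _ Sum.inl_injective
    exact ⟨Module.Basis.span hli, fun i j => by
      rw [restrictForm_apply, Module.Basis.span_apply, Module.Basis.span_apply, hb]; rfl⟩
  · have hli : LinearIndependent ℂ fun i => b (.inr i) :=
      b.linearIndependent.comp _ Sum.inr_injective
    exact ⟨Module.Basis.span hli, fun i j => by
      rw [restrictForm_apply, Module.Basis.span_apply, Module.Basis.span_apply, hb]; rfl⟩

theorem Realizes.reindex {ι κ : Type*} {M : Matrix ι ι ℂ} {N : Matrix κ κ ℂ} (e : ι ≃ κ)
    (hN : ∀ i j, N (e i) (e j) = M i j) (h : Realizes B M) : Realizes B N := by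
  obtain ⟨b, hb⟩ := h
  refine ⟨b.reindex e, fun i j => ?_⟩
  rw [Module.Basis.reindex_apply, Module.Basis.reindex_apply, hb, ← hN, e.apply_symm_apply,
    e.apply_symm_apply]

end cosquare

section listSum
variable {σ : ℂ →+* ℂ}

/-- An additive invariant of forms takes on a direct sum the sum of its values on the summands. -/
theorem invariant_listSum {S : Type} (block : S → BlockMatrix ℂ) (f : S → ℕ)
    (P : ∀ (W : Type) [AddCommGroup W] [Module ℂ W], (W →ₛₗ[σ] W →ₗ[ℂ] ℂ) → Module.End ℂ W →
      ℕ → Prop)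
    (hadd : ∀ (W : Type) [AddCommGroup W] [Module ℂ W] [FiniteDimensional ℂ W]
      (B : W →ₛₗ[σ] W →ₗ[ℂ] ℂ) (Φ : Module.End ℂ W) (X X' : Submodule ℂ W)
      (hX : IsRegularSubspace B Φ X) (hX' : IsRegularSubspace B Φ X'), IsCompl X X' →
      (∀ x ∈ X, ∀ y ∈ X', B x y = 0) → (∀ x ∈ X, ∀ y ∈ X', B y x = 0) → ∀ p p',
      P X (restrictForm B X) (Φ.restrict hX.stable) p →
      P X' (restrictForm B X') (Φ.restrict hX'.stable) p' → P W B Φ (p + p'))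
    (h0 : ∀ (W : Type) [AddCommGroup W] [Module ℂ W] [Subsingleton W]
      (B : W →ₛₗ[σ] W →ₗ[ℂ] ℂ) (Φ : Module.End ℂ W), P W B Φ 0)
    (hs : ∀ (s : S) (W : Type) [AddCommGroup W] [Module ℂ W] [FiniteDimensional ℂ W]
      (B : W →ₛₗ[σ] W →ₗ[ℂ] ℂ) (Φ : Module.End ℂ W), IsCosquare σ B Φ →
      Realizes B (block s).A → P W B Φ (f s)) (C : List S) :
    ∀ (W : Type) [AddCommGroup W] [Module ℂ W] (B : W →ₛₗ[σ] W →ₗ[ℂ] ℂ) (Φ : Module.End ℂ W),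
      IsCosquare σ B Φ → Realizes B (BlockMatrix.listSum (C.map block)).A →
      P W B Φ (C.map f).sum := by
  induction C with
  | nil =>
    intro W _ _ B Φ h hB
    obtain ⟨b, -⟩ := hB
    have hi : IsEmpty (BlockMatrix.listSum (([] : List S).map block)).ι :=
      inferInstanceAs (IsEmpty (Fin 0))
    have : Subsingleton W := b.repr.injective.subsingleton
    exact h0 W B Φ
  | cons s C ih =>
    intro W _ _ B Φ h hB
    have hfd : FiniteDimensional ℂ W := by
      obtain ⟨b, -⟩ := hB
      exact b.finiteDimensional_of_finite
    obtain ⟨X, X', hX, hX', hc, h1, h2, hR, hR'⟩ := Realizes.exists_split (M := (block s).A)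
      (M' := (BlockMatrix.listSum (C.map block)).A) h hB
    rw [List.map_cons, List.sum_cons]
    exact hadd W B Φ X X' hX hX' hc h1 h2 _ _ (hs s X _ _ (hX.isCosquare h) hR)
      (ih X' _ _ (hX'.isCosquare h) hR')

theorem Realizes.perm {L L' : List (BlockMatrix ℂ)} (hL : L.Perm L') :
    ∀ (W : Type) [AddCommGroup W] [Module ℂ W] (B : W →ₛₗ[σ] W →ₗ[ℂ] ℂ) (Φ : Module.End ℂ W),
      IsCosquare σ B Φ → Realizes B (BlockMatrix.listSum L).A →
      Realizes B (BlockMatrix.listSum L').A := by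
  induction hL with
  | nil => exact fun W _ _ B Φ _ hB => hB
  | cons M _ ih =>
    intro W _ _ B Φ h hB
    obtain ⟨X, X', hX, hX', hc, h1, h2, hR, hR'⟩ := Realizes.exists_split (M := M.A)
      (M' := (BlockMatrix.listSum _).A) h hB
    exact Realizes.fromBlocks hc h1 h2 hR (ih X' _ _ (hX'.isCosquare h) hR')
  | swap M N L =>
    intro W _ _ B Φ h hB
    refine Realizes.reindex (M := Matrix.fromBlocks N.A 0 0 (Matrix.fromBlocks M.A 0 0
      (BlockMatrix.listSum L).A)) (N := Matrix.fromBlocks M.A 0 0 (Matrix.fromBlocks N.A 0 0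
      (BlockMatrix.listSum L).A)) (((Equiv.sumAssoc _ _ _).symm.trans
      (Equiv.sumCongr (Equiv.sumComm _ _) (Equiv.refl _))).trans (Equiv.sumAssoc _ _ _)) ?_ hB
    rintro (i | i | i) (j | j | j) <;> rfl
  | trans _ _ ih1 ih2 => exact fun W _ _ B Φ h hB => ih2 W B Φ h (ih1 W B Φ h hB)

/-- Replacing summands by summands of the same form, and permuting them. -/
theorem Realizes.rel {S : Type} (block : S → BlockMatrix ℂ) (r : S → S → Prop)
    (hr : ∀ s s', r s s' → ∀ (W : Type) [AddCommGroup W] [Module ℂ W]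
      (B : W →ₛₗ[σ] W →ₗ[ℂ] ℂ) (Φ : Module.End ℂ W), IsCosquare σ B Φ →
      Realizes B (block s).A → Realizes B (block s').A) (C : List S) :
    ∀ C' : List S, Multiset.Rel r (C : Multiset S) (C' : Multiset S) →
    ∀ (W : Type) [AddCommGroup W] [Module ℂ W] (B : W →ₛₗ[σ] W →ₗ[ℂ] ℂ) (Φ : Module.End ℂ W),
      IsCosquare σ B Φ → Realizes B (BlockMatrix.listSum (C.map block)).A →
      Realizes B (BlockMatrix.listSum (C'.map block)).A := by
  induction C with
  | nil =>
    intro C' hC' W _ _ B Φ h hB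
    rw [Multiset.coe_nil, Multiset.rel_zero_left, Multiset.coe_eq_zero] at hC'
    rw [hC']
    exact hB
  | cons s C ih =>
    intro C' hC' W _ _ B Φ h hB
    rw [← Multiset.cons_coe, Multiset.rel_cons_left] at hC'
    obtain ⟨s', t, hs, ht, hC'⟩ := hC'
    obtain ⟨C2, rfl⟩ := Quot.exists_rep t
    obtain ⟨X, X', hX, hX', hc, h1, h2, hR, hR'⟩ := Realizes.exists_split (M := (block s).A)
      (M' := (BlockMatrix.listSum (C.map block)).A) h hB
    have hp : (s' :: C2).Perm C' := (Multiset.coe_eq_coe.mp hC').symm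
    exact Realizes.perm (hp.map block) W B Φ h (Realizes.fromBlocks hc h1 h2
      (hr s s' hs X _ _ (hX.isCosquare h) hR) (ih C2 ht X' _ _ (hX'.isCosquare h) hR'))

end listSum

section additivity
variable {W : Type*} [AddCommGroup W] [Module ℂ W]
  {Φ : Module.End ℂ W} {X X' : Submodule ℂ W}

theorem finrank_map_sup_map [FiniteDimensional ℂ W] (hc : IsCompl X X') (A : Submodule ℂ X)
    (A' : Submodule ℂ X') :
    Module.finrank ℂ ↥(A.map X.subtype ⊔ A'.map X'.subtype) =
      Module.finrank ℂ A + Module.finrank ℂ A' := by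
  have h1 := Submodule.finrank_sup_add_finrank_inf_eq (A.map X.subtype) (A'.map X'.subtype)
  have h2 : A.map X.subtype ⊓ A'.map X'.subtype = ⊥ :=
    (hc.disjoint.mono (Submodule.map_subtype_le X A) (Submodule.map_subtype_le X' A')).eq_bot
  rw [h2, finrank_bot, add_zero, Submodule.finrank_map_subtype_eq,
    Submodule.finrank_map_subtype_eq] at h1
  exact h1

theorem ker_shift_pow_eq_sup (hc : IsCompl X X') (hX : ∀ x ∈ X, Φ x ∈ X)
    (hX' : ∀ x ∈ X', Φ x ∈ X') (d : ℂ) (k : ℕ) :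
    LinearMap.ker (shift Φ d ^ k) =
      (LinearMap.ker (shift (Φ.restrict hX) d ^ k)).map X.subtype ⊔
        (LinearMap.ker (shift (Φ.restrict hX') d ^ k)).map X'.subtype := by
  apply le_antisymm
  · intro w hw
    obtain ⟨x, hx, x', hx', rfl⟩ := Submodule.mem_sup.mp (hc.sup_eq_top ▸
      Submodule.mem_top (x := w))
    rw [LinearMap.mem_ker, map_add] at hw
    have h1 := coe_shift_restrict_pow hX d k ⟨x, hx⟩
    have h2 := coe_shift_restrict_pow hX' d k ⟨x', hx'⟩
    dsimp only at h1 h2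
    have h3 : (shift Φ d ^ k) x = 0 := by
      refine Submodule.disjoint_def.mp hc.disjoint _ (h1 ▸ Subtype.property _) ?_
      rw [eq_neg_of_add_eq_zero_left hw]
      exact X'.neg_mem (h2 ▸ Subtype.property _)
    rw [h3, zero_add] at hw
    refine Submodule.add_mem_sup ⟨⟨x, hx⟩, ?_, rfl⟩ ⟨⟨x', hx'⟩, ?_, rfl⟩
    · exact Subtype.ext (h1.trans h3)
    · exact Subtype.ext (h2.trans hw)
  · refine sup_le ?_ ?_
    · rintro _ ⟨x, hx, rfl⟩
      exact (coe_shift_restrict_pow hX d k x).symm.trans (congr_arg Subtype.val hx)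
    · rintro _ ⟨x, hx, rfl⟩
      exact (coe_shift_restrict_pow hX' d k x).symm.trans (congr_arg Subtype.val hx)

theorem finrank_ker_shift_pow [FiniteDimensional ℂ W] (hc : IsCompl X X') (hX : ∀ x ∈ X, Φ x ∈ X)
    (hX' : ∀ x ∈ X', Φ x ∈ X') (d : ℂ) (k : ℕ) :
    Module.finrank ℂ (LinearMap.ker (shift Φ d ^ k)) =
      Module.finrank ℂ (LinearMap.ker (shift (Φ.restrict hX) d ^ k)) +
        Module.finrank ℂ (LinearMap.ker (shift (Φ.restrict hX') d ^ k)) := by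
  rw [ker_shift_pow_eq_sup hc hX hX', finrank_map_sup_map hc]

end additivity

/-- The dimensions of the kernels of the powers of `Φ - d` for a direct sum. -/
theorem finrank_ker_listSum {σ : ℂ →+* ℂ} {S : Type} (block : S → BlockMatrix ℂ) (f : S → ℕ)
    (d : ℂ) (k : ℕ)
    (hs : ∀ (s : S) (W : Type) [AddCommGroup W] [Module ℂ W] [FiniteDimensional ℂ W]
      (B : W →ₛₗ[σ] W →ₗ[ℂ] ℂ) (Φ : Module.End ℂ W), IsCosquare σ B Φ →
      Realizes B (block s).A → Module.finrank ℂ (LinearMap.ker (shift Φ d ^ k)) = f s)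
    (C : List S) (W : Type) [AddCommGroup W] [Module ℂ W] (B : W →ₛₗ[σ] W →ₗ[ℂ] ℂ)
    (Φ : Module.End ℂ W) (h : IsCosquare σ B Φ)
    (hB : Realizes B (BlockMatrix.listSum (C.map block)).A) :
    Module.finrank ℂ (LinearMap.ker (shift Φ d ^ k)) = (C.map f).sum := by
  refine invariant_listSum block f
    (fun W _ _ B Φ p => Module.finrank ℂ (LinearMap.ker (shift Φ d ^ k)) = p) ?_ ?_ hs C W B Φ h hB
  · intro W _ _ _ B Φ X X' hX hX' hc h1 h2 p p' hp hp'
    rw [finrank_ker_shift_pow hc hX.stable hX'.stable, hp, hp']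
  · intro W _ _ _ B Φ
    exact Module.finrank_zero_of_subsingleton

/-- A nondegenerate form has no matrix `J_n(0)`. -/
theorem not_realizes_jordanBlock_zero {σ : ℂ →+* ℂ} {W : Type*} [AddCommGroup W] [Module ℂ W]
    {B : W →ₛₗ[σ] W →ₗ[ℂ] ℂ} {Φ : Module.End ℂ W} (h : IsCosquare σ B Φ) {n : ℕ} (hn : 1 ≤ n) :
    ¬ Realizes B (jordanBlock n (0 : ℂ)) := by
  rintro ⟨b, hb⟩
  have h1 : B.flip (b ⟨0, hn⟩) = 0 := b.ext fun i => by
    rw [LinearMap.flip_apply, hb, jordanBlock, Matrix.of_apply]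
    split_ifs with h1 h2
    · rfl
    · exact absurd h2 (by simp)
    · rfl
  exact b.ne_zero _ (h.right_sep _ fun x => LinearMap.congr_fun h1 x)

/-! ### Uniqueness for bilinear forms -/

/-- The second difference in `m` of the kernel dimensions counts the Jordan cells of size `m`. -/
theorem two_mul_sum_min (L : List (ℕ × ℂ)) (d : ℂ) {m : ℕ} (hm : 1 ≤ m) :
    open Classical in
    2 * (L.map fun p => if p.2 = d then min m p.1 else 0).sum =
      (L.map fun p => if p.2 = d then min (m - 1) p.1 else 0).sum +
      (L.map fun p => if p.2 = d then min (m + 1) p.1 else 0).sum + L.count (m, d) := by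
  classical
  induction L with
  | nil => rfl
  | cons p L ih =>
    obtain ⟨n, c⟩ := p
    have h1 : (if c = d then min m n else 0) * 2 =
        (if c = d then min (m - 1) n else 0) + (if c = d then min (m + 1) n else 0) +
        if ((n, c) == (m, d)) = true then 1 else 0 := by
      simp only [beq_iff_eq, Prod.mk.injEq]
      by_cases hc : c = d
      · simp only [hc, if_true, and_true]
        split_ifs <;> omega
      · simp [hc]
    simp only [List.map_cons, List.sum_cons, List.count_cons]
    omega

/-- The kernel dimensions determine the Jordan cells of positive size. -/
theorem perm_of_sum_min {L L' : List (ℕ × ℂ)} (hL : ∀ p ∈ L, 1 ≤ p.1) (hL' : ∀ p ∈ L', 1 ≤ p.1)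
    (h : open Classical in ∀ (d : ℂ) (k : ℕ),
      (L.map fun p => if p.2 = d then min k p.1 else 0).sum =
      (L'.map fun p => if p.2 = d then min k p.1 else 0).sum) : L.Perm L' := by
  classical
  rw [List.perm_iff_count]
  rintro ⟨m, d⟩
  by_cases hm : 1 ≤ m
  · have h1 := two_mul_sum_min L d hm
    have h2 := two_mul_sum_min L' d hm
    rw [h, h, h] at h1
    omega
  · rw [List.count_eq_zero_of_not_mem fun h1 => hm (hL _ h1),
      List.count_eq_zero_of_not_mem fun h1 => hm (hL' _ h1)]

namespace CongruenceSummand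

/-- The sizes and eigenvalues of the Jordan cells of the cosquare of a summand; the singular
summand `J_n(0)`, which has no cosquare, is given the eigenvalue `0`. -/
noncomputable def cells : CongruenceSummand → List (ℕ × ℂ)
  | jordan n _ => [(n, 0)]
  | gamma n _ => [(n, (-1) ^ (n + 1))]
  | h n _ c _ _ => [(n, c), (n, c⁻¹)]

theorem one_le_of_mem_cells {s : CongruenceSummand} {p : ℕ × ℂ} (hp : p ∈ s.cells) : 1 ≤ p.1 := by
  cases s <;> simp only [cells, List.mem_cons, List.not_mem_nil, or_false] at hp
  · rw [hp]; assumption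
  · rw [hp]; assumption
  · rcases hp with rfl | rfl <;> assumption

theorem finrank_ker {s : CongruenceSummand} {W : Type} [AddCommGroup W] [Module ℂ W]
    {B : W →ₛₗ[RingHom.id ℂ] W →ₗ[ℂ] ℂ} {Φ : Module.End ℂ W} (hΦ : IsCosquare (RingHom.id ℂ) B Φ)
    (hB : Realizes B s.toBlock.A) (d : ℂ) (k : ℕ) :
    Module.finrank ℂ (LinearMap.ker (shift Φ d ^ k)) =
      (s.cells.map fun p => open Classical in if p.2 = d then min k p.1 else 0).sum := by
  rcases s with ⟨n, hn⟩ | ⟨n, hn⟩ | ⟨n, hn, c, hc, hc'⟩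
  · exact absurd hB (not_realizes_jordanBlock_zero hΦ hn)
  · have hl : ((-1 : ℂ)) ^ (n + 1) ≠ 0 := pow_ne_zero _ (neg_ne_zero.mpr one_ne_zero)
    have hJ := (isAntitriangular_gammaMatrix (σ := RingHom.id ℂ) n).hasJordanBasis hn hl
      (by rw [RingHom.id_apply, ← inv_pow, inv_neg_one]) hΦ hB
    rw [hJ.finrank_ker]
    simp [cells]
  · have hJ := hΦ.hasJordanBasis_hMatrix hc hn hB
    rw [hJ.finrank_ker]
    simp [cells]

theorem sameUpToInverse_of_mem {s s' : CongruenceSummand} {p : ℕ × ℂ} (hp : p ∈ s.cells)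
    (hp' : p ∈ s'.cells) : SameUpToInverse s s' ∧ s.cells.Perm s'.cells := by
  have h0 : ∀ n : ℕ, (-1 : ℂ) ^ n ≠ 0 := fun n => pow_ne_zero _ (neg_ne_zero.mpr one_ne_zero)
  have hinv : ∀ (c : ℂ) (n : ℕ), c⁻¹ = (-1) ^ n → c = (-1) ^ n := fun c n h => by
    rw [← inv_inv c, h, ← inv_pow, inv_neg_one]
  rcases s with ⟨n, hn⟩ | ⟨n, hn⟩ | ⟨n, hn, c, hc, hc'⟩ <;>
  rcases s' with ⟨n', hn'⟩ | ⟨n', hn'⟩ | ⟨n', hn', d, hd, hd'⟩ <;>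
  simp only [cells, List.mem_cons, List.not_mem_nil, or_false] at hp hp' ⊢
  · obtain ⟨rfl, -⟩ := Prod.mk.inj (hp.symm.trans hp')
    exact ⟨rfl, List.Perm.refl _⟩
  · exact absurd (Prod.mk.inj (hp.symm.trans hp')).2.symm (h0 _)
  · subst hp
    rcases hp' with h | h
    · exact absurd (Prod.mk.inj h).2.symm hd
    · exact absurd (Prod.mk.inj h).2.symm (inv_ne_zero hd)
  · exact absurd (Prod.mk.inj (hp.symm.trans hp')).2 (h0 _)
  · obtain ⟨rfl, -⟩ := Prod.mk.inj (hp.symm.trans hp')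
    exact ⟨rfl, List.Perm.refl _⟩
  · subst hp
    rcases hp' with h | h <;> obtain ⟨rfl, h2⟩ := Prod.mk.inj h
    · exact absurd h2.symm hd'
    · exact absurd (hinv _ _ h2.symm) hd'
  · subst hp'
    rcases hp with h | h
    · exact absurd (Prod.mk.inj h).2.symm hc
    · exact absurd (Prod.mk.inj h).2.symm (inv_ne_zero hc)
  · subst hp'
    rcases hp with h | h <;> obtain ⟨rfl, h2⟩ := Prod.mk.inj h
    · exact absurd h2.symm hc'
    · exact absurd (hinv _ _ h2.symm) hc'
  · have h1 : n = n' ∧ (d = c ∨ d = c⁻¹) := by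
      rcases hp with rfl | rfl <;> rcases hp' with h | h <;>
        obtain ⟨rfl, h2⟩ := Prod.mk.inj h <;> refine ⟨rfl, ?_⟩
      · exact Or.inl h2.symm
      · exact Or.inr (by rw [h2, inv_inv])
      · exact Or.inr h2.symm
      · exact Or.inl (inv_injective h2).symm
    refine ⟨h1, ?_⟩
    obtain ⟨rfl, rfl | rfl⟩ := h1
    · exact List.Perm.refl _
    · rw [inv_inv]
      exact List.Perm.swap _ _ _

theorem cells_ne_nil (s : CongruenceSummand) : ∃ p, p ∈ s.cells := by
  cases s <;> exact ⟨_, List.mem_cons_self⟩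

/-- The Jordan cells of the cosquare determine the summands up to `SameUpToInverse`. -/
theorem rel_of_bind_cells_eq (C : Multiset CongruenceSummand) :
    ∀ C' : Multiset CongruenceSummand,
    (C.bind fun s => (s.cells : Multiset (ℕ × ℂ))) = C'.bind (fun s => (s.cells : Multiset (ℕ × ℂ)))
      → Multiset.Rel SameUpToInverse C C' := by
  induction C using Multiset.induction_on with
  | empty =>
    intro C' h
    rw [Multiset.zero_bind] at h
    have h1 : C' = 0 := by
      rw [Multiset.eq_zero_iff_forall_notMem]
      intro s hs
      obtain ⟨p, hp⟩ := cells_ne_nil s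
      have h2 : p ∈ (0 : Multiset (ℕ × ℂ)) := h ▸ Multiset.mem_bind.mpr ⟨s, hs, hp⟩
      exact Multiset.notMem_zero _ h2
    rw [h1]
    exact Multiset.Rel.zero
  | cons s C ih =>
    intro C' h
    obtain ⟨p, hp⟩ := cells_ne_nil s
    obtain ⟨s', hs', hps'⟩ := Multiset.mem_bind.mp
      (h ▸ Multiset.mem_bind.mpr ⟨s, Multiset.mem_cons_self _ _, hp⟩)
    obtain ⟨t, rfl⟩ := Multiset.exists_cons_of_mem hs'
    obtain ⟨h1, h2⟩ := sameUpToInverse_of_mem hp hps'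
    rw [Multiset.cons_bind, Multiset.cons_bind, Multiset.coe_eq_coe.mpr h2] at h
    exact Multiset.Rel.cons h1 (ih t (add_left_cancel h))

theorem realizes_of_sameUpToInverse {s s' : CongruenceSummand} (hs : SameUpToInverse s s')
    (W : Type) [AddCommGroup W] [Module ℂ W] (B : W →ₛₗ[RingHom.id ℂ] W →ₗ[ℂ] ℂ)
    (Φ : Module.End ℂ W) (h : IsCosquare (RingHom.id ℂ) B Φ) (hB : Realizes B s.toBlock.A) :
    Realizes B s'.toBlock.A := by
  rcases s with ⟨n, hn⟩ | ⟨n, hn⟩ | ⟨n, hn, c, hc, hc'⟩ <;>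
  rcases s' with ⟨n', hn'⟩ | ⟨n', hn'⟩ | ⟨n', hn', d, hd, hd'⟩ <;>
  simp only [SameUpToInverse, reduceCtorEq] at hs
  · cases hs; exact hB
  · cases hs; exact hB
  · obtain ⟨rfl, rfl | rfl⟩ := hs
    · exact hB
    · have hfd : FiniteDimensional ℂ W := by
        obtain ⟨b, -⟩ := hB
        exact b.finiteDimensional_of_finite
      obtain ⟨B', Φ', h', hB'⟩ := exists_isCosquare_realizes h.invol (isUnit_hMatrix n hd)
      have hJ := h.hasJordanBasis_hMatrix hc hn hB
      have hJ' : HasJordanBasis Φ' (fun _ : Bool => n) (fun s => if s then c else c⁻¹) := by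
        obtain ⟨b, hb⟩ := h'.hasJordanBasis_hMatrix hd hn hB'
        let e : (Σ _ : Bool, Fin n) ≃ Σ _ : Bool, Fin n :=
          ⟨fun p => ⟨!p.1, p.2⟩, fun p => ⟨!p.1, p.2⟩, fun p => by simp, fun p => by simp⟩
        have hbe : ∀ s i, b.reindex e ⟨s, i⟩ = b ⟨!s, i⟩ := fun s i => by
          rw [Module.Basis.reindex_apply]
          rfl
        refine ⟨b.reindex e, fun s i => ?_⟩
        simp only [hbe]
        rw [← hb]
        cases s <;> simp
      obtain ⟨φ, hφ⟩ := hJ.exists_equiv hJ'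
      exact Realizes.of_similar_id h h' φ hφ hB'

/-- Two nonsingular canonical forms are congruent only if their summands agree. -/
theorem starCongruent_blockSum_iff {C C' : List CongruenceSummand}
    (hC : IsUnit (blockSum C).A) :
    StarCongruent (id : ℂ → ℂ) (blockSum C).A (blockSum C').A ↔
      Multiset.Rel SameUpToInverse (C : Multiset CongruenceSummand)
        (C' : Multiset CongruenceSummand) := by
  classical
  obtain ⟨B, Φ, h, hB⟩ := exists_isCosquare_realizes (σ := RingHom.id ℂ) (fun _ => rfl) hC
  constructor
  · intro hCC'
    have hB' := Realizes.of_starCongruent (σ := RingHom.id ℂ) hCC' hB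
    have key : ∀ (D : List CongruenceSummand), Realizes B (blockSum D).A → ∀ (d : ℂ) (k : ℕ),
        Module.finrank ℂ (LinearMap.ker (shift Φ d ^ k)) =
          ((D.flatMap cells).map fun p => if p.2 = d then min k p.1 else 0).sum := by
      intro D hD d k
      rw [finrank_ker_listSum toBlock _ d k (fun s W _ _ _ B Φ h hB => s.finrank_ker h hB d k) D _
        B Φ h hD]
      clear hD
      induction D with
      | nil => rfl
      | cons s D ih =>
        rw [List.flatMap_cons, List.map_append, List.sum_append, List.map_cons, List.sum_cons, ih]
    have hp : (C.flatMap cells).Perm (C'.flatMap cells) := by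
      refine perm_of_sum_min ?_ ?_ fun d k => ?_
      · intro p hp
        obtain ⟨s, -, hs⟩ := List.mem_flatMap.mp hp
        exact one_le_of_mem_cells hs
      · intro p hp
        obtain ⟨s, -, hs⟩ := List.mem_flatMap.mp hp
        exact one_le_of_mem_cells hs
      · rw [← key C hB, ← key C' hB']
    refine rel_of_bind_cells_eq _ _ ?_
    rw [Multiset.coe_bind, Multiset.coe_bind]
    exact Multiset.coe_eq_coe.mpr hp
  · intro hr
    have hB' : Realizes B (blockSum C').A := Realizes.rel toBlock SameUpToInverse
      (fun s s' hs => realizes_of_sameUpToInverse hs) C C' hr _ B Φ h hB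
    exact hB.starCongruent hB'

end CongruenceSummand

/-! ### Uniqueness for sesquilinear forms -/

section index
variable {W : Type*} [AddCommGroup W] [Module ℂ W]

/-- The Hermitian index of the height pairing on the kernel of `(Φ - c) ^ m`, normalized by the
phase of `w`, equals `p`: there are a positive definite and a nonpositive subspace of
complementary dimensions, the first of dimension `p`. -/
def HasIndex (c : ℂ) (m : ℕ) (w : ℂ) (B : W →ₛₗ[starRingEnd ℂ] W →ₗ[ℂ] ℂ) (Φ : Module.End ℂ W)
    (p : ℕ) : Prop :=
  ∃ P Q : Submodule ℂ W, P ≤ LinearMap.ker (shift Φ c ^ m) ∧ Q ≤ LinearMap.ker (shift Φ c ^ m) ∧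
    (∀ x ∈ P, x ≠ 0 → 0 < (starRingEnd ℂ w * B ((shift Φ c ^ (m - 1)) x) x).re) ∧
    (∀ x ∈ Q, (starRingEnd ℂ w * B ((shift Φ c ^ (m - 1)) x) x).re ≤ 0) ∧
    Module.finrank ℂ P + Module.finrank ℂ Q =
      Module.finrank ℂ (LinearMap.ker (shift Φ c ^ m)) ∧
    Module.finrank ℂ P = p

variable {B : W →ₛₗ[starRingEnd ℂ] W →ₗ[ℂ] ℂ} {Φ : Module.End ℂ W} {c w : ℂ} {m : ℕ}

theorem HasIndex.le [FiniteDimensional ℂ W] {p p' : ℕ} (h : HasIndex c m w B Φ p)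
    (h' : HasIndex c m w B Φ p') : p ≤ p' := by
  obtain ⟨P, Q, hP, hQ, hPp, hQn, hd, rfl⟩ := h
  obtain ⟨P', Q', hP', hQ', hPp', hQn', hd', rfl⟩ := h'
  have h1 : P ⊓ Q' = ⊥ := by
    rw [eq_bot_iff]
    rintro x ⟨hx, hx'⟩
    by_contra hne
    exact absurd (hPp x hx hne) (not_lt.mpr (hQn' x hx'))
  have h2 := Submodule.finrank_sup_add_finrank_inf_eq P Q'
  rw [h1, finrank_bot, add_zero] at h2
  have h3 := Submodule.finrank_mono (sup_le hP hQ')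
  omega

theorem HasIndex.unique [FiniteDimensional ℂ W] {p p' : ℕ} (h : HasIndex c m w B Φ p)
    (h' : HasIndex c m w B Φ p') : p = p' := le_antisymm (h.le h') (h'.le h)

theorem HasIndex.of_nonpos (h : ∀ x, (shift Φ c ^ m) x = 0 →
    (starRingEnd ℂ w * B ((shift Φ c ^ (m - 1)) x) x).re ≤ 0) : HasIndex c m w B Φ 0 :=
  ⟨⊥, LinearMap.ker (shift Φ c ^ m), bot_le, le_rfl,
    fun x hx hx0 => absurd ((Submodule.mem_bot ℂ).mp hx) hx0, fun x hx => h x hx, by simp, by simp⟩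

/-- Inertia is additive over orthogonal stable decompositions. -/
theorem HasIndex.add [FiniteDimensional ℂ W] {X X' : Submodule ℂ W}
    (hX : IsRegularSubspace B Φ X) (hX' : IsRegularSubspace B Φ X') (hc : IsCompl X X')
    (h1 : ∀ x ∈ X, ∀ y ∈ X', B x y = 0) (h2 : ∀ x ∈ X, ∀ y ∈ X', B y x = 0) {p p' : ℕ}
    (h : HasIndex c m w (restrictForm B X) (Φ.restrict hX.stable) p)
    (h' : HasIndex c m w (restrictForm B X') (Φ.restrict hX'.stable) p') :
    HasIndex c m w B Φ (p + p') := by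
  obtain ⟨P, Q, hP, hQ, hPp, hQn, hd, rfl⟩ := h
  obtain ⟨P', Q', hP', hQ', hPp', hQn', hd', rfl⟩ := h'
  have hval : ∀ (x : X) (x' : X'),
      (starRingEnd ℂ w * B ((shift Φ c ^ (m - 1)) (x + x' : W)) (x + x')).re =
      (starRingEnd ℂ w * restrictForm B X ((shift (Φ.restrict hX.stable) c ^ (m - 1)) x) x).re +
      (starRingEnd ℂ w *
        restrictForm B X' ((shift (Φ.restrict hX'.stable) c ^ (m - 1)) x') x').re := by
    intro x x'
    have e1 := coe_shift_restrict_pow hX.stable c (m - 1) x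
    have e2 := coe_shift_restrict_pow hX'.stable c (m - 1) x'
    rw [restrictForm_apply, restrictForm_apply, e1, e2, map_add, map_add, map_add,
      LinearMap.add_apply, LinearMap.add_apply,
      h2 x x.2 ((shift Φ c ^ (m - 1)) (x' : W)) (e2 ▸ Subtype.property _),
      h1 ((shift Φ c ^ (m - 1)) (x : W)) (e1 ▸ Subtype.property _) x' x'.2, add_zero, zero_add,
      mul_add, Complex.add_re]
  refine ⟨P.map X.subtype ⊔ P'.map X'.subtype, Q.map X.subtype ⊔ Q'.map X'.subtype, ?_, ?_, ?_,
    ?_, ?_, finrank_map_sup_map hc P P'⟩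
  · rw [ker_shift_pow_eq_sup hc hX.stable hX'.stable]
    exact sup_le_sup (Submodule.map_mono hP) (Submodule.map_mono hP')
  · rw [ker_shift_pow_eq_sup hc hX.stable hX'.stable]
    exact sup_le_sup (Submodule.map_mono hQ) (Submodule.map_mono hQ')
  · intro y hy hy0
    obtain ⟨_, ⟨x, hx, rfl⟩, _, ⟨x', hx', rfl⟩, rfl⟩ := Submodule.mem_sup.mp hy
    simp only [Submodule.subtype_apply] at hy0 ⊢
    rw [hval]
    by_cases hx0 : x = 0
    · have hx0' : x' ≠ 0 := by
        rintro rfl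
        exact hy0 (by simp [hx0])
      rw [hx0, map_zero, mul_zero, Complex.zero_re, zero_add]
      exact hPp' x' hx' hx0'
    · by_cases hx0' : x' = 0
      · rw [hx0', map_zero, mul_zero, Complex.zero_re, add_zero]
        exact hPp x hx hx0
      · exact add_pos (hPp x hx hx0) (hPp' x' hx' hx0')
  · intro y hy
    obtain ⟨_, ⟨x, hx, rfl⟩, _, ⟨x', hx', rfl⟩, rfl⟩ := Submodule.mem_sup.mp hy
    simp only [Submodule.subtype_apply]
    rw [hval]
    exact add_nonpos (hQn x hx) (hQn' x' hx')
  · rw [finrank_map_sup_map hc, finrank_map_sup_map hc,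
      finrank_ker_shift_pow hc hX.stable hX'.stable, ← hd, ← hd']
    ring

/-- On a single Jordan cell of size `n`, the height pairing of level `m ≠ n` vanishes. -/
theorem HasIndex.of_cell_ne [FiniteDimensional ℂ W] (h : IsCosquare (starRingEnd ℂ) B Φ)
    (hc0 : c ≠ 0) (hc : (starRingEnd ℂ c)⁻¹ = c) {n : ℕ}
    (hJ : HasJordanBasis Φ (fun _ : Unit => n) (fun _ => c)) (hm : 1 ≤ m) (hnm : n ≠ m) :
    HasIndex c m w B Φ 0 := by
  have hk : ∀ k, Module.finrank ℂ (LinearMap.ker (shift Φ c ^ k)) = min k n := fun k => by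
    rw [hJ.finrank_ker]
    simp
  have hW : Module.finrank ℂ W = n := by
    obtain ⟨b, -⟩ := hJ
    rw [Module.finrank_eq_card_basis b]
    simp
  have hN : ∀ k, n ≤ k → shift Φ c ^ k = 0 := fun k hk' => by
    rw [← LinearMap.ker_eq_top]
    exact Submodule.eq_top_of_finrank_eq (by rw [hk, hW]; omega)
  refine HasIndex.of_nonpos fun x hx => le_of_eq ?_
  rcases lt_or_gt_of_ne hnm with hlt | hgt
  · rw [hN (m - 1) (by omega)]
    simp
  · have hr : LinearMap.range (shift Φ c ^ (n - m)) = LinearMap.ker (shift Φ c ^ m) := by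
      refine Submodule.eq_of_le_of_finrank_eq ?_ ?_
      · rintro _ ⟨y, rfl⟩
        rw [LinearMap.mem_ker, ← Module.End.mul_apply, ← pow_add, hN _ (by omega)]
        rfl
      · have h1 := LinearMap.finrank_range_add_finrank_ker (shift Φ c ^ (n - m))
        rw [hk, hW] at h1
        rw [hk]
        omega
    obtain ⟨y, rfl⟩ : x ∈ LinearMap.range (shift Φ c ^ (n - m)) := hr ▸ hx
    rw [h.adjoint_pow hc0, hc, ← Module.End.mul_apply, ← Module.End.mul_apply, ← pow_add, ← pow_add,
      hN _ (by omega)]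
    simp

theorem HasIndex.of_finrank_eq_zero [FiniteDimensional ℂ W]
    (h : Module.finrank ℂ (LinearMap.ker (shift Φ c ^ m)) = 0) : HasIndex c m w B Φ 0 := by
  refine HasIndex.of_nonpos fun x hx => le_of_eq ?_
  have h1 : x ∈ (⊥ : Submodule ℂ W) := by
    rw [← Submodule.finrank_eq_zero.mp h]
    exact hx
  rw [(Submodule.mem_bot ℂ).mp h1]
  simp

theorem apply_smul_smul (f : Module.End ℂ W) (a : ℂ) (u : W) :
    B (f (a • u)) (a • u) = ((‖a‖ ^ 2 : ℝ) : ℂ) * B (f u) u := by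
  rw [map_smul f, map_smul (B _), map_smulₛₗ B, LinearMap.smul_apply, smul_eq_mul, smul_eq_mul,
    ← mul_assoc, Complex.mul_conj, Complex.normSq_eq_norm_sq]

/-- On a single Jordan cell with generator `u`, the height pairing of level `n` is determined by
its value at `u`. -/
theorem exists_height_eq [FiniteDimensional ℂ W] (h : IsCosquare (starRingEnd ℂ) B Φ)
    (hc0 : c ≠ 0) (hc : (starRingEnd ℂ c)⁻¹ = c) (hm : 1 ≤ m)
    (hW : Module.finrank ℂ W = m) {u : W} (hu : (shift Φ c ^ m) u = 0)
    (hg : B ((shift Φ c ^ (m - 1)) u) u ≠ 0) (x : W) :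
    ∃ (a : ℂ) (y : W), x = a • u + shift Φ c y ∧ B ((shift Φ c ^ (m - 1)) x) x =
      ((‖a‖ ^ 2 : ℝ) : ℂ) * B ((shift Φ c ^ (m - 1)) u) u := by
  have hJ := h.hasJordanBasis_of_generator hc0 hc hW hu hg
  have hk : ∀ k, Module.finrank ℂ (LinearMap.ker (shift Φ c ^ k)) = min k m := fun k => by
    rw [hJ.finrank_ker]
    simp
  have hN : shift Φ c ^ m = 0 := by
    rw [← LinearMap.ker_eq_top]
    exact Submodule.eq_top_of_finrank_eq (by rw [hk, hW]; omega)
  have hBN : ∀ x y, B ((shift Φ c ^ (m - 1)) x) (shift Φ c y) = 0 := fun x y => by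
    rw [h.adjoint hc0, hc, ← Module.End.mul_apply, ← pow_succ', Nat.sub_add_cancel hm, hN]
    simp
  have hNB : ∀ y, (shift Φ c ^ (m - 1)) (shift Φ c y) = 0 := fun y => by
    rw [← Module.End.mul_apply, ← pow_succ, Nat.sub_add_cancel hm, hN]
    rfl
  have hsup : Submodule.span ℂ {u} ⊔ LinearMap.range (shift Φ c) = ⊤ := by
    apply Submodule.eq_top_of_finrank_eq
    have hu0 : u ≠ 0 := by
      rintro rfl
      simp at hg
    have h1 := Submodule.finrank_sup_add_finrank_inf_eq (Submodule.span ℂ {u})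
      (LinearMap.range (shift Φ c))
    have h2 : Submodule.span ℂ {u} ⊓ LinearMap.range (shift Φ c) = ⊥ := by
      rw [eq_bot_iff]
      rintro _ ⟨hx, y, rfl⟩
      obtain ⟨a, ha⟩ := Submodule.mem_span_singleton.mp hx
      have h3 := hBN u y
      rw [← ha, map_smul, smul_eq_mul, mul_eq_zero] at h3
      rw [Submodule.mem_bot, ← ha, h3.resolve_right hg, zero_smul]
    rw [h2, finrank_bot, add_zero, finrank_span_singleton hu0] at h1
    have h3 := LinearMap.finrank_range_add_finrank_ker (shift Φ c)
    have h4 := hk 1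
    rw [pow_one] at h4
    rw [h4, hW] at h3
    omega
  obtain ⟨_, hx1, _, ⟨y, rfl⟩, rfl⟩ := Submodule.mem_sup.mp (hsup ▸ Submodule.mem_top (x := x))
  obtain ⟨a, rfl⟩ := Submodule.mem_span_singleton.mp hx1
  refine ⟨a, y, rfl, ?_⟩
  rw [map_add (shift Φ c ^ (m - 1)), hNB, add_zero, map_add, hBN, add_zero, apply_smul_smul]

theorem conj_mul_ofReal_mul_re (w : ℂ) (t : ℝ) :
    (starRingEnd ℂ w * ((t : ℂ) * w)).re = t * ‖w‖ ^ 2 := by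
  have h1 : starRingEnd ℂ w * ((t : ℂ) * w) = ((t * ‖w‖ ^ 2 : ℝ) : ℂ) := by
    rw [mul_left_comm, mul_comm _ w, Complex.mul_conj, Complex.normSq_eq_norm_sq]
    push_cast
    ring
  rw [h1, Complex.ofReal_re]

/-- A single cell whose generator has the height pairing `w` has index `1`: the generator spans a
positive definite line, and the height pairing vanishes on the range of `Φ - c`. -/
theorem HasIndex.one [FiniteDimensional ℂ W] (h : IsCosquare (starRingEnd ℂ) B Φ)
    (hc0 : c ≠ 0) (hc : (starRingEnd ℂ c)⁻¹ = c) (hm : 1 ≤ m) (hW : Module.finrank ℂ W = m)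
    (hw : w ≠ 0) {u : W} (hu : (shift Φ c ^ m) u = 0)
    (hg : B ((shift Φ c ^ (m - 1)) u) u = w) : HasIndex c m w B Φ 1 := by
  have hg0 : B ((shift Φ c ^ (m - 1)) u) u ≠ 0 := by rw [hg]; exact hw
  have hJ := h.hasJordanBasis_of_generator hc0 hc hW hu hg0
  have hk : ∀ k, Module.finrank ℂ (LinearMap.ker (shift Φ c ^ k)) = min k m := fun k => by
    rw [hJ.finrank_ker]
    simp
  have hN : shift Φ c ^ m = 0 := by
    rw [← LinearMap.ker_eq_top]
    exact Submodule.eq_top_of_finrank_eq (by rw [hk, hW]; omega)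
  have hu0 : u ≠ 0 := by
    rintro rfl
    simp at hg0
  refine ⟨Submodule.span ℂ {u}, LinearMap.range (shift Φ c), ?_, ?_, ?_, ?_, ?_,
    finrank_span_singleton hu0⟩
  · rw [hN, LinearMap.ker_zero]
    exact le_top
  · rw [hN, LinearMap.ker_zero]
    exact le_top
  · intro x hx hx0
    obtain ⟨a, rfl⟩ := Submodule.mem_span_singleton.mp hx
    have ha : a ≠ 0 := by
      rintro rfl
      exact hx0 (zero_smul _ _)
    rw [apply_smul_smul, hg, conj_mul_ofReal_mul_re]
    have := norm_pos_iff.mpr ha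
    have := norm_pos_iff.mpr hw
    positivity
  · rintro _ ⟨y, rfl⟩
    rw [← Module.End.mul_apply, ← pow_succ, Nat.sub_add_cancel hm, hN]
    simp
  · have h3 := LinearMap.finrank_range_add_finrank_ker (shift Φ c)
    have h4 := hk 1
    rw [pow_one] at h4
    rw [h4, hW] at h3
    rw [finrank_span_singleton hu0, hk]
    omega

theorem HasIndex.of_neg [FiniteDimensional ℂ W] (h : IsCosquare (starRingEnd ℂ) B Φ)
    (hc0 : c ≠ 0) (hc : (starRingEnd ℂ c)⁻¹ = c) (hm : 1 ≤ m) (hW : Module.finrank ℂ W = m)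
    (hw : w ≠ 0) {u : W} (hu : (shift Φ c ^ m) u = 0)
    (hg : B ((shift Φ c ^ (m - 1)) u) u = -w) : HasIndex c m w B Φ 0 := by
  refine HasIndex.of_nonpos fun x _ => ?_
  obtain ⟨a, y, -, hx⟩ := exists_height_eq h hc0 hc hm hW hu
    (by rw [hg]; exact neg_ne_zero.mpr hw) x
  rw [hx, hg, mul_neg, mul_neg, Complex.neg_re, conj_mul_ofReal_mul_re]
  have := norm_nonneg a
  have := norm_nonneg w
  have : 0 ≤ ‖a‖ ^ 2 * ‖w‖ ^ 2 := by positivity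
  linarith

end index

namespace StarCongruenceSummand
variable {T : ∀ n, Matrix (Fin n) (Fin n) ℂ}

theorem sum_map_ite [DecidableEq StarCongruenceSummand] (C : List StarCongruenceSummand)
    (s : StarCongruenceSummand) : (C.map fun t => if t = s then 1 else 0).sum = C.count s := by
  induction C with
  | nil => rfl
  | cons t C ih =>
    rw [List.map_cons, List.sum_cons, ih, List.count_cons, add_comm]
    simp

/-- The matrix `a T_n` is antitriangular for the eigenvalue `a ^ 2 l`, where `l` is the eigenvalue
for `T_n`. -/
theorem exists_isAntitriangular_smul (hT : T = gammaMatrix ∨ T = deltaMatrix) (n : ℕ) :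
    ∃ l : ℂ, ‖l‖ = 1 ∧ ∀ a : ℂ, ‖a‖ = 1 →
      IsAntitriangular (starRingEnd ℂ) (a ^ 2 * l) (a • T n) := by
  obtain ⟨l, hl1, hl⟩ := exists_isAntitriangular hT n
  refine ⟨l, hl1, fun a ha => ?_⟩
  rw [← div_conj_of_norm_one ha]
  exact hl.smul (norm_ne_zero_iff.mp (by rw [ha]; exact one_ne_zero))

/-- The contribution of a summand to the dimension of the kernel of `(Φ - d) ^ k`, if `1 < ‖d‖`. -/
noncomputable def kerDim (d : ℂ) (k : ℕ) : StarCongruenceSummand → ℕ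
  | h n _ c _ => open Classical in if c = d then min k n else 0
  | _ => 0

theorem finrank_ker_eq_kerDim (hT : T = gammaMatrix ∨ T = deltaMatrix) {d : ℂ} (hd : 1 < ‖d‖)
    (k : ℕ) (s : StarCongruenceSummand) {W : Type} [AddCommGroup W] [Module ℂ W]
    {B : W →ₛₗ[starRingEnd ℂ] W →ₗ[ℂ] ℂ} {Φ : Module.End ℂ W}
    (hΦ : IsCosquare (starRingEnd ℂ) B Φ) (hB : Realizes B (s.toBlock T).A) :
    Module.finrank ℂ (LinearMap.ker (shift Φ d ^ k)) =
      s.kerDim d k := by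
  rcases s with ⟨n, hn⟩ | ⟨n, hn, a, ha⟩ | ⟨n, hn, c, hc⟩
  · exact absurd hB (not_realizes_jordanBlock_zero hΦ hn)
  · obtain ⟨l, hl, hl'⟩ := exists_isAntitriangular_smul hT n
    have h1 : ‖a ^ 2 * l‖ = 1 := by rw [norm_mul, norm_pow, ha, hl]; norm_num
    have h0 : a ^ 2 * l ≠ 0 := norm_ne_zero_iff.mp (by rw [h1]; exact one_ne_zero)
    have hJ := (hl' a ha).hasJordanBasis hn h0 ((inv_conj_eq_self_iff h0).mpr h1) hΦ hB
    rw [hJ.finrank_ker]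
    refine Finset.sum_eq_zero fun _ _ => if_neg ?_
    rintro rfl
    linarith
  · have hc0 : c ≠ 0 := norm_pos_iff.mp (by linarith)
    have hJ := hΦ.hasJordanBasis_hMatrix hc0 hn hB
    rw [hJ.finrank_ker, Fintype.sum_bool]
    have h1 : (starRingEnd ℂ c)⁻¹ ≠ d := by
      rintro rfl
      rw [norm_inv, RCLike.norm_conj] at hd
      have := inv_lt_one_of_one_lt₀ hc
      linarith
    simp [kerDim, h1]

theorem two_mul_sum_kerDim [DecidableEq StarCongruenceSummand] (C : List StarCongruenceSummand)
    {m : ℕ} (hm : 1 ≤ m) {d : ℂ} (hd : 1 < ‖d‖) :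
    2 * (C.map (kerDim d m)).sum =
      (C.map (kerDim d (m - 1))).sum + (C.map (kerDim d (m + 1))).sum +
      C.count (h m hm d hd) := by
  induction C with
  | nil => rfl
  | cons s C ih =>
    have h1 : 2 * s.kerDim d m = s.kerDim d (m - 1) + s.kerDim d (m + 1) +
        if (s == h m hm d hd) = true then 1 else 0 := by
      rcases s with ⟨n, hn⟩ | ⟨n, hn, a, ha⟩ | ⟨n, hn, c, hc⟩
      · simp [kerDim]
      · simp [kerDim]
      · simp only [kerDim, beq_iff_eq, h.injEq]
        by_cases hcd : c = d
        · simp only [hcd, if_true, and_true]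
          split_ifs <;> omega
        · simp [hcd]
    simp only [List.map_cons, List.sum_cons, List.count_cons]
    omega

/-- Each unimodular summand `a T_m` has an index that is `1` on it and `0` on all other canonical
summands. The summand `-a T_m` is the only other one whose cosquare has the same Jordan cell; its
height pairing is negative. -/
theorem hasIndex_toBlock [DecidableEq StarCongruenceSummand]
    (hT : T = gammaMatrix ∨ T = deltaMatrix) {m : ℕ} (hm : 1 ≤ m) {a : ℂ} (ha : ‖a‖ = 1) :
    ∃ c w : ℂ, ∀ (s : StarCongruenceSummand) (W : Type) [AddCommGroup W] [Module ℂ W]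
      [FiniteDimensional ℂ W] (B : W →ₛₗ[starRingEnd ℂ] W →ₗ[ℂ] ℂ) (Φ : Module.End ℂ W),
      IsCosquare (starRingEnd ℂ) B Φ → Realizes B (s.toBlock T).A →
      HasIndex c m w B Φ (if s = unimodular m hm a ha then 1 else 0) := by
  obtain ⟨l, hl, hl'⟩ := exists_isAntitriangular_smul hT m
  have h1 : ‖a ^ 2 * l‖ = 1 := by rw [norm_mul, norm_pow, ha, hl]; norm_num
  have h0 : a ^ 2 * l ≠ 0 := norm_ne_zero_iff.mp (by rw [h1]; exact one_ne_zero)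
  have hc := (inv_conj_eq_self_iff h0).mpr h1
  have hl0 : l ≠ 0 := norm_ne_zero_iff.mp (by rw [hl]; exact one_ne_zero)
  have ha0 : a ≠ 0 := norm_ne_zero_iff.mp (by rw [ha]; exact one_ne_zero)
  obtain ⟨w, hw, hw'⟩ := (hl' a ha).exists_value hm
  refine ⟨a ^ 2 * l, w, fun s W _ _ _ B Φ hΦ hB => ?_⟩
  rcases s with ⟨n, hn⟩ | ⟨n, hn, a', ha'⟩ | ⟨n, hn, c, hc⟩
  · exact absurd hB (not_realizes_jordanBlock_zero hΦ hn)
  · obtain ⟨l', hln, hl''⟩ := exists_isAntitriangular_smul hT n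
    have h1' : ‖a' ^ 2 * l'‖ = 1 := by rw [norm_mul, norm_pow, ha', hln]; norm_num
    have h0' : a' ^ 2 * l' ≠ 0 := norm_ne_zero_iff.mp (by rw [h1']; exact one_ne_zero)
    have hJ := (hl'' a' ha').hasJordanBasis hn h0' ((inv_conj_eq_self_iff h0').mpr h1') hΦ hB
    by_cases hnm : n = m
    · subst hnm
      by_cases haa : a' = a
      · subst haa
        rw [if_pos rfl]
        obtain ⟨b, hb⟩ : Realizes B (a' • T n) := hB
        obtain ⟨u, hu, hg⟩ := hw' W B Φ hΦ b hb
        exact HasIndex.one hΦ h0 hc hm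
          (by rw [Module.finrank_eq_card_basis b, Fintype.card_fin]) hw hu hg
      · rw [if_neg (by simp [haa])]
        by_cases haa' : a' = -a
        · -- `-B` has the same cosquare and the matrix `a T_n`
          subst haa'
          obtain ⟨b, hb⟩ : Realizes B ((-a) • T n) := hB
          have hΦ' : IsCosquare (starRingEnd ℂ) (-B) Φ := by
            refine ⟨hΦ.invol, fun x y => ?_, fun y hy => hΦ.right_sep y fun x => ?_⟩
            · rw [LinearMap.neg_apply, LinearMap.neg_apply, LinearMap.neg_apply,
                LinearMap.neg_apply, map_neg, hΦ.apply x]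
            · exact neg_eq_zero.mp (hy x)
          obtain ⟨u, hu, hg⟩ := hw' W (-B) Φ hΦ' b fun i j => by
            rw [LinearMap.neg_apply, LinearMap.neg_apply, hb, neg_smul, Matrix.neg_apply, neg_neg]
          rw [LinearMap.neg_apply, LinearMap.neg_apply] at hg
          exact HasIndex.of_neg hΦ h0 hc hm
            (by rw [Module.finrank_eq_card_basis b, Fintype.card_fin]) hw hu (by rw [← hg, neg_neg])
        · refine HasIndex.of_finrank_eq_zero ?_
          have hJ' := (hl' a' ha').hasJordanBasis hn (mul_ne_zero (pow_ne_zero _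
            (norm_ne_zero_iff.mp (by rw [ha']; exact one_ne_zero))) hl0)
            ((inv_conj_eq_self_iff (mul_ne_zero (pow_ne_zero _
            (norm_ne_zero_iff.mp (by rw [ha']; exact one_ne_zero))) hl0)).mpr
            (by rw [norm_mul, norm_pow, ha', hl]; norm_num)) hΦ hB
          rw [hJ'.finrank_ker]
          refine Finset.sum_eq_zero fun _ _ => if_neg fun h2 => ?_
          rcases sq_eq_sq_iff_eq_or_eq_neg.mp (mul_right_cancel₀ hl0 h2) with h3 | h3
          · exact haa h3
          · exact haa' h3
    · rw [if_neg (by simp [hnm])]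
      by_cases hcc : a' ^ 2 * l' = a ^ 2 * l
      · rw [hcc] at hJ
        exact HasIndex.of_cell_ne hΦ h0 hc hJ hm hnm
      · refine HasIndex.of_finrank_eq_zero ?_
        rw [hJ.finrank_ker]
        exact Finset.sum_eq_zero fun _ _ => if_neg hcc
  · rw [if_neg (by simp)]
    refine HasIndex.of_finrank_eq_zero ?_
    have hc0 : c ≠ 0 := norm_pos_iff.mp (by linarith)
    have hJ := hΦ.hasJordanBasis_hMatrix hc0 hn hB
    rw [hJ.finrank_ker]
    refine Finset.sum_eq_zero fun s _ => if_neg fun h2 => ?_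
    have h3 := congr_arg norm h2
    rw [h1] at h3
    cases s
    · have := inv_lt_one_of_one_lt₀ hc
      simp only [Bool.false_eq_true, if_false] at h3
      rw [norm_inv, RCLike.norm_conj] at h3
      linarith
    · simp only [if_true] at h3
      linarith

/-- A nondegenerate form determines the multiplicity of each canonical summand. -/
theorem count_eq [DecidableEq StarCongruenceSummand] (hT : T = gammaMatrix ∨ T = deltaMatrix)
    {W : Type} [AddCommGroup W] [Module ℂ W] [FiniteDimensional ℂ W]
    {B : W →ₛₗ[starRingEnd ℂ] W →ₗ[ℂ] ℂ} {Φ : Module.End ℂ W}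
    (hΦ : IsCosquare (starRingEnd ℂ) B Φ) {C C' : List StarCongruenceSummand}
    (hC : Realizes B (blockSum T C).A) (hC' : Realizes B (blockSum T C').A)
    (s : StarCongruenceSummand) : C.count s = C'.count s := by
  rcases s with ⟨n, hn⟩ | ⟨n, hn, a, ha⟩ | ⟨n, hn, c, hc⟩
  · have key : ∀ D, Realizes B (blockSum T D).A → D.count (jordan n hn) = 0 := by
      intro D hD
      rw [← sum_map_ite]
      refine invariant_listSum (toBlock T) _ (fun _ _ _ _ _ p => p = 0) ?_ ?_ ?_ D W B Φ hΦ hD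
      · intro W _ _ _ B Φ X X' hX hX' hc h1 h2 p p' hp hp'
        rw [hp, hp']
      · intro W _ _ _ B Φ
        rfl
      · intro s W _ _ _ B Φ hΦ hB
        refine if_neg ?_
        rintro rfl
        exact not_realizes_jordanBlock_zero hΦ hn hB
    rw [key C hC, key C' hC']
  · obtain ⟨c, w, hcw⟩ := hasIndex_toBlock hT hn ha
    have key : ∀ D, Realizes B (blockSum T D).A →
        HasIndex c n w B Φ (D.count (unimodular n hn a ha)) := by
      intro D hD
      rw [← sum_map_ite]
      refine invariant_listSum (toBlock T) _ (fun _ _ _ B Φ p => HasIndex c n w B Φ p) ?_ ?_ hcw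
        D W B Φ hΦ hD
      · intro W _ _ _ B Φ X X' hX hX' hc h1 h2 p p' hp hp'
        exact HasIndex.add hX hX' hc h1 h2 hp hp'
      · intro W _ _ _ B Φ
        refine HasIndex.of_nonpos fun x _ => ?_
        rw [Subsingleton.elim x 0]
        simp
    exact (key C hC).unique (key C' hC')
  · have key : ∀ (D : List StarCongruenceSummand) (k : ℕ), Realizes B (blockSum T D).A →
        Module.finrank ℂ (LinearMap.ker (shift Φ c ^ k)) = (D.map (kerDim c k)).sum :=
      fun D k hD => finrank_ker_listSum (toBlock T) _ c k
        (fun s W _ _ _ B Φ hΦ hB => finrank_ker_eq_kerDim hT hc k s hΦ hB) D W B Φ hΦ hD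
    have h1 := two_mul_sum_kerDim C hn hc
    have h2 := two_mul_sum_kerDim C' hn hc
    simp only [← key C _ hC] at h1
    simp only [← key C' _ hC'] at h2
    omega

theorem starCongruent_blockSum_iff (hT : T = gammaMatrix ∨ T = deltaMatrix)
    {C C' : List StarCongruenceSummand} (hC : IsUnit (blockSum T C).A) :
    StarCongruent (star : ℂ → ℂ) (blockSum T C).A (blockSum T C').A ↔ C.Perm C' := by
  classical
  obtain ⟨B, Φ, h, hB⟩ := exists_isCosquare_realizes (σ := starRingEnd ℂ) Complex.conj_conj hC
  constructor
  · intro hCC'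
    have hB' := Realizes.of_starCongruent (σ := starRingEnd ℂ) hCC' hB
    rw [List.perm_iff_count]
    exact count_eq hT h hB hB'
  · intro hp
    have hB' : Realizes B (blockSum T C').A := Realizes.perm (hp.map (toBlock T)) _ B Φ h hB
    exact hB.starCongruent hB'

end StarCongruenceSummand

/-! ### Canonical matrices -/

theorem isEmpty_listSum_κ {S : Type} (block : S → BlockMatrix ℂ) (hb : ∀ s, IsEmpty (block s).κ)
    (C : List S) : IsEmpty (BlockMatrix.listSum (C.map block)).κ := by
  induction C with
  | nil => exact inferInstanceAs (IsEmpty (Fin 0))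
  | cons s C ih =>
    have := hb s
    exact inferInstanceAs (IsEmpty ((block s).κ ⊕ (BlockMatrix.listSum (C.map block)).κ))

instance isEmpty_regular_κ {F : Type*} [Zero F] {ι : Type} [Fintype ι] [DecidableEq ι]
    (K : Matrix ι ι F) : IsEmpty (BlockMatrix.regular K).κ :=
  inferInstanceAs (IsEmpty (Fin 0))

instance CongruenceSummand.isEmpty_blockSum_κ (C : List CongruenceSummand) :
    IsEmpty (blockSum C).κ :=
  isEmpty_listSum_κ _ (fun s => by cases s <;> exact isEmpty_regular_κ _) C

instance StarCongruenceSummand.isEmpty_blockSum_κ (T : ∀ n, Matrix (Fin n) (Fin n) ℂ)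
    (C : List StarCongruenceSummand) : IsEmpty (blockSum T C).κ :=
  isEmpty_listSum_κ _ (fun s => by cases s <;> exact isEmpty_regular_κ _) C

theorem isInvolution_id : IsInvolution (id : ℂ → ℂ) :=
  ⟨fun _ _ => rfl, fun a b => mul_comm a b, fun _ => rfl⟩

theorem isInvolution_star : IsInvolution (star : ℂ → ℂ) :=
  ⟨star_add, star_mul, star_star⟩

/-- First part: the regularizing decomposition over an arbitrary field or skew field with
involution. Second and third part: the canonical matrices over `ℂ`, for bilinear forms
(identity involution) and for sesquilinear forms (complex conjugation). -/
theorem theorem3 :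
    (∀ {F : Type*} [DivisionRing F] (σ : F → F), IsInvolution σ →
      ∀ {V : Type*} [AddCommGroup V] [Module Fᵐᵒᵖ V] [Module.Finite Fᵐᵒᵖ V]
        (U : Submodule Fᵐᵒᵖ V) (G : SubspaceForm σ U),
        ∃ (p : ℕ) (K : Matrix (Fin p) (Fin p) F) (L : List SingularSummand),
          IsUnit K ∧
          G.HasMatrix ((BlockMatrix.regular K).sum (singularSum F L)) ∧
          ∀ (p' : ℕ) (K' : Matrix (Fin p') (Fin p') F) (L' : List SingularSummand),
            (IsUnit K' ∧ G.HasMatrix ((BlockMatrix.regular K').sum (singularSum F L'))) ↔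
              (StarCongruent σ K K' ∧ L.Perm L')) ∧
    (∀ {V : Type*} [AddCommGroup V] [Module ℂᵐᵒᵖ V] [Module.Finite ℂᵐᵒᵖ V]
        (U : Submodule ℂᵐᵒᵖ V) (G : SubspaceForm (id : ℂ → ℂ) U)
        (p : ℕ) (K : Matrix (Fin p) (Fin p) ℂ) (L : List SingularSummand),
        IsUnit K → G.HasMatrix ((BlockMatrix.regular K).sum (singularSum ℂ L)) →
        ∃ C : List CongruenceSummand,
          StarCongruent (id : ℂ → ℂ) K (CongruenceSummand.blockSum C).A ∧
          G.HasMatrix ((CongruenceSummand.blockSum C).sum (singularSum ℂ L)) ∧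
          ∀ (C' : List CongruenceSummand) (L' : List SingularSummand),
            (IsUnit (CongruenceSummand.blockSum C').A ∧
              G.HasMatrix ((CongruenceSummand.blockSum C').sum (singularSum ℂ L'))) ↔
              (Multiset.Rel CongruenceSummand.SameUpToInverse
                (C : Multiset CongruenceSummand) (C' : Multiset CongruenceSummand) ∧
                L.Perm L')) ∧
    (∀ T : ∀ n, Matrix (Fin n) (Fin n) ℂ, T = gammaMatrix ∨ T = deltaMatrix →
      ∀ {V : Type*} [AddCommGroup V] [Module ℂᵐᵒᵖ V] [Module.Finite ℂᵐᵒᵖ V]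
        (U : Submodule ℂᵐᵒᵖ V) (G : SubspaceForm (star : ℂ → ℂ) U)
        (p : ℕ) (K : Matrix (Fin p) (Fin p) ℂ) (L : List SingularSummand),
        IsUnit K → G.HasMatrix ((BlockMatrix.regular K).sum (singularSum ℂ L)) →
        ∃ C : List StarCongruenceSummand,
          StarCongruent (star : ℂ → ℂ) K (StarCongruenceSummand.blockSum T C).A ∧
          G.HasMatrix ((StarCongruenceSummand.blockSum T C).sum (singularSum ℂ L)) ∧
          ∀ (C' : List StarCongruenceSummand) (L' : List SingularSummand),
            (IsUnit (StarCongruenceSummand.blockSum T C').A ∧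
              G.HasMatrix ((StarCongruenceSummand.blockSum T C').sum (singularSum ℂ L'))) ↔
              (C.Perm C' ∧ L.Perm L')) := by
  refine ⟨?_, ?_, ?_⟩
  · intro F _ σ hσ V _ _ _ U G
    obtain ⟨p, K, L, hK, H⟩ := exists_hasMatrix hσ G
    exact ⟨p, K, L, hK, H, fun p' K' L' =>
      hasMatrix_iff hσ G (BlockMatrix.regular K) (BlockMatrix.regular K') L L' hK H⟩
  · intro V _ _ _ U G p K L hK H
    obtain ⟨C, hC⟩ := exists_congruent_blockSum hK
    obtain ⟨hCu, hCH⟩ := (hasMatrix_iff isInvolution_id G (BlockMatrix.regular K)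
      (CongruenceSummand.blockSum C) L L hK H).mpr ⟨hC, List.Perm.refl L⟩
    refine ⟨C, hC, hCH, fun C' L' => ?_⟩
    rw [← CongruenceSummand.starCongruent_blockSum_iff hCu]
    exact hasMatrix_iff isInvolution_id G _ _ L L' hCu hCH
  · intro T hT V _ _ _ U G p K L hK H
    obtain ⟨C, hC⟩ := exists_starCongruent_blockSum hT hK
    obtain ⟨hCu, hCH⟩ := (hasMatrix_iff isInvolution_star G (BlockMatrix.regular K)
      (StarCongruenceSummand.blockSum T C) L L hK H).mpr ⟨hC, List.Perm.refl L⟩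
    refine ⟨C, hC, hCH, fun C' L' => ?_⟩
    rw [← StarCongruenceSummand.starCongruent_blockSum_iff hT hCu]
    exact hasMatrix_iff isInvolution_star G _ _ L L' hCu hCH
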